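/- Let $f,g:\mathbb R\to\mathbb R$ be $C^\infty$ and consider the scalar balance law $$\partial_t u+\partial_x(f(u))=g(u),\qquad t\ge 0,\ x\in\mathbb R. \tag{E}$$ **Definitions.** For $x\in\mathbb R$ write $x_+=\max(x,0)$, and for $\kappa\in\mathbb R$ set $\Omega_\kappa^+(x)=e^{-\kappa x_+}$. $BUC^0(\mathbb R)$ is the space of bounded uniformly continuous functions, and $BUC^1(\mathbb R)$ the space of $C^1$ functions $v$ with $v,\partial_xv\in BUC^0(\mathbb R)$. A *sub-exponential weight* is a nonincreasing function $\rho:[0,\infty)\to(0,\infty)$, converging to $0$ at $+\infty$, such that there exist $\omega,C>0$ with $Ce^{-\omega t}\le\rho(t)$ for all $t\ge0$, and there exist $\omega,C>0$ with $\int_0^te^{-\omega(t-s)}\rho(s)\,ds\le C\rho(t)$ for all $t\ge0$. For $C^1$ functions $v$, set, in $[0,+\infty]$, $$\|v\|_{W^{1,\infty}_{\kappa,+}}=\big\|(\Omega_\kappa^+)^{-1}(v,\partial_xv)\big\|_{L^\infty(\mathbb R)},\qquad \|v\|_{W^{1,\infty}_{+,\rho}}=\big\|(\rho(\cdot_+)\,\Omega^+_{\kappa^+})^{-1}(v,\partial_xv)\big\|_{L^\infty(\mathbb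 R)},$$ with $\kappa^+$ as below. An *entropy solution* of (E) with initial datum $u_0$ is a measurable function on $(0,\infty)\times\mathbb R$, essentially bounded on $(0,T)\times\mathbb R$ for every $T>0$, such that for all $k\in\mathbb R$ and all nonnegative $\varphi\in C^\infty_c(\mathbb R^2)$ $$\int_0^\infty\!\!\int_{\mathbb R}\Big(|u-k|\,\partial_t\varphi+\operatorname{sgn}(u-k)(f(u)-f(k))\,\partial_x\varphi+\operatorname{sgn}(u-k)\,g(u)\,\varphi\Big)dx\,dt+\int_{\mathbb R}|u_0-k|\,\varphi(0,\cdot)\,dx\ge0 .$$ **Theorem.** Let $(t,x)\mapsto\underline u(x-\sigma t)$ be a solution of (E) with $\underline u\in C^\infty(\mathbb R)$, $\lim_{-\infty}\underline u=u_-$ and $\lim_{+\infty}\underline u=u_+$. Assume that this wave is non-characteristic, that is, $f'\ne\sigma$ at every value of $\underline u$ and at $u_\pm$, and that $g'(u_-)<0<g'(u_+)$. Set $\kappa^+:=g'(u_+)/|f'(u_+)-\sigma|$. There exists $\delta_0>0$, and for every sub-exponential weight $\rho$ there exist $C_\rho,\theta_\rho>0$, such that the following holds. Let $u_0\in BUC^1(\mathbb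 R)$ be such that $(u_0-\underline u)/\Omega^+_{\kappa^+}\in BUC^0(\mathbb R)$, $\partial_x(u_0-\underline u)/\Omega^+_{\kappa^+}\in BUC^0(\mathbb R)$ and $$\|u_0-\underline u\|_{W^{1,\infty}_{\kappa^+,+}}\le\delta_0 .$$ Then (E) has an entropy solution $u$ with initial datum $u_0$. It is unique (up to equality almost everywhere), it is a classical solution, of class $C^1$ on $[0,\infty)\times\mathbb R$ with $u(0,\cdot)=u_0$, and it satisfies the following. 1. If $\lim_{x\to+\infty}e^{\kappa^+x}\,(u_0-\underline u,\ \partial_x(u_0-\underline u))(x)=(0,0)$, then $$\lim_{t\to\infty}\|u(t,\cdot+\sigma t)-\underline u\|_{W^{1,\infty}_{\kappa^+,+}}=0 .$$ 2. If $\|u_0-\underline u\|_{W^{1,\infty}_{+,\rho}}<+\infty$, then for every $t\ge0$ $$\|u(t,\cdot+\sigma t)-\underline u\|_{W^{1,\infty}_{\kappa^+,+}}\le C_\rho\,\|u_0-\underline u\|_{W^{1,\infty}_{+,\rho}}\,\rho(\theta_\rho t) .$$ -/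

import Mathlib

open Real Set Filter Topology MeasureTheory
open scoped ENNReal ContDiff

noncomputable section

namespace BalanceLaw

/-- Bounded and uniformly continuous functions on the real line (the space `BUC⁰`). -/
def IsBUC (v : ℝ → ℝ) : Prop :=
  UniformContinuous v ∧ ∃ M : ℝ, ∀ x, |v x| ≤ M

/-- The space `BUC¹`: `C¹`, bounded and uniformly continuous together with the derivative. -/
def IsBUC1 (v : ℝ → ℝ) : Prop :=
  ContDiff ℝ 1 v ∧ IsBUC v ∧ IsBUC (deriv v)

/-- Classical solutions `u = u(t,x)` of `∂ₜ u + ∂ₓ (f(u)) = g(u)` on `[0,∞) × ℝ`: they are `C¹` up to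
the initial time, at which the time derivative is the one-sided one. The values of `u` at negative
times play no role. -/
def IsClassicalSolution (f g : ℝ → ℝ) (u : ℝ → ℝ → ℝ) : Prop :=
  ContDiffOn ℝ 1 (fun p : ℝ × ℝ => u p.1 p.2) (Ici 0 ×ˢ univ) ∧
  ∀ t : ℝ, 0 ≤ t → ∀ x : ℝ,
    derivWithin (fun s => u s x) (Ici 0) t + deriv (fun y => f (u t y)) x = g (u t x)

/-- Kruzhkov entropy solutions `u = u(t,x)` of `∂ₜ u + ∂ₓ (f(u)) = g(u)` on `(0,∞) × ℝ` with initial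
datum `u₀`: measurable, essentially bounded on each strip `(0,T) × ℝ`, and satisfying all Kruzhkov
entropy inequalities, tested against nonnegative smooth compactly supported functions that need not
vanish at the initial time. -/
def IsEntropySolution (f g : ℝ → ℝ) (u₀ : ℝ → ℝ) (u : ℝ → ℝ → ℝ) : Prop :=
  AEStronglyMeasurable (fun p : ℝ × ℝ => u p.1 p.2)
    ((volume : Measure (ℝ × ℝ)).restrict (Ioi 0 ×ˢ univ)) ∧
  (∀ T : ℝ, 0 < T → ∃ M : ℝ,
    ∀ᵐ p ∂((volume : Measure (ℝ × ℝ)).restrict (Ioo 0 T ×ˢ univ)), |u p.1 p.2| ≤ M) ∧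
  ∀ (k : ℝ) (φ : ℝ → ℝ → ℝ),
    ContDiff ℝ ∞ (fun p : ℝ × ℝ => φ p.1 p.2) →
    HasCompactSupport (fun p : ℝ × ℝ => φ p.1 p.2) →
    (∀ t x, 0 ≤ φ t x) →
    0 ≤ (∫ p in (Ioi 0 ×ˢ univ : Set (ℝ × ℝ)),
          (|u p.1 p.2 - k| * deriv (fun s => φ s p.2) p.1
            + Real.sign (u p.1 p.2 - k) * (f (u p.1 p.2) - f k) * deriv (fun y => φ p.1 y) p.2
            + Real.sign (u p.1 p.2 - k) * g (u p.1 p.2) * φ p.1 p.2))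
        + ∫ x, |u₀ x - k| * φ 0 x

/-- `(t,x) ↦ U (x - σ t)` is a smooth traveling wave of `∂ₜ u + ∂ₓ (f(u)) = g(u)`, with endstates
`um` at `-∞` and `up` at `+∞`, and it is non-characteristic: neither a value of the profile nor an
endstate is a point where `f' = σ`. -/
structure IsSmoothNoncharacteristicWave (f g : ℝ → ℝ) (U : ℝ → ℝ) (σ um up : ℝ) : Prop where
  smooth : ContDiff ℝ ∞ U
  solution : IsClassicalSolution f g (fun t x => U (x - σ * t))
  tendsto_atBot : Tendsto U atBot (𝓝 um)
  tendsto_atTop : Tendsto U atTop (𝓝 up)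
  noncharacteristic : ∀ x, deriv f (U x) ≠ σ
  noncharacteristic_left : deriv f um ≠ σ
  noncharacteristic_right : deriv f up ≠ σ

/-- The exponential weight `Ω_κ (x) = exp (-κ x)`. -/
def expWeight (κ : ℝ) (x : ℝ) : ℝ := Real.exp (-κ * x)

/-- The one-sided exponential weight `Ω_κ⁺ (x) = Ω_κ (x₊)`. -/
def expWeightPos (κ : ℝ) (x : ℝ) : ℝ := expWeight κ (max x 0)

/-- The critical spatial decay rate `κ⁺ = g'(u₊) / |f'(u₊) - σ|`. -/
def criticalRate (f g : ℝ → ℝ) (σ up : ℝ) : ℝ := deriv g up / |deriv f up - σ|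

/-- The (possibly infinite) weighted norm `‖w⁻¹ (v, ∂ₓ v)‖` in `L^∞(ℝ)`, for `v` of class `C¹`. -/
def weightedNorm (w : ℝ → ℝ) (v : ℝ → ℝ) : ℝ≥0∞ :=
  eLpNorm (fun x => (w x)⁻¹ • (v x, deriv v x)) ⊤ (volume : Measure ℝ)

/-- The norm of `W^{1,∞}_{κ,+}`. -/
def normExp (κ : ℝ) (v : ℝ → ℝ) : ℝ≥0∞ := weightedNorm (expWeightPos κ) v

/-- The norm of `W^{1,∞}_{+,ρ}`, with weight `ρ(x₊) Ω_κ⁺(x)` (used with the critical `κ`). -/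
def normExpRho (κ : ℝ) (ρ : ℝ → ℝ) (v : ℝ → ℝ) : ℝ≥0∞ :=
  weightedNorm (fun x => ρ (max x 0) * expWeightPos κ x) v

/-- Sub-exponential weights, as functions on `[0,∞)`; the values at negative arguments are
irrelevant. -/
structure IsSubexponentialWeight (ρ : ℝ → ℝ) : Prop where
  pos : ∀ t, 0 ≤ t → 0 < ρ t
  antitone : AntitoneOn ρ (Ici 0)
  tendsto_zero : Tendsto ρ atTop (𝓝 0)
  lower_bound : ∃ a C : ℝ, 0 < a ∧ 0 < C ∧ ∀ t, 0 ≤ t → C * Real.exp (-a * t) ≤ ρ t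
  integral_bound : ∃ a C : ℝ, 0 < a ∧ 0 < C ∧ ∀ t, 0 ≤ t →
    (∫ s in (0 : ℝ)..t, Real.exp (-a * (t - s)) * ρ s) ≤ C * ρ t

end BalanceLaw

end

/-! The equation is integrated exactly along characteristics. In the moving frame, with states
rescaled so that the endstates become 0 and 1, it reads `v_t + a(v) v_x = b(v)`, and the profile `M`
solves `a(M) M' = b(M)`. Non-characteristicity and `b'(0) < 0` force `b < 0` on `(0,1)` and `a < 0`
on `[0,1]` (`isFront_of_profile`), so every characteristic moves to the left.

The field `b/a` has a simple zero at 0 with slope `μ = b'(0)/a(0) > 0`. A `C¹` coordinate `h` makes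
it linear, `h' b/a = μ h`, normalised so that `h(M(x)) = e^{μx}` (`exists_linearizing_coordinate`,
`IsFront.exists_chart`); `G` is its inverse. For any solution, `q = e^{-μx} h(v)` is then constant
along characteristics, and `q = 1` is the wave itself. Once `q` is known the speed depends on `x`
alone: travelling from `ξ` down to `x` takes the time `∫_x^ξ B(q e^{μs}) ds` with `B = -1/a(G ·)`.
Solving for the foot `ξ(t,x)` (`exists_characteristic_foot`) gives the global solution `v = G(q(ξ)
e^{μx})`. No shock forms because, for small perturbations, the `ξ`-derivative of the travel time
stays bounded away from 0.

The weight is dictated by the front. At `+∞`, `M'` is comparable to `e^{-κx}` with `κ` the critical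
rate (`IsFront.exists_decay`), so `h'(M)` grows at most like `e^{(μ+κ)x}`, and a perturbation of
size `n e^{-κx}` of the state perturbs `q` by `O(n)`; on the left it perturbs `q` by `O(n e^{μ|x|})`
(`exists_first_integral_bounds`). Going back to `v`, the perturbation at `(t,x)` is at most `C n
e^{-κ x₊} e^{-μ(x₋ - y₋)}`, where `y ≥ x + ct` is the foot and `n` the weighted initial size at `y`
(`exists_solution`). Both asymptotic statements follow from one alternative: either the foot lies
far to the right, where the weighted datum is small, or it does not, and then `x` is far to the left
and the last factor is exponentially small in time
(`IsSubexponentialWeight.exists_transport_bound`).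

Bounded `C¹` solutions are entropy solutions by the chain rule for regularised Kruzhkov entropies
(`isEntropySolution_of_contDiff`). Uniqueness is of weak-strong type and needs no doubling of
variables: integrating the Kruzhkov inequalities in `k` produces the quadratic entropy, the extreme
values of `k` supply the equation itself, and the resulting relative entropy inequality
(`relative_entropy_nonneg`) is closed by a Gronwall weight in truncated cones (`ae_eq_of_kruzhkov`).
-/

namespace BalanceLaw

/-! ### Space-time derivatives, test functionals and smoothing of test functions. -/

/-- Time derivative of a function on space-time. -/
noncomputable def pdt (Φ : ℝ × ℝ → ℝ) (p : ℝ × ℝ) : ℝ := fderiv ℝ Φ p (1, 0)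

/-- Space derivative of a function on space-time. -/
noncomputable def pdx (Φ : ℝ × ℝ → ℝ) (p : ℝ × ℝ) : ℝ := fderiv ℝ Φ p (0, 1)

/-- The open half-plane of positive times. -/
def futureSet : Set (ℝ × ℝ) := Ioi 0 ×ˢ univ

lemma measurableSet_futureSet : MeasurableSet futureSet :=
  measurableSet_Ioi.prod MeasurableSet.univ

lemma hasDerivAt_pdt {Φ : ℝ × ℝ → ℝ} {p : ℝ × ℝ} (h : DifferentiableAt ℝ Φ p) :
    HasDerivAt (fun s => Φ (s, p.2)) (pdt Φ p) p.1 := by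
  have h1 : HasDerivAt (fun s : ℝ => (s, p.2)) ((1 : ℝ), (0 : ℝ)) p.1 :=
    (hasDerivAt_id p.1).prodMk (hasDerivAt_const p.1 p.2)
  exact h.hasFDerivAt.comp_hasDerivAt p.1 h1

lemma hasDerivAt_pdx {Φ : ℝ × ℝ → ℝ} {p : ℝ × ℝ} (h : DifferentiableAt ℝ Φ p) :
    HasDerivAt (fun y => Φ (p.1, y)) (pdx Φ p) p.2 := by
  have h1 : HasDerivAt (fun y : ℝ => (p.1, y)) ((0 : ℝ), (1 : ℝ)) p.2 :=
    (hasDerivAt_const p.2 p.1).prodMk (hasDerivAt_id p.2)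
  exact h.hasFDerivAt.comp_hasDerivAt p.2 h1

lemma continuous_pdt {Φ : ℝ × ℝ → ℝ} (h : ContDiff ℝ 1 Φ) : Continuous (pdt Φ) :=
  (h.continuous_fderiv one_ne_zero).clm_apply continuous_const

lemma continuous_pdx {Φ : ℝ × ℝ → ℝ} (h : ContDiff ℝ 1 Φ) : Continuous (pdx Φ) :=
  (h.continuous_fderiv one_ne_zero).clm_apply continuous_const

lemma hasCompactSupport_pdt {Φ : ℝ × ℝ → ℝ} (h : HasCompactSupport Φ) :
    HasCompactSupport (pdt Φ) := h.fderiv_apply ℝ (1, 0)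

lemma hasCompactSupport_pdx {Φ : ℝ × ℝ → ℝ} (h : HasCompactSupport Φ) :
    HasCompactSupport (pdx Φ) := h.fderiv_apply ℝ (0, 1)

lemma pdt_mul {Φ Ψ : ℝ × ℝ → ℝ} {p : ℝ × ℝ} (h : DifferentiableAt ℝ Φ p)
    (h' : DifferentiableAt ℝ Ψ p) :
    pdt (fun p => Φ p * Ψ p) p = pdt Φ p * Ψ p + Φ p * pdt Ψ p := by
  unfold pdt
  rw [fderiv_fun_mul h h']
  simp only [FunLike.coe_add, FunLike.coe_smul, Pi.add_apply, Pi.smul_apply, smul_eq_mul]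
  ring

lemma pdx_mul {Φ Ψ : ℝ × ℝ → ℝ} {p : ℝ × ℝ} (h : DifferentiableAt ℝ Φ p)
    (h' : DifferentiableAt ℝ Ψ p) :
    pdx (fun p => Φ p * Ψ p) p = pdx Φ p * Ψ p + Φ p * pdx Ψ p := by
  unfold pdx
  rw [fderiv_fun_mul h h']
  simp only [FunLike.coe_add, FunLike.coe_smul, Pi.add_apply, Pi.smul_apply, smul_eq_mul]
  ring

lemma pdt_comp {Φ : ℝ × ℝ → ℝ} {e : ℝ → ℝ} {p : ℝ × ℝ} {e' : ℝ} (h : DifferentiableAt ℝ Φ p)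
    (he : HasDerivAt e e' (Φ p)) : pdt (fun p => e (Φ p)) p = e' * pdt Φ p := by
  have := he.comp_hasFDerivAt p h.hasFDerivAt
  unfold pdt
  rw [show (fun p => e (Φ p)) = e ∘ Φ from rfl, this.fderiv]
  simp

lemma pdx_comp {Φ : ℝ × ℝ → ℝ} {e : ℝ → ℝ} {p : ℝ × ℝ} {e' : ℝ} (h : DifferentiableAt ℝ Φ p)
    (he : HasDerivAt e e' (Φ p)) : pdx (fun p => e (Φ p)) p = e' * pdx Φ p := by
  have := he.comp_hasFDerivAt p h.hasFDerivAt
  unfold pdx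
  rw [show (fun p => e (Φ p)) = e ∘ Φ from rfl, this.fderiv]
  simp

lemma hasCompactSupport_slice_left {Φ : ℝ × ℝ → ℝ} (h : HasCompactSupport Φ) (x : ℝ) :
    HasCompactSupport (fun t => Φ (t, x)) := by
  refine HasCompactSupport.of_support_subset_isCompact (h.isCompact.image continuous_fst) ?_
  intro t ht
  exact ⟨(t, x), subset_tsupport _ ht, rfl⟩

lemma hasCompactSupport_slice_right {Φ : ℝ × ℝ → ℝ} (h : HasCompactSupport Φ) (t : ℝ) :
    HasCompactSupport (fun x => Φ (t, x)) := by
  refine HasCompactSupport.of_support_subset_isCompact (h.isCompact.image continuous_snd) ?_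
  intro x hx
  exact ⟨(t, x), subset_tsupport _ hx, rfl⟩

lemma setIntegral_pdt {A : ℝ × ℝ → ℝ} (h : ContDiff ℝ 1 A) (hc : HasCompactSupport A) :
    ∫ p in futureSet, pdt A p = - ∫ x, A (0, x) := by
  have hi : Integrable (pdt A) :=
    (continuous_pdt h).integrable_of_hasCompactSupport (hasCompactSupport_pdt hc)
  have e : (volume : Measure (ℝ × ℝ)).restrict futureSet
      = ((volume : Measure ℝ).restrict (Ioi 0)).prod volume := by
    rw [futureSet, Measure.volume_eq_prod, ← Measure.prod_restrict, Measure.restrict_univ]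
  rw [e, integral_prod_symm _ (by rw [← e]; exact hi.restrict), ← integral_neg]
  refine integral_congr_ae (Eventually.of_forall fun x => ?_)
  have hd : ContDiff ℝ 1 (fun t => A (t, x)) := h.comp (contDiff_id.prodMk contDiff_const)
  have := HasCompactSupport.integral_Ioi_deriv_eq hd (hasCompactSupport_slice_left hc x) 0
  simp only
  rw [← this]
  refine integral_congr_ae (Eventually.of_forall fun t => ?_)
  exact ((hasDerivAt_pdt (p := (t, x)) (h.differentiable one_ne_zero _)).deriv).symm

lemma setIntegral_pdx {A : ℝ × ℝ → ℝ} (h : ContDiff ℝ 1 A) (hc : HasCompactSupport A) :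
    ∫ p in futureSet, pdx A p = 0 := by
  have hi : Integrable (pdx A) :=
    (continuous_pdx h).integrable_of_hasCompactSupport (hasCompactSupport_pdx hc)
  have e : (volume : Measure (ℝ × ℝ)).restrict futureSet
      = ((volume : Measure ℝ).restrict (Ioi 0)).prod volume := by
    rw [futureSet, Measure.volume_eq_prod, ← Measure.prod_restrict, Measure.restrict_univ]
  rw [e, integral_prod _ (by rw [← e]; exact hi.restrict)]
  rw [integral_eq_zero_of_ae (Eventually.of_forall fun t => ?_)]
  have hd : ContDiff ℝ 1 (fun x => A (t, x)) := h.comp (contDiff_const.prodMk contDiff_id)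
  have hs := hasCompactSupport_slice_right hc t
  have h1 := HasCompactSupport.integral_Ioi_deriv_eq hd hs 0
  have h2 := HasCompactSupport.integral_Iic_deriv_eq hd hs 0
  have hint : Integrable (deriv fun x => A (t, x)) :=
    (hd.continuous_deriv le_rfl).integrable_of_hasCompactSupport hs.deriv
  have h3 := intervalIntegral.integral_Iic_add_Ioi (b := (0 : ℝ)) hint.integrableOn hint.integrableOn
  rw [h1, h2] at h3
  simp only [Pi.zero_apply]
  rw [show (∫ y, pdx A (t, y)) = ∫ x, deriv (fun x => A (t, x)) x from ?_]
  · linarith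
  refine integral_congr_ae (Eventually.of_forall fun x => ?_)
  exact ((hasDerivAt_pdx (p := (t, x)) (h.differentiable one_ne_zero _)).deriv).symm

/-- The first order functional in which entropy inequalities are expressed. -/
noncomputable def testFunctional (α β γ : ℝ × ℝ → ℝ) (δ : ℝ → ℝ) (Φ : ℝ × ℝ → ℝ) : ℝ :=
  (∫ p in futureSet, (α p * pdt Φ p + β p * pdx Φ p + γ p * Φ p)) + ∫ x, δ x * Φ (0, x)

open ContinuousLinearMap Convolution in
/-- A nonnegative `C¹` compactly supported function is approached by smooth ones in `C¹`, with
supports converging too. -/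
lemma exists_smooth_approx {Φ : ℝ × ℝ → ℝ} (h : ContDiff ℝ 1 Φ) (hc : HasCompactSupport Φ)
    (h0 : ∀ p, 0 ≤ Φ p) {ε : ℝ} (hε : 0 < ε) :
    ∃ Ψ : ℝ × ℝ → ℝ, ContDiff ℝ ∞ Ψ ∧ (∀ p, 0 ≤ Ψ p) ∧
      (∀ p, Ψ p ≠ 0 → p ∈ Metric.cthickening ε (tsupport Φ)) ∧
      (∀ p, |Ψ p - Φ p| ≤ ε) ∧ (∀ p, |pdt Ψ p - pdt Φ p| ≤ ε) ∧
      (∀ p, |pdx Ψ p - pdx Φ p| ≤ ε) := by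
  have huc : UniformContinuous Φ := hc.uniformContinuous_of_continuous h.continuous
  have huc' : UniformContinuous (fderiv ℝ Φ) :=
    (hc.fderiv ℝ).uniformContinuous_of_continuous (h.continuous_fderiv one_ne_zero)
  obtain ⟨r1, hr1, H1⟩ := Metric.uniformContinuous_iff.1 huc ε hε
  obtain ⟨r2, hr2, H2⟩ := Metric.uniformContinuous_iff.1 huc' ε hε
  -- The bound by `ε` confines the support; `r1` and `r2` control the oscillation of `Φ` and of its
  -- differential.
  set r := min ε (min r1 r2) with hr
  have hrpos : 0 < r := lt_min hε (lt_min hr1 hr2)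
  let b : ContDiffBump (0 : ℝ × ℝ) := ⟨r / 2, r, by positivity, by linarith⟩
  have hbo : b.rOut = r := rfl
  have hli : LocallyIntegrable Φ volume := h.continuous.locallyIntegrable
  have hbi : LocallyIntegrable (b.normed volume) volume :=
    (b.continuous_normed).locallyIntegrable
  set Ψ : ℝ × ℝ → ℝ := (b.normed volume ⋆[lsmul ℝ ℝ, volume] Φ) with hΨ
  have hval : ∀ p, dist (Ψ p) (Φ p) ≤ ε := fun p =>
    b.dist_normed_convolution_le h.continuous.aestronglyMeasurable fun q hq =>
      (H1 (lt_of_lt_of_le hq (by rw [hbo]; exact (min_le_right _ _).trans (min_le_left _ _)))).le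
  have hfd : ∀ p, dist (fderiv ℝ Ψ p) (fderiv ℝ Φ p) ≤ ε := by
    intro p
    -- The derivative is put on `Φ`, so the differential of the mollification is the mollification
    -- of the differential and the same estimate applies to it.
    have hd := hc.hasFDerivAt_convolution_right (lsmul ℝ ℝ) hbi h p
    have he : (b.normed volume ⋆[(lsmul ℝ ℝ).precompR (ℝ × ℝ), volume] fderiv ℝ Φ) p
        = (b.normed volume ⋆[lsmul ℝ ℝ, volume] fderiv ℝ Φ) p := by
      unfold convolution
      refine integral_congr_ae (Eventually.of_forall fun q => ?_)
      ext <;> simp [ContinuousLinearMap.precompR_apply]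
    rw [hd.fderiv, he]
    refine b.dist_normed_convolution_le
      (h.continuous_fderiv one_ne_zero).aestronglyMeasurable fun q hq => ?_
    exact (H2 (lt_of_lt_of_le hq
      (by rw [hbo]; exact (min_le_right _ _).trans (min_le_right _ _)))).le
  have hfd' : ∀ p v, ‖v‖ ≤ 1 → |fderiv ℝ Ψ p v - fderiv ℝ Φ p v| ≤ ε := by
    intro p v hv
    have := (fderiv ℝ Ψ p - fderiv ℝ Φ p).le_opNorm v
    rw [← dist_eq_norm] at this
    calc |fderiv ℝ Ψ p v - fderiv ℝ Φ p v| = ‖(fderiv ℝ Ψ p - fderiv ℝ Φ p) v‖ := by simp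
      _ ≤ _ := this
      _ ≤ ε * 1 := mul_le_mul (hfd p) hv (norm_nonneg _) hε.le
      _ = ε := mul_one _
  refine ⟨Ψ, ?_, ?_, ?_, ?_, ?_, ?_⟩
  · exact b.hasCompactSupport_normed.contDiff_convolution_left (lsmul ℝ ℝ) b.contDiff_normed hli
  · intro p
    exact integral_nonneg fun q => mul_nonneg (b.nonneg_normed q) (h0 _)
  · intro p hp
    by_contra hcon
    apply hp
    rw [hΨ]
    unfold convolution
    refine integral_eq_zero_of_ae (Eventually.of_forall fun q => ?_)
    simp only [lsmul_apply, Pi.zero_apply, smul_eq_mul]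
    by_cases hq : q ∈ Metric.ball (0 : ℝ × ℝ) r
    · have : Φ (p - q) = 0 := by
        by_contra hne
        apply hcon
        refine Metric.mem_cthickening_of_dist_le p (p - q) ε _ (subset_tsupport _ hne) ?_
        rw [dist_eq_norm]
        simp only [sub_sub_cancel]
        rw [mem_ball_zero_iff] at hq
        exact hq.le.trans (min_le_left _ _)
      rw [this, mul_zero]
    · have : b.normed volume q = 0 := by
        rw [← Function.notMem_support, b.support_normed_eq, hbo]; exact hq
      rw [this, zero_mul]
  · intro p; exact hval p
  · intro p; exact hfd' p _ (by simp [Prod.norm_def])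
  · intro p; exact hfd' p _ (by simp [Prod.norm_def])

lemma integrable_bdd_mul_test {X : Type*} [TopologicalSpace X] [MeasurableSpace X]
    [OpensMeasurableSpace X] {μ : Measure X} [IsFiniteMeasureOnCompacts μ]
    {α ψ : X → ℝ} {C : ℝ} (hα : AEStronglyMeasurable α μ) (hC : ∀ p, |α p| ≤ C)
    (hψ : Continuous ψ) (hs : HasCompactSupport ψ) : Integrable (fun p => α p * ψ p) μ :=
  (hψ.integrable_of_hasCompactSupport hs).bdd_mul hα (Eventually.of_forall hC)

/-- Mollify `Φ` and pass to the limit by dominated convergence; only bounds on the coefficients are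
needed since first derivatives converge uniformly. The enlargement is needed because the test
functions used for uniqueness involve the `C¹` solution and squares of positive parts, which are
only `C¹`. Mollification spreads the support in time, hence the margin between `T` and `T + 1`. -/
lemma testFunctional_nonneg_of_smooth {α β γ : ℝ × ℝ → ℝ} {δ : ℝ → ℝ} {C : ℝ}
    (hα : AEStronglyMeasurable α volume) (hβ : AEStronglyMeasurable β volume)
    (hγ : AEStronglyMeasurable γ volume) (hδ : Continuous δ)
    (bα : ∀ p, |α p| ≤ C) (bβ : ∀ p, |β p| ≤ C) (bγ : ∀ p, |γ p| ≤ C) {T : ℝ}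
    (H : ∀ Φ : ℝ × ℝ → ℝ, ContDiff ℝ ∞ Φ → HasCompactSupport Φ → (∀ p, 0 ≤ Φ p) →
      (∀ p : ℝ × ℝ, T + 1 ≤ p.1 → Φ p = 0) → 0 ≤ testFunctional α β γ δ Φ)
    {Φ : ℝ × ℝ → ℝ} (h : ContDiff ℝ 1 Φ) (hc : HasCompactSupport Φ) (h0 : ∀ p, 0 ≤ Φ p)
    (hT : ∀ p : ℝ × ℝ, T ≤ p.1 → Φ p = 0) : 0 ≤ testFunctional α β γ δ Φ := by
  have hC0 : 0 ≤ C := (abs_nonneg _).trans (bα 0)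
  -- The shift by 2 keeps the radius strictly below 1 from `n = 0` on, so the mollified function
  -- vanishes from time `T + 1`, endpoint included.
  have hεpos : ∀ n : ℕ, (0 : ℝ) < 1 / ((n : ℝ) + 2) := fun n => by positivity
  have hεle : ∀ n : ℕ, (1 : ℝ) / ((n : ℝ) + 2) ≤ 1 := fun n => by
    rw [div_le_one (by positivity)]; linarith [(Nat.cast_nonneg n : (0 : ℝ) ≤ n)]
  have hεlt : ∀ n : ℕ, (1 : ℝ) / ((n : ℝ) + 2) < 1 := fun n => by
    rw [div_lt_one (by positivity)]; linarith [(Nat.cast_nonneg n : (0 : ℝ) ≤ n)]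
  have hεlim : Tendsto (fun n : ℕ => (1 : ℝ) / ((n : ℝ) + 2)) atTop (𝓝 0) := by
    have := (tendsto_one_div_add_atTop_nhds_zero_nat (𝕜 := ℝ)).comp (tendsto_add_atTop_nat 1)
    refine this.congr fun n => ?_
    simp only [Function.comp, Nat.cast_add, Nat.cast_one]; ring_nf
  choose Ψ hs hn hsupp e0 et ex using fun n : ℕ => exists_smooth_approx h hc h0 (hεpos n)
  set K : Set (ℝ × ℝ) := Metric.cthickening 1 (tsupport Φ) with hK
  have hKc : IsCompact K := hc.isCompact.cthickening
  have htK : ∀ n, tsupport (Ψ n) ⊆ K := fun n =>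
    closure_minimal (fun p hp => Metric.cthickening_mono (hεle n) _ (hsupp n p hp))
      Metric.isClosed_cthickening
  have hcs : ∀ n, HasCompactSupport (Ψ n) := fun n =>
    hKc.of_isClosed_subset (isClosed_tsupport _) (htK n)
  have hs1 : ∀ n, ContDiff ℝ 1 (Ψ n) := fun n => (hs n).of_le (by exact_mod_cast le_top)
  have hpos : ∀ n, 0 ≤ testFunctional α β γ δ (Ψ n) := by
    intro n
    refine H _ (hs n) (hcs n) (hn n) fun p hp => ?_
    by_contra hne
    have hmem := hsupp n p hne
    have hsub : tsupport Φ ⊆ {p : ℝ × ℝ | p.1 ≤ T} := by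
      refine closure_minimal (fun q hq => ?_) (isClosed_le continuous_fst continuous_const)
      by_contra hcon
      exact hq (hT q (not_le.1 hcon).le)
    rw [hc.isCompact.cthickening_eq_biUnion_closedBall (hεpos n).le] at hmem
    obtain ⟨q, hq, h1⟩ := mem_iUnion₂.1 hmem
    rw [Metric.mem_closedBall] at h1
    have h2 : |p.1 - q.1| ≤ dist p q := by
      rw [← Real.dist_eq]; exact le_max_left _ _
    have h3 := hsub hq
    simp only [mem_ofPred_eq] at h3
    have h4 := le_abs_self (p.1 - q.1)
    have h5 := hεlt n
    linarith
  obtain ⟨D, hD⟩ := (hKc.bddAbove_image ((continuous_pdt h).abs.add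
    ((continuous_pdx h).abs.add h.continuous.abs)).continuousOn)
  have hD' : ∀ p ∈ K, |pdt Φ p| + (|pdx Φ p| + |Φ p|) ≤ D := fun p hp => hD ⟨p, hp, rfl⟩
  have hval : ∀ p, Tendsto (fun n => Ψ n p) atTop (𝓝 (Φ p)) := fun p =>
    tendsto_iff_norm_sub_tendsto_zero.2
      (squeeze_zero (fun _ => norm_nonneg _) (fun n => e0 n p) hεlim)
  have hvt : ∀ p, Tendsto (fun n => pdt (Ψ n) p) atTop (𝓝 (pdt Φ p)) := fun p =>
    tendsto_iff_norm_sub_tendsto_zero.2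
      (squeeze_zero (fun _ => norm_nonneg _) (fun n => et n p) hεlim)
  have hvx : ∀ p, Tendsto (fun n => pdx (Ψ n) p) atTop (𝓝 (pdx Φ p)) := fun p =>
    tendsto_iff_norm_sub_tendsto_zero.2
      (squeeze_zero (fun _ => norm_nonneg _) (fun n => ex n p) hεlim)
  have hlim : Tendsto (fun n => testFunctional α β γ δ (Ψ n)) atTop
      (𝓝 (testFunctional α β γ δ Φ)) := by
    unfold testFunctional
    refine Tendsto.add ?_ ?_
    · refine tendsto_integral_of_dominated_convergence
        (K.indicator fun _ => C * (D + 3)) ?_ ?_ ?_ ?_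
      · intro n
        exact (((hα.mul (continuous_pdt (hs1 n)).aestronglyMeasurable).add
          (hβ.mul (continuous_pdx (hs1 n)).aestronglyMeasurable)).add
          (hγ.mul (hs1 n).continuous.aestronglyMeasurable)).restrict
      · exact ((integrable_indicator_iff hKc.measurableSet).2
          (integrableOn_const hKc.measure_lt_top.ne)).restrict
      · intro n
        refine Eventually.of_forall fun p => ?_
        by_cases hp : p ∈ K
        · rw [indicator_of_mem hp]
          have a1 := abs_sub_abs_le_abs_sub (pdt (Ψ n) p) (pdt Φ p)
          have a2 := abs_sub_abs_le_abs_sub (pdx (Ψ n) p) (pdx Φ p)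
          have a3 := abs_sub_abs_le_abs_sub (Ψ n p) (Φ p)
          have a4 := et n p; have a5 := ex n p; have a6 := e0 n p
          have a7 := hεle n; have a8 := hD' p hp
          calc ‖α p * pdt (Ψ n) p + β p * pdx (Ψ n) p + γ p * Ψ n p‖
              ≤ |α p| * |pdt (Ψ n) p| + |β p| * |pdx (Ψ n) p| + |γ p| * |Ψ n p| := by
                rw [← abs_mul, ← abs_mul, ← abs_mul]
                exact abs_add_three _ _ _
            _ ≤ C * |pdt (Ψ n) p| + C * |pdx (Ψ n) p| + C * |Ψ n p| := by
                gcongr <;> first | exact bα p | exact bβ p | exact bγ p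
            _ = C * (|pdt (Ψ n) p| + |pdx (Ψ n) p| + |Ψ n p|) := by ring
            _ ≤ C * (D + 3) := by
                apply mul_le_mul_of_nonneg_left _ hC0
                linarith
        · rw [indicator_of_notMem hp]
          have hp' : p ∉ tsupport (Ψ n) := fun hq => hp (htK n hq)
          have z0 : Ψ n p = 0 := image_eq_zero_of_notMem_tsupport hp'
          have z1 : fderiv ℝ (Ψ n) p = 0 := image_eq_zero_of_notMem_tsupport
            fun hq => hp' (tsupport_fderiv_subset ℝ hq)
          simp [pdt, pdx, z0, z1]
      · refine Eventually.of_forall fun p => ?_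
        exact (((hvt p).const_mul _).add ((hvx p).const_mul _)).add ((hval p).const_mul _)
    · have hK2 : IsCompact (Prod.snd '' K) := hKc.image continuous_snd
      obtain ⟨E, hE⟩ := hK2.bddAbove_image hδ.abs.continuousOn
      refine tendsto_integral_of_dominated_convergence
        ((Prod.snd '' K).indicator fun _ => E * (D + 3)) ?_ ?_ ?_ ?_
      · intro n
        exact (hδ.mul ((hs1 n).continuous.comp
          (continuous_const.prodMk continuous_id))).aestronglyMeasurable
      · exact ((integrable_indicator_iff hK2.measurableSet).2
          (integrableOn_const hK2.measure_lt_top.ne))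
      · intro n
        refine Eventually.of_forall fun x => ?_
        by_cases hp : ((0 : ℝ), x) ∈ K
        · rw [indicator_of_mem (show x ∈ Prod.snd '' K from ⟨(0, x), hp, rfl⟩)]
          have hE' : |δ x| ≤ E := hE ⟨x, ⟨(0, x), hp, rfl⟩, rfl⟩
          have a3 := abs_sub_abs_le_abs_sub (Ψ n (0, x)) (Φ (0, x))
          have a6 := e0 n (0, x)
          have a7 := hεle n; have a8 := hD' _ hp
          have a9 := abs_nonneg (pdt Φ (0, x))
          have a10 := abs_nonneg (pdx Φ (0, x))
          rw [norm_mul]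
          exact mul_le_mul hE' (by rw [Real.norm_eq_abs]; linarith) (norm_nonneg _)
            ((abs_nonneg _).trans hE')
        · have z0 : Ψ n (0, x) = 0 := image_eq_zero_of_notMem_tsupport fun hq => hp (htK n hq)
          rw [z0, mul_zero, norm_zero]
          refine indicator_nonneg (fun y hy => ?_) _
          obtain ⟨q, hq, rfl⟩ := hy
          have hE' : |δ q.2| ≤ E := hE ⟨q.2, ⟨q, hq, rfl⟩, rfl⟩
          have := hD' q hq
          have a9 := abs_nonneg (pdt Φ q)
          have a10 := abs_nonneg (pdx Φ q)
          have a11 := abs_nonneg (Φ q)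
          have a12 := abs_nonneg (δ q.2)
          apply mul_nonneg <;> linarith
      · exact Eventually.of_forall fun x => (hval (0, x)).const_mul _
  exact ge_of_tendsto' hlim hpos

/-! ### Bounded classical solutions are entropy solutions. -/

/-- Weak form of the chain rule for a `C¹` function `U` of space-time. -/
lemma testFunctional_chain {U : ℝ × ℝ → ℝ} (hU : ContDiff ℝ 1 U) {e e' q q' : ℝ → ℝ}
    (he : ∀ s, HasDerivAt e (e' s) s) (he' : Continuous e')
    (hq : ∀ s, HasDerivAt q (q' s) s) (hq' : Continuous q')
    {Φ : ℝ × ℝ → ℝ} (h : ContDiff ℝ 1 Φ) (hc : HasCompactSupport Φ) :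
    testFunctional (fun p => e (U p)) (fun p => q (U p))
      (fun p => e' (U p) * pdt U p + q' (U p) * pdx U p) (fun x => e (U (0, x))) Φ = 0 := by
  have ce : ContDiff ℝ 1 e := contDiff_one_iff_deriv.2
    ⟨fun s => (he s).differentiableAt, by
      rw [show deriv e = e' from funext fun s => (he s).deriv]; exact he'⟩
  have cq : ContDiff ℝ 1 q := contDiff_one_iff_deriv.2
    ⟨fun s => (hq s).differentiableAt, by
      rw [show deriv q = q' from funext fun s => (hq s).deriv]; exact hq'⟩
  have hA : ContDiff ℝ 1 (fun p => e (U p) * Φ p) := (ce.comp hU).mul h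
  have hB : ContDiff ℝ 1 (fun p => q (U p) * Φ p) := (cq.comp hU).mul h
  have cA : HasCompactSupport (fun p => e (U p) * Φ p) := hc.mul_left
  have cB : HasCompactSupport (fun p => q (U p) * Φ p) := hc.mul_left
  have iA : Integrable (pdt (fun p => e (U p) * Φ p)) :=
    (continuous_pdt hA).integrable_of_hasCompactSupport (hasCompactSupport_pdt cA)
  have iB : Integrable (pdx (fun p => q (U p) * Φ p)) :=
    (continuous_pdx hB).integrable_of_hasCompactSupport (hasCompactSupport_pdx cB)
  -- The integrand is the space-time divergence of `(e(U) Φ, q(U) Φ)`; after integration only the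
  -- boundary term at time zero survives.
  have key : ∫ p in futureSet, (e (U p) * pdt Φ p + q (U p) * pdx Φ p
      + (e' (U p) * pdt U p + q' (U p) * pdx U p) * Φ p)
      = ∫ p in futureSet, (pdt (fun p => e (U p) * Φ p) p + pdx (fun p => q (U p) * Φ p) p) := by
    refine integral_congr_ae (Eventually.of_forall fun p => ?_)
    have dU := hU.differentiable one_ne_zero p
    have dΦ := h.differentiable one_ne_zero p
    have de : DifferentiableAt ℝ (fun p => e (U p)) p := (ce.comp hU).differentiable one_ne_zero p
    have dq : DifferentiableAt ℝ (fun p => q (U p)) p := (cq.comp hU).differentiable one_ne_zero p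
    simp only
    rw [pdt_mul de dΦ, pdx_mul dq dΦ, pdt_comp dU (he (U p)), pdx_comp dU (hq (U p))]
    ring
  unfold testFunctional
  rw [key, integral_add iA.integrableOn iB.integrableOn, setIntegral_pdt hA cA,
    setIntegral_pdx hB cB]
  ring

section RegularizedAbs

lemma sqrt_sq_add_sq_pos (k s : ℝ) {d : ℝ} (hd : 0 < d) : 0 < √((s - k) ^ 2 + d ^ 2) :=
  Real.sqrt_pos.2 (by positivity)

lemma hasDerivAt_regularized_abs (k s : ℝ) {d : ℝ} (hd : 0 < d) :
    HasDerivAt (fun s => √((s - k) ^ 2 + d ^ 2)) ((s - k) / √((s - k) ^ 2 + d ^ 2)) s := by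
  have h1 : HasDerivAt (fun s : ℝ => (s - k) ^ 2 + d ^ 2) (2 * (s - k)) s := by
    have := (((hasDerivAt_id s).sub_const k).pow 2).add_const (d ^ 2)
    refine this.congr_deriv ?_
    simp
  refine (h1.sqrt (by positivity)).congr_deriv ?_
  rw [mul_div_mul_left _ _ two_ne_zero]

lemma regularized_abs_le (k s : ℝ) {d : ℝ} (hd : 0 < d) :
    √((s - k) ^ 2 + d ^ 2) ≤ |s - k| + d := by
  rw [Real.sqrt_le_iff]
  refine ⟨by positivity, ?_⟩
  have := abs_nonneg (s - k)
  nlinarith [sq_abs (s - k), mul_nonneg this hd.le]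

lemma abs_deriv_regularized_abs_le (k s : ℝ) {d : ℝ} (hd : 0 < d) :
    |(s - k) / √((s - k) ^ 2 + d ^ 2)| ≤ 1 := by
  rw [abs_div, abs_of_pos (sqrt_sq_add_sq_pos k s hd), div_le_one (sqrt_sq_add_sq_pos k s hd)]
  exact Real.abs_le_sqrt (by nlinarith [sq_nonneg d])

lemma tendsto_regularized_abs (k s : ℝ) {d : ℕ → ℝ} (hd : Tendsto d atTop (𝓝 0)) :
    Tendsto (fun n => √((s - k) ^ 2 + d n ^ 2)) atTop (𝓝 |s - k|) := by
  have : Tendsto (fun n => √((s - k) ^ 2 + d n ^ 2)) atTop (𝓝 √((s - k) ^ 2 + 0 ^ 2)) :=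
    (Real.continuous_sqrt.tendsto _).comp ((hd.pow 2).const_add _)
  simpa [Real.sqrt_sq_eq_abs] using this

/-- The convergence holds at `s = k` too, where both sides vanish thanks to the convention
`Real.sign 0 = 0`; no exceptional set has to be discarded later. -/
lemma tendsto_deriv_regularized_abs (k s : ℝ) {d : ℕ → ℝ} (hd : Tendsto d atTop (𝓝 0)) :
    Tendsto (fun n => (s - k) / √((s - k) ^ 2 + d n ^ 2)) atTop (𝓝 (Real.sign (s - k))) := by
  rcases eq_or_ne (s - k) 0 with h | h
  · simp [h]
  · have h2 : Real.sign (s - k) = (s - k) / |s - k| := by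
      rcases lt_or_gt_of_ne h with h' | h'
      · rw [Real.sign_of_neg h', abs_of_neg h', div_neg, div_self h]
      · rw [Real.sign_of_pos h', abs_of_pos h', div_self h]
    rw [h2]
    exact tendsto_const_nhds.div (tendsto_regularized_abs k s hd) (abs_ne_zero.2 h)

end RegularizedAbs

lemma measurable_real_sign : Measurable Real.sign := by
  unfold Real.sign
  exact Measurable.ite measurableSet_Iio measurable_const
    (Measurable.ite measurableSet_Ioi measurable_const measurable_const)

lemma abs_real_sign_le (x : ℝ) : |Real.sign x| ≤ 1 := by
  rcases Real.sign_apply_eq x with h | h | h <;> simp [h]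

/-- Bounded classical solutions, extended to a `C¹` function on the plane, are entropy solutions. -/
theorem isEntropySolution_of_contDiff {f g : ℝ → ℝ} (hf : ContDiff ℝ 1 f) (hg : Continuous g)
    {u : ℝ → ℝ → ℝ} (hu : ContDiff ℝ 1 (fun p : ℝ × ℝ => u p.1 p.2)) {M : ℝ}
    (hM : ∀ t x, |u t x| ≤ M)
    (hpde : ∀ p : ℝ × ℝ, 0 < p.1 → pdt (fun p : ℝ × ℝ => u p.1 p.2) p
      + deriv f (u p.1 p.2) * pdx (fun p : ℝ × ℝ => u p.1 p.2) p = g (u p.1 p.2)) :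
    IsEntropySolution f g (u 0) u := by
  refine ⟨hu.continuous.aestronglyMeasurable,
    fun T _ => ⟨M, Eventually.of_forall fun p => hM _ _⟩, fun k φ hφ hcφ _ => ?_⟩
  set U : ℝ × ℝ → ℝ := fun p => u p.1 p.2 with hUdef
  set Φ : ℝ × ℝ → ℝ := fun p => φ p.1 p.2 with hΦdef
  have hΦ : ContDiff ℝ 1 Φ := hφ.of_le (by exact_mod_cast le_top)
  have hf' : Continuous (deriv f) := hf.continuous_deriv le_rfl
  set d : ℕ → ℝ := fun n => 1 / ((n : ℝ) + 1) with hd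
  have hd0 : ∀ n, 0 < d n := fun n => by positivity
  have hd1 : ∀ n, d n ≤ 1 := fun n => by
    rw [hd]; simp only; rw [div_le_one (by positivity)]; linarith [(Nat.cast_nonneg n : (0:ℝ) ≤ n)]
  have hdl : Tendsto d atTop (𝓝 0) := tendsto_one_div_add_atTop_nhds_zero_nat
  set e : ℕ → ℝ → ℝ := fun n s => √((s - k) ^ 2 + d n ^ 2)
  set e' : ℕ → ℝ → ℝ := fun n s => (s - k) / √((s - k) ^ 2 + d n ^ 2)
  -- The entropy flux is normalised to vanish at `k`, so that its limit is the Kruzhkov flux without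
  -- an additive constant.
  set q : ℕ → ℝ → ℝ := fun n s => ∫ r in k..s, e' n r * deriv f r
  have he : ∀ n s, HasDerivAt (e n) (e' n s) s := fun n s => hasDerivAt_regularized_abs k s (hd0 n)
  have ce' : ∀ n, Continuous (e' n) := fun n => by
    refine Continuous.div (by fun_prop) (by fun_prop) fun s => (sqrt_sq_add_sq_pos k s (hd0 n)).ne'
  have cq' : ∀ n, Continuous (fun r => e' n r * deriv f r) := fun n => (ce' n).mul hf'
  have hq : ∀ n s, HasDerivAt (q n) (e' n s * deriv f s) s := fun n s =>
    intervalIntegral.integral_hasDerivAt_right ((cq' n).intervalIntegrable _ _)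
      (cq' n).stronglyMeasurable.stronglyMeasurableAtFilter (cq' n).continuousAt
  have cq : ∀ n, Continuous (q n) := fun n =>
    continuous_iff_continuousAt.2 fun s => (hq n s).continuousAt
  obtain ⟨F1, hF1⟩ := (isCompact_Icc (a := -(|M| + |k|)) (b := |M| + |k|)).bddAbove_image
    hf'.abs.continuousOn
  obtain ⟨G1, hG1⟩ := (isCompact_Icc (a := -M) (b := M)).bddAbove_image hg.abs.continuousOn
  have bM : ∀ p, U p ∈ Icc (-M) M := fun p => abs_le.1 (hM _ _)
  have bG : ∀ p, |g (U p)| ≤ G1 := fun p => hG1 ⟨_, bM p, rfl⟩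
  have bF : ∀ r ∈ Icc (-(|M| + |k|)) (|M| + |k|), |deriv f r| ≤ F1 := fun r hr => hF1 ⟨r, hr, rfl⟩
  have bUk : ∀ p, |U p - k| ≤ |M| + |k| := fun p =>
    (abs_sub _ _).trans (add_le_add ((hM _ _).trans (le_abs_self _)) le_rfl)
  have memI : ∀ p, ∀ r ∈ uIcc k (U p), r ∈ Icc (-(|M| + |k|)) (|M| + |k|) := by
    intro p
    have h1 : U p ∈ Icc (-(|M| + |k|)) (|M| + |k|) := by
      have := (hM p.1 p.2).trans (le_abs_self M)
      exact abs_le.1 (this.trans (by linarith [abs_nonneg k]))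
    have h2 : k ∈ Icc (-(|M| + |k|)) (|M| + |k|) :=
      abs_le.1 (by linarith [abs_nonneg M])
    exact fun r hr => (convex_Icc _ _).ordConnected.uIcc_subset h2 h1 hr
  have hF10 : 0 ≤ F1 := (abs_nonneg _).trans (bF _ (memI 0 k left_mem_uIcc))
  have bq : ∀ n p, |q n (U p)| ≤ F1 * (|M| + |k|) := by
    intro n p
    have := intervalIntegral.norm_integral_le_of_norm_le_const (a := k) (b := U p)
      (f := fun r => e' n r * deriv f r) (C := F1) (fun r hr => by
        rw [norm_mul]
        calc ‖e' n r‖ * ‖deriv f r‖ ≤ 1 * F1 :=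
              mul_le_mul (abs_deriv_regularized_abs_le k r (hd0 n))
                (bF r (memI p r (uIoc_subset_uIcc hr))) (norm_nonneg _) zero_le_one
          _ = F1 := one_mul _)
    exact this.trans (mul_le_mul_of_nonneg_left (bUk p) hF10)
  have lq : ∀ p, Tendsto (fun n => q n (U p)) atTop
      (𝓝 (Real.sign (U p - k) * (f (U p) - f k))) := by
    intro p
    have h1 : Tendsto (fun n => ∫ r in k..U p, e' n r * deriv f r) atTop
        (𝓝 (∫ r in k..U p, Real.sign (r - k) * deriv f r)) := by
      refine intervalIntegral.tendsto_integral_filter_of_dominated_convergence (fun _ => F1)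
        (Eventually.of_forall fun n => (cq' n).aestronglyMeasurable.restrict)
        (Eventually.of_forall fun n => Eventually.of_forall fun r hr => ?_)
        intervalIntegrable_const
        (Eventually.of_forall fun r _ =>
          (tendsto_deriv_regularized_abs k r hdl).mul_const _)
      rw [norm_mul]
      calc ‖e' n r‖ * ‖deriv f r‖ ≤ 1 * F1 :=
            mul_le_mul (abs_deriv_regularized_abs_le k r (hd0 n))
              (bF r (memI p r (uIoc_subset_uIcc hr))) (norm_nonneg _) zero_le_one
        _ = F1 := one_mul _
    -- Between `k` and `U p` the sign is constant off the endpoints, so it can be pulled out and the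
    -- fundamental theorem of calculus applies.
    have h2 : ∫ r in k..U p, Real.sign (r - k) * deriv f r
        = ∫ r in k..U p, Real.sign (U p - k) * deriv f r := by
      have hk : ∀ᵐ r : ℝ, r ≠ k ∧ r ≠ U p :=
        (measure_eq_zero_iff_ae_notMem.1 (measure_singleton k)).and
          (measure_eq_zero_iff_ae_notMem.1 (measure_singleton (U p)))
      refine intervalIntegral.integral_congr_ae (hk.mono fun r hr hr' => ?_)
      congr 1
      rcases le_total k (U p) with hle | hle
      · rw [uIoc_of_le hle] at hr'
        rw [Real.sign_of_pos (by linarith [hr'.1]), Real.sign_of_pos (by linarith [hr'.1, hr'.2])]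
      · rw [uIoc_of_ge hle] at hr'
        have : r < k := lt_of_le_of_ne hr'.2 hr.1
        rw [Real.sign_of_neg (by linarith), Real.sign_of_neg (by linarith [hr'.1])]
    have h3 : ∫ r in k..U p, deriv f r = f (U p) - f k :=
      intervalIntegral.integral_deriv_eq_sub
        (fun r _ => hf.differentiable one_ne_zero r) (hf'.intervalIntegrable _ _)
    rw [h2, intervalIntegral.integral_const_mul, h3] at h1
    exact h1
  have hident : ∀ n, (∫ p in futureSet, (e n (U p) * pdt Φ p + q n (U p) * pdx Φ p
      + (e' n (U p) * g (U p)) * Φ p)) + ∫ x, e n (U (0, x)) * Φ (0, x) = 0 := by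
    intro n
    have := testFunctional_chain hu (he n) (ce' n) (hq n) (cq' n) hΦ hcφ
    unfold testFunctional at this
    refine Eq.trans ?_ this
    congr 1
    refine setIntegral_congr_fun measurableSet_futureSet fun p hp => ?_
    simp only
    rw [← hpde p hp.1]
    ring
  have lim : Tendsto (fun n => (∫ p in futureSet, (e n (U p) * pdt Φ p + q n (U p) * pdx Φ p
      + (e' n (U p) * g (U p)) * Φ p)) + ∫ x, e n (U (0, x)) * Φ (0, x)) atTop
      (𝓝 ((∫ p in futureSet, (|U p - k| * pdt Φ p
        + Real.sign (U p - k) * (f (U p) - f k) * pdx Φ p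
        + Real.sign (U p - k) * g (U p) * Φ p)) + ∫ x, |u 0 x - k| * Φ (0, x))) := by
    have ie : Integrable (fun p => (|M| + |k| + 1) * |pdt Φ p| + F1 * (|M| + |k|) * |pdx Φ p|
        + G1 * |Φ p|) (volume.restrict futureSet) := by
      have i1 := ((continuous_pdt hΦ).integrable_of_hasCompactSupport (μ := volume)
        (hasCompactSupport_pdt hcφ)).abs
      have i2 := ((continuous_pdx hΦ).integrable_of_hasCompactSupport (μ := volume)
        (hasCompactSupport_pdx hcφ)).abs
      have i3 := (hΦ.continuous.integrable_of_hasCompactSupport (μ := volume) hcφ).abs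
      exact (((i1.const_mul _).add (i2.const_mul _)).add (i3.const_mul _)).restrict
    have be : ∀ n p, |e n (U p)| ≤ |M| + |k| + 1 := by
      intro n p
      rw [abs_of_pos (sqrt_sq_add_sq_pos k (U p) (hd0 n))]
      exact (regularized_abs_le k (U p) (hd0 n)).trans (add_le_add (bUk p) (hd1 n))
    have cU : Continuous U := hu.continuous
    have ce : ∀ n, Continuous (e n) := fun n =>
      continuous_iff_continuousAt.2 fun s => (he n s).continuousAt
    refine Tendsto.add ?_ ?_
    · refine tendsto_integral_of_dominated_convergence _ (fun n => ?_) ie (fun n => ?_) ?_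
      · refine Continuous.aestronglyMeasurable ?_
        have := continuous_pdt hΦ
        have := continuous_pdx hΦ
        have := hΦ.continuous
        have c1 := ce n; have c2 := ce' n; have c3 := cq n
        exact (((c1.comp cU).mul (continuous_pdt hΦ)).add
          ((c3.comp cU).mul (continuous_pdx hΦ))).add
          (((c2.comp cU).mul (hg.comp cU)).mul hΦ.continuous)
      · refine Eventually.of_forall fun p => ?_
        refine (abs_add_three _ _ _).trans ?_
        rw [abs_mul, abs_mul, abs_mul (e' n (U p) * g (U p))]
        have h1 : |e' n (U p) * g (U p)| ≤ G1 := by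
          rw [abs_mul]
          calc _ ≤ 1 * G1 := mul_le_mul (abs_deriv_regularized_abs_le k _ (hd0 n)) (bG p)
                (abs_nonneg _) zero_le_one
            _ = G1 := one_mul _
        gcongr
        · exact be n p
        · exact bq n p
      · exact Eventually.of_forall fun p =>
          (((tendsto_regularized_abs k (U p) hdl).mul_const _).add ((lq p).mul_const _)).add
            (((tendsto_deriv_regularized_abs k (U p) hdl).mul_const _).mul_const _)
    · have cΦ0 : Continuous (fun x => Φ (0, x)) :=
        hΦ.continuous.comp (continuous_const.prodMk continuous_id)
      refine tendsto_integral_of_dominated_convergence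
        (fun x => (|M| + |k| + 1) * |Φ (0, x)|) (fun n => ?_) ?_ (fun n => ?_) ?_
      · exact (((ce n).comp (cU.comp (continuous_const.prodMk continuous_id))).mul
          cΦ0).aestronglyMeasurable
      · exact ((cΦ0.integrable_of_hasCompactSupport
          (hasCompactSupport_slice_right hcφ 0)).abs).const_mul _
      · refine Eventually.of_forall fun x => ?_
        rw [norm_mul]
        exact mul_le_mul_of_nonneg_right (be n (0, x)) (norm_nonneg _)
      · exact Eventually.of_forall fun x => (tendsto_regularized_abs k (u 0 x) hdl).mul_const _
  -- For a `C¹` solution each regularised entropy balance is an equality, so the limiting Kruzhkov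
  -- expression is exactly zero.
  have hzero := tendsto_nhds_unique lim ((tendsto_const_nhds (x := (0 : ℝ))).congr
    fun n => (hident n).symm)
  refine hzero.symm.le.trans (le_of_eq ?_)
  congr 1
  refine setIntegral_congr_fun measurableSet_futureSet fun p _ => ?_
  have dΦ := hΦ.differentiable one_ne_zero p
  rw [show deriv (fun s => φ s p.2) p.1 = pdt Φ p from (hasDerivAt_pdt dΦ).deriv,
    show deriv (fun y => φ p.1 y) p.2 = pdx Φ p from (hasDerivAt_pdx dΦ).deriv]

/-! ### Weak-strong uniqueness by relative entropy. -/

/-- The left-hand side of the Kruzhkov inequality with parameter `k` for a function of space-time. -/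
noncomputable def kruzhkovFunctional (f g : ℝ → ℝ) (u₀ : ℝ → ℝ) (w : ℝ × ℝ → ℝ) (k : ℝ)
    (Φ : ℝ × ℝ → ℝ) : ℝ :=
  testFunctional (fun p => |w p - k|) (fun p => Real.sign (w p - k) * (f (w p) - f k))
    (fun p => Real.sign (w p - k) * g (w p)) (fun x => |u₀ x - k|) Φ

lemma exists_bound_Icc {h : ℝ → ℝ} (hh : Continuous h) (M : ℝ) :
    ∃ C, 0 ≤ C ∧ ∀ s, |s| ≤ M → |h s| ≤ C := by
  obtain ⟨C, hC⟩ := (isCompact_Icc (a := -M) (b := M)).bddAbove_image hh.abs.continuousOn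
  exact ⟨max C 0, le_max_right _ _, fun s hs => (hC ⟨s, abs_le.1 hs, rfl⟩).trans (le_max_left _ _)⟩

lemma exists_lipschitz_Icc {h : ℝ → ℝ} (hh : ContDiff ℝ 1 h) (M : ℝ) :
    ∃ C, 0 ≤ C ∧ ∀ s r, |s| ≤ M → |r| ≤ M → |h s - h r| ≤ C * |s - r| := by
  obtain ⟨C, hC0, hC⟩ := exists_bound_Icc (hh.continuous_deriv le_rfl) M
  refine ⟨C, hC0, fun s r hs hr => ?_⟩
  exact (convex_Icc (-M) M).norm_image_sub_le_of_norm_deriv_le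
    (fun x _ => hh.differentiable one_ne_zero x) (fun x hx => hC x (abs_le.2 hx))
    (abs_le.1 hr) (abs_le.1 hs)

/-- Mean value inequality for `x ↦ h x - h'(r) x`, whose derivative is `O(|s - r|)` between `r` and
`s`. It serves both for the flux remainder in the relative entropy and for the linearisation at the
endstates. -/
lemma exists_taylor_Icc {h : ℝ → ℝ} (hh : ContDiff ℝ 2 h) (M : ℝ) :
    ∃ C, 0 ≤ C ∧ ∀ s r, |s| ≤ M → |r| ≤ M →
      |h s - h r - deriv h r * (s - r)| ≤ C * (s - r) ^ 2 := by
  have hd : ContDiff ℝ 1 (deriv h) := by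
    have : ContDiff ℝ (1 + 1) h := by simpa [one_add_one_eq_two] using hh
    exact (contDiff_succ_iff_deriv.1 this).2.2
  obtain ⟨C, hC0, hC⟩ := exists_lipschitz_Icc hd M
  refine ⟨C, hC0, fun s r hs hr => ?_⟩
  have hdiff : Differentiable ℝ h := hh.differentiable two_ne_zero
  have hder : ∀ x, HasDerivAt (fun x => h x - deriv h r * x) (deriv h x - deriv h r) x := by
    intro x
    exact ((hdiff x).hasDerivAt.fun_sub ((hasDerivAt_id x).const_mul (deriv h r))).congr_deriv
      (by simp)
  have key := (convex_uIcc r s).norm_image_sub_le_of_norm_hasDerivWithin_le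
    (f := fun x => h x - deriv h r * x) (C := C * |s - r|)
    (fun x _ => (hder x).hasDerivWithinAt) (fun x hx => ?_) left_mem_uIcc right_mem_uIcc
  · rw [Real.norm_eq_abs, Real.norm_eq_abs] at key
    calc |h s - h r - deriv h r * (s - r)| = |h s - deriv h r * s - (h r - deriv h r * r)| := by
          congr 1; ring
      _ ≤ C * |s - r| * |s - r| := key
      _ = C * (s - r) ^ 2 := by rw [mul_assoc, ← sq, sq_abs]
  · have hxM : |x| ≤ M := by
      have : x ∈ Icc (-M) M :=
        (convex_Icc (-M) M).ordConnected.uIcc_subset (abs_le.1 hr) (abs_le.1 hs) hx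
      exact abs_le.2 this
    refine (hC x r hxM hr).trans ?_
    exact mul_le_mul_of_nonneg_left (abs_sub_left_of_mem_uIcc hx) hC0

/-- The sign switches once, at `k = w`. All averages in `k` of Kruzhkov integrands reduce to this
formula. -/
lemma integral_sign_mul {M w : ℝ} (h1 : -M ≤ w) (h2 : w ≤ M) {c : ℝ → ℝ} (hc : Continuous c) :
    ∫ k in (-M)..M, Real.sign (w - k) * c k = (∫ k in (-M)..w, c k) - ∫ k in w..M, c k := by
  have hw : ∀ᵐ r : ℝ, r ≠ w := measure_eq_zero_iff_ae_notMem.1 (measure_singleton w)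
  have e1 : ∀ᵐ r : ℝ, r ∈ uIoc (-M) w → c r = Real.sign (w - r) * c r := by
    refine hw.mono fun r hr hr' => ?_
    rw [uIoc_of_le h1] at hr'
    have := lt_of_le_of_ne hr'.2 hr
    rw [Real.sign_of_pos (by linarith), one_mul]
  have e2 : ∀ᵐ r : ℝ, r ∈ uIoc w M → - c r = Real.sign (w - r) * c r := by
    refine Eventually.of_forall fun r hr' => ?_
    rw [uIoc_of_le h2] at hr'
    rw [Real.sign_of_neg (by linarith [hr'.1]), neg_one_mul]
  have i1 : IntervalIntegrable (fun r => Real.sign (w - r) * c r) volume (-M) w :=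
    (hc.intervalIntegrable _ _).congr_ae ((ae_restrict_iff' measurableSet_uIoc).2 e1)
  have i2 : IntervalIntegrable (fun r => Real.sign (w - r) * c r) volume w M :=
    (hc.neg.intervalIntegrable _ _).congr_ae ((ae_restrict_iff' measurableSet_uIoc).2 e2)
  rw [← intervalIntegral.integral_add_adjacent_intervals i1 i2,
    ← intervalIntegral.integral_congr_ae e1, ← intervalIntegral.integral_congr_ae e2,
    intervalIntegral.integral_neg, sub_eq_add_neg]

lemma abs_eq_sign_mul (x : ℝ) : |x| = Real.sign x * x := by
  rcases lt_trichotomy x 0 with h | h | h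
  · rw [abs_of_neg h, Real.sign_of_neg h, neg_one_mul]
  · simp [h]
  · rw [abs_of_pos h, Real.sign_of_pos h, one_mul]

lemma integral_sign {M w : ℝ} (h1 : -M ≤ w) (h2 : w ≤ M) :
    ∫ k in (-M)..M, Real.sign (w - k) = 2 * w := by
  have := integral_sign_mul h1 h2 (c := fun _ => 1) continuous_const
  simp only [mul_one] at this
  rw [this]
  simp
  ring

lemma integral_abs_sub {M w : ℝ} (h1 : -M ≤ w) (h2 : w ≤ M) :
    ∫ k in (-M)..M, |w - k| = w ^ 2 + M ^ 2 := by
  simp_rw [abs_eq_sign_mul (w - _)]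
  rw [integral_sign_mul h1 h2 (c := fun k => w - k) (by fun_prop)]
  rw [intervalIntegral.integral_sub (by simp) (by simp),
    intervalIntegral.integral_sub (by simp) (by simp)]
  simp
  ring

lemma integral_sign_mul_sub {M w : ℝ} (h1 : -M ≤ w) (h2 : w ≤ M) {f : ℝ → ℝ}
    (hf : Continuous f) :
    ∫ k in (-M)..M, Real.sign (w - k) * (f w - f k)
      = 2 * w * f w - 2 * (∫ r in (0 : ℝ)..w, f r) + (∫ r in (0 : ℝ)..M, f r)
        + ∫ r in (0 : ℝ)..(-M), f r := by
  have hi : ∀ a b, IntervalIntegrable f volume a b := fun a b => hf.intervalIntegrable a b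
  rw [integral_sign_mul h1 h2 (c := fun k => f w - f k) (by fun_prop)]
  rw [intervalIntegral.integral_sub (by simp) (hi _ _),
    intervalIntegral.integral_sub (by simp) (hi _ _)]
  rw [← intervalIntegral.integral_interval_sub_left (hi 0 w) (hi 0 (-M)),
    ← intervalIntegral.integral_interval_sub_left (hi 0 M) (hi 0 w)]
  simp
  ring

/-- The flux relative to the quadratic entropy. -/
noncomputable def relativeFlux (f : ℝ → ℝ) (w v : ℝ) : ℝ :=
  2 * (w - v) * f w - 2 * ((∫ r in (0 : ℝ)..w, f r) - ∫ r in (0 : ℝ)..v, f r)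

/-- The relative flux is twice the integral of `f w - f r` for `r` between `v` and `w`, hence
quadratically small. The factor 2 is what fixes the slope of the cones below. -/
lemma abs_relativeFlux_le {f : ℝ → ℝ} (hf : Continuous f) {M C : ℝ}
    (hC0 : 0 ≤ C) (hC : ∀ s r, |s| ≤ M → |r| ≤ M → |f s - f r| ≤ C * |s - r|) {w v : ℝ}
    (hw : |w| ≤ M) (hv : |v| ≤ M) : |relativeFlux f w v| ≤ 2 * C * (w - v) ^ 2 := by
  have hi : ∀ a b, IntervalIntegrable f volume a b := fun a b => hf.intervalIntegrable a b
  have e : relativeFlux f w v = 2 * ∫ r in v..w, (f w - f r) := by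
    unfold relativeFlux
    rw [intervalIntegral.integral_interval_sub_left (hi _ _) (hi _ _),
      intervalIntegral.integral_sub (by simp) (hi _ _)]
    simp
    ring
  have := intervalIntegral.norm_integral_le_of_norm_le_const (a := v) (b := w)
    (f := fun r => f w - f r) (C := C * |w - v|) (fun r hr => by
      have hr' := uIoc_subset_uIcc hr
      have hrM : |r| ≤ M := abs_le.2
        ((convex_Icc (-M) M).ordConnected.uIcc_subset (abs_le.1 hv) (abs_le.1 hw) hr')
      refine (hC w r hw hrM).trans (mul_le_mul_of_nonneg_left ?_ hC0)
      exact abs_sub_right_of_mem_uIcc hr')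
  rw [e, abs_mul, abs_two]
  rw [Real.norm_eq_abs] at this
  calc 2 * |∫ r in v..w, (f w - f r)| ≤ 2 * (C * |w - v| * |w - v|) := by linarith
    _ = 2 * C * (w - v) ^ 2 := by rw [← sq_abs (w - v)]; ring

lemma integrable_testIntegrand {α β γ : ℝ × ℝ → ℝ} {C : ℝ}
    (hα : AEStronglyMeasurable α volume) (hβ : AEStronglyMeasurable β volume)
    (hγ : AEStronglyMeasurable γ volume)
    (bα : ∀ p, |α p| ≤ C) (bβ : ∀ p, |β p| ≤ C) (bγ : ∀ p, |γ p| ≤ C)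
    {Φ : ℝ × ℝ → ℝ} (h : ContDiff ℝ 1 Φ) (hc : HasCompactSupport Φ) :
    Integrable (fun p => α p * pdt Φ p + β p * pdx Φ p + γ p * Φ p)
      (volume.restrict futureSet) :=
  (((integrable_bdd_mul_test hα bα (continuous_pdt h) (hasCompactSupport_pdt hc)).add
    (integrable_bdd_mul_test hβ bβ (continuous_pdx h) (hasCompactSupport_pdx hc))).add
    (integrable_bdd_mul_test hγ bγ h.continuous hc)).restrict

/-- Kruzhkov inequalities yield the inequality for the quadratic entropy. -/
lemma quadratic_of_kruzhkov {f g u₀ : ℝ → ℝ} (hf : Continuous f) (hg : Continuous g)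
    (hu₀ : Continuous u₀) {w : ℝ × ℝ → ℝ} (hw : Measurable w) {M : ℝ}
    (hwM : ∀ p, |w p| ≤ M) (huM : ∀ x, |u₀ x| ≤ M) {Φ : ℝ × ℝ → ℝ}
    (h : ContDiff ℝ 1 Φ) (hc : HasCompactSupport Φ)
    (H : ∀ k, 0 ≤ kruzhkovFunctional f g u₀ w k Φ) :
    0 ≤ testFunctional (fun p => w p ^ 2 + M ^ 2)
      (fun p => 2 * w p * f (w p) - 2 * (∫ r in (0 : ℝ)..(w p), f r) + (∫ r in (0 : ℝ)..M, f r)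
        + ∫ r in (0 : ℝ)..(-M), f r)
      (fun p => 2 * w p * g (w p)) (fun x => u₀ x ^ 2 + M ^ 2) Φ := by
  have hM0 : 0 ≤ M := (abs_nonneg _).trans (hwM 0)
  have hMM : -M ≤ M := by linarith
  obtain ⟨Cf, hCf0, hCf⟩ := exists_bound_Icc hf M
  obtain ⟨Cg, hCg0, hCg⟩ := exists_bound_Icc hg M
  -- Averaging `|w - k|` over `k` in `[-M, M]` gives `w² + M²`. The Kruzhkov inequality is
  -- integrated in `k` and Fubini moves the `k`-integral inside.
  set μ : Measure ℝ := volume.restrict (Ioc (-M) M) with hμ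
  have hk : ∀ᵐ k ∂μ, |k| ≤ M := (ae_restrict_mem measurableSet_Ioc).mono fun k hk =>
    abs_le.2 ⟨hk.1.le, hk.2⟩
  set A : ℝ → ℝ × ℝ → ℝ := fun k p => |w p - k| * pdt Φ p
    + Real.sign (w p - k) * (f (w p) - f k) * pdx Φ p + Real.sign (w p - k) * g (w p) * Φ p with hA
  have m1 : Measurable (fun z : ℝ × (ℝ × ℝ) => w z.2) := hw.comp measurable_snd
  have m2 : Measurable (fun z : ℝ × (ℝ × ℝ) => Real.sign (w z.2 - z.1)) :=
    measurable_real_sign.comp (m1.sub measurable_fst)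
  have hk2 : ∀ {X : Type} [MeasurableSpace X] (ν : Measure X) [SFinite ν],
      ∀ᵐ z ∂(μ.prod ν), |z.1| ≤ M := fun ν _ => Measure.quasiMeasurePreserving_fst.ae hk
  have iA : Integrable (Function.uncurry A) (μ.prod (volume.restrict futureSet)) := by
    refine Integrable.add (Integrable.add ?_ ?_) ?_
    · refine Integrable.bdd_mul (c := 2 * M)
        ((((continuous_pdt h).integrable_of_hasCompactSupport
          (hasCompactSupport_pdt hc)).restrict).comp_snd μ)
        (m1.sub measurable_fst).abs.aestronglyMeasurable ?_
      refine (hk2 _).mono fun z hz => ?_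
      rw [Real.norm_eq_abs, abs_abs]
      exact (abs_sub _ _).trans (by linarith [hwM z.2])
    · refine Integrable.bdd_mul (c := 1 * (Cf + Cf))
        ((((continuous_pdx h).integrable_of_hasCompactSupport
          (hasCompactSupport_pdx hc)).restrict).comp_snd μ)
        (m2.mul ((hf.measurable.comp m1).sub
          (hf.measurable.comp measurable_fst))).aestronglyMeasurable ?_
      refine (hk2 _).mono fun z hz => ?_
      rw [norm_mul]
      exact mul_le_mul (abs_real_sign_le _) ((abs_sub _ _).trans
        (add_le_add (hCf _ (hwM _)) (hCf _ hz))) (norm_nonneg _) zero_le_one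
    · refine Integrable.bdd_mul (c := 1 * Cg)
        (((h.continuous.integrable_of_hasCompactSupport hc).restrict).comp_snd μ)
        (m2.mul (hg.measurable.comp m1)).aestronglyMeasurable ?_
      refine Eventually.of_forall fun z => ?_
      rw [norm_mul]
      exact mul_le_mul (abs_real_sign_le _) (hCg _ (hwM _)) (norm_nonneg _) zero_le_one
  have cΦ0 : Continuous (fun x => Φ (0, x)) :=
    h.continuous.comp (continuous_const.prodMk continuous_id)
  have iB : Integrable (Function.uncurry fun k x => |u₀ x - k| * Φ (0, x))
      (μ.prod (volume : Measure ℝ)) := by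
    refine Integrable.bdd_mul (c := 2 * M)
      ((cΦ0.integrable_of_hasCompactSupport (hasCompactSupport_slice_right hc 0)).comp_snd μ)
      ?_ ?_
    · exact (Continuous.abs (by fun_prop)).aestronglyMeasurable
    · refine (hk2 _).mono fun z hz => ?_
      rw [Real.norm_eq_abs, abs_abs]
      exact (abs_sub _ _).trans (by linarith [huM z.2])
  have hint : 0 ≤ ∫ k, kruzhkovFunctional f g u₀ w k Φ ∂μ := integral_nonneg H
  have hsplit : ∫ k, kruzhkovFunctional f g u₀ w k Φ ∂μ
      = (∫ p in futureSet, ∫ k, A k p ∂μ) + ∫ x, ∫ k, |u₀ x - k| * Φ (0, x) ∂μ := by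
    have j1 : Integrable (fun k => ∫ p in futureSet, A k p) μ := iA.integral_prod_left
    have j2 : Integrable (fun k => ∫ x, |u₀ x - k| * Φ (0, x)) μ := iB.integral_prod_left
    rw [← integral_integral_swap iA, ← integral_integral_swap iB]
    exact integral_add j1 j2
  rw [hsplit] at hint
  refine hint.trans (le_of_eq ?_)
  unfold testFunctional
  have e0 : ∀ F : ℝ → ℝ, ∫ k, F k ∂μ = ∫ k in (-M)..M, F k := fun F =>
    (intervalIntegral.integral_of_le hMM).symm
  congr 1
  · refine integral_congr_ae (Eventually.of_forall fun p => ?_)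
    have hp := abs_le.1 (hwM p)
    have isg : Integrable (fun k => Real.sign (w p - k)) μ := by
      refine Integrable.of_bound (C := 1)
        (measurable_real_sign.comp (measurable_const.sub measurable_id)).aestronglyMeasurable
        (Eventually.of_forall fun k => abs_real_sign_le _)
    have iab : Integrable (fun k => |w p - k|) μ :=
      (Continuous.integrableOn_Ioc (by fun_prop))
    have isf : Integrable (fun k => Real.sign (w p - k) * (f (w p) - f k)) μ :=
      Integrable.bdd_mul (c := 1) (Continuous.integrableOn_Ioc (by fun_prop)) isg.1
        (Eventually.of_forall fun k => abs_real_sign_le _)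
    have j1 : Integrable (fun k => |w p - k| * pdt Φ p) μ := iab.mul_const _
    have j2 : Integrable (fun k => Real.sign (w p - k) * (f (w p) - f k) * pdx Φ p) μ :=
      isf.mul_const _
    have j3 : Integrable (fun k => Real.sign (w p - k) * g (w p) * Φ p) μ :=
      (isg.mul_const _).mul_const _
    have j4 : Integrable (fun k => |w p - k| * pdt Φ p
      + Real.sign (w p - k) * (f (w p) - f k) * pdx Φ p) μ := j1.add j2
    simp only [hA]
    rw [integral_add j4 j3, integral_add j1 j2, integral_mul_const, integral_mul_const,
      integral_mul_const, integral_mul_const, e0, e0, e0,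
      integral_abs_sub hp.1 hp.2, integral_sign_mul_sub hp.1 hp.2 hf, integral_sign hp.1 hp.2]
  · refine integral_congr_ae (Eventually.of_forall fun x => ?_)
    have hx := abs_le.1 (huM x)
    simp only
    rw [integral_mul_const, e0, integral_abs_sub hx.1 hx.2]

lemma contDiff_primitive {f : ℝ → ℝ} (hf : Continuous f) (s : ℝ) :
    HasDerivAt (fun s => ∫ r in (0 : ℝ)..s, f r) (f s) s :=
  intervalIntegral.integral_hasDerivAt_right (hf.intervalIntegrable _ _)
    hf.stronglyMeasurable.stronglyMeasurableAtFilter hf.continuousAt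

/-- Relative entropy inequality between an entropy solution `w` and a classical solution `U`. -/
lemma relative_entropy_nonneg {f g : ℝ → ℝ} (hf : ContDiff ℝ 1 f) (hg : Continuous g)
    {U : ℝ × ℝ → ℝ} (hU : ContDiff ℝ 1 U) {M : ℝ} (hUM : ∀ p, |U p| < M)
    (hpde : ∀ p : ℝ × ℝ, 0 < p.1 → pdt U p + deriv f (U p) * pdx U p = g (U p))
    {w : ℝ × ℝ → ℝ} (hw : Measurable w) (hwM : ∀ p, |w p| < M)
    {Φ : ℝ × ℝ → ℝ} (h : ContDiff ℝ 1 Φ) (hc : HasCompactSupport Φ) (h0 : ∀ p, 0 ≤ Φ p)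
    (H : ∀ k (Ψ : ℝ × ℝ → ℝ), ContDiff ℝ 1 Ψ → HasCompactSupport Ψ → (∀ p, 0 ≤ Ψ p) →
      (∀ p, Φ p = 0 → Ψ p = 0) → 0 ≤ kruzhkovFunctional f g (fun x => U (0, x)) w k Ψ) :
    Integrable (fun p => (w p - U p) ^ 2 * pdt Φ p + relativeFlux f (w p) (U p) * pdx Φ p
      + (2 * (w p - U p) * (g (w p) - g (U p))
        - 2 * (f (w p) - f (U p) - deriv f (U p) * (w p - U p)) * pdx U p) * Φ p)
      (volume.restrict futureSet) ∧
    0 ≤ ∫ p in futureSet, ((w p - U p) ^ 2 * pdt Φ p + relativeFlux f (w p) (U p) * pdx Φ p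
      + (2 * (w p - U p) * (g (w p) - g (U p))
        - 2 * (f (w p) - f (U p) - deriv f (U p) * (w p - U p)) * pdx U p) * Φ p) := by
  have hfc := hf.continuous
  have hU' : ∀ p, |U p| ≤ M := fun p => (hUM p).le
  have hw' : ∀ p, |w p| ≤ M := fun p => (hwM p).le
  have hM0 : 0 ≤ M := (abs_nonneg _).trans (hU' 0)
  have cU0 : Continuous (fun x => U (0, x)) :=
    hU.continuous.comp (continuous_const.prodMk continuous_id)
  obtain ⟨Cf, hCf0, hCf⟩ := exists_bound_Icc hfc M
  obtain ⟨Cg, hCg0, hCg⟩ := exists_bound_Icc hg M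
  set P : ℝ → ℝ := fun s => ∫ r in (0 : ℝ)..s, f r with hP
  have hPd : ∀ s, HasDerivAt P (f s) s := contDiff_primitive hfc
  have hPc : Continuous P := continuous_iff_continuousAt.2 fun s => (hPd s).continuousAt
  obtain ⟨CP, hCP0, hCP⟩ := exists_bound_Icc hPc M
  have bM : |M| ≤ M := (abs_of_nonneg hM0).le
  have bM' : |-M| ≤ M := by rw [abs_neg]; exact bM
  -- the three inequalities
  have K1 := quadratic_of_kruzhkov hfc hg cU0 hw hw' (fun x => hU' (0, x)) h hc
    (fun k => H k Φ h hc h0 fun _ hp => hp)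
  have sL : ContDiff ℝ 1 (fun p => (M - U p) * Φ p) := (contDiff_const.sub hU).mul h
  have sR : ContDiff ℝ 1 (fun p => (M + U p) * Φ p) := (contDiff_const.add hU).mul h
  have cL : HasCompactSupport (fun p => (M - U p) * Φ p) := hc.mul_left
  have cR : HasCompactSupport (fun p => (M + U p) * Φ p) := hc.mul_left
  -- For `k = ±M`, outside the range of `w`, the sign is constant and the Kruzhkov inequalities
  -- become the two one-sided weak forms of the equation for `w`. They are tested against `(M - U)Φ`
  -- and `(M + U)Φ`, nonnegative because `|U| < M`.
  have K2 := H (-M) _ sL cL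
    (fun p => mul_nonneg (by linarith [(abs_lt.1 (hUM p)).2]) (h0 p)) (fun p hp => by simp [hp])
  have K3 := H M _ sR cR
    (fun p => mul_nonneg (by linarith [(abs_lt.1 (hUM p)).1]) (h0 p)) (fun p hp => by simp [hp])
  -- The entropy is dictated by `(w² + M²) + (w + M)(M - U) + (M - w)(M + U) - (3M² - U²) = (w -
  -- U)²`; the flux is chosen so that the same combination of fluxes is the relative flux.
  have K4 := testFunctional_chain hU (e := fun s => 3 * M ^ 2 - s ^ 2) (e' := fun s => -(2 * s))
    (q := fun s => -2 * P s + P M + P (-M) + M * (f M - f (-M)) + s * (f M + f (-M)))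
    (q' := fun s => -2 * f s + (f M + f (-M)))
    (fun s => by
      refine (((hasDerivAt_id s).pow 2).const_sub _).congr_deriv ?_
      simp) (by fun_prop)
    (fun s => by
      refine (((((hPd s).const_mul (-2)).add_const _).add_const _).add_const _).fun_add
        ((hasDerivAt_id s).mul_const _) |>.congr_deriv ?_
      simp) (by fun_prop) h hc
  have mU : Measurable U := hU.continuous.measurable
  -- integrability
  have mw : AEStronglyMeasurable w volume := hw.aestronglyMeasurable
  set I1 : ℝ × ℝ → ℝ := fun p => (w p ^ 2 + M ^ 2) * pdt Φ p
    + (2 * w p * f (w p) - 2 * P (w p) + P M + P (-M)) * pdx Φ p + 2 * w p * g (w p) * Φ p with hI1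
  have i1 : Integrable I1 (volume.restrict futureSet) := by
    refine integrable_testIntegrand
      (C := max (M ^ 2 + M ^ 2) (max (2 * M * Cf + 2 * CP + CP + CP) (2 * M * Cg)))
      ?_ ?_ ?_ (fun p => ?_) (fun p => ?_) (fun p => ?_) h hc
    · exact ((hw.pow_const 2).add_const _).aestronglyMeasurable
    · exact ((((hw.const_mul 2).mul (hfc.measurable.comp hw)).sub
        ((hPc.measurable.comp hw).const_mul 2)).add_const _ |>.add_const _).aestronglyMeasurable
    · exact ((hw.const_mul 2).mul (hg.measurable.comp hw)).aestronglyMeasurable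
    · refine le_trans ?_ (le_max_left _ _)
      rw [abs_of_nonneg (by positivity)]
      have := sq_le_sq.2 (show |w p| ≤ |M| by rw [abs_of_nonneg hM0]; exact hw' p)
      linarith
    · refine le_trans ?_ ((le_max_left _ _).trans (le_max_right _ _))
      have a1 := hCP _ (hw' p)
      have a2 := hCP _ bM
      have a3 := hCP _ bM'
      have a4 : |2 * w p * f (w p)| ≤ 2 * M * Cf := by
        rw [abs_mul, abs_mul, abs_two]
        have := hw' p
        have := hCf _ (hw' p)
        gcongr
      have a5 := abs_add_le (2 * w p * f (w p) - 2 * P (w p) + P M) (P (-M))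
      have a6 := abs_add_le (2 * w p * f (w p) - 2 * P (w p)) (P M)
      have a7 := abs_sub (2 * w p * f (w p)) (2 * P (w p))
      rw [abs_mul 2 (P (w p)), abs_two] at a7
      linarith
    · refine le_trans ?_ ((le_max_right _ _).trans (le_max_right _ _))
      rw [abs_mul, abs_mul, abs_two]
      have := hw' p
      have := hCg _ (hw' p)
      gcongr
  have sgL : ∀ p, Real.sign (w p - -M) = 1 := fun p =>
    Real.sign_of_pos (by linarith [(abs_lt.1 (hwM p)).1])
  have sgR : ∀ p, Real.sign (w p - M) = -1 := fun p =>
    Real.sign_of_neg (by linarith [(abs_lt.1 (hwM p)).2])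
  have bk : ∀ k, |k| ≤ M → ∀ Ψ : ℝ × ℝ → ℝ, ContDiff ℝ 1 Ψ → HasCompactSupport Ψ →
      Integrable (fun p => |w p - k| * pdt Ψ p
        + Real.sign (w p - k) * (f (w p) - f k) * pdx Ψ p
        + Real.sign (w p - k) * g (w p) * Ψ p) (volume.restrict futureSet) := by
    intro k hk Ψ hΨ hΨc
    have ms : Measurable fun p => Real.sign (w p - k) :=
      measurable_real_sign.comp (hw.sub_const k)
    refine integrable_testIntegrand (C := max (M + M) (max (1 * (Cf + Cf)) (1 * Cg)))
      ?_ ?_ ?_ (fun p => ?_) (fun p => ?_) (fun p => ?_) hΨ hΨc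
    · exact (hw.sub_const k).abs.aestronglyMeasurable
    · exact (ms.mul ((hfc.measurable.comp hw).sub_const _)).aestronglyMeasurable
    · exact (ms.mul (hg.measurable.comp hw)).aestronglyMeasurable
    · refine le_trans ?_ (le_max_left _ _)
      rw [abs_abs]
      exact (abs_sub _ _).trans (add_le_add (hw' p) hk)
    · refine le_trans ?_ ((le_max_left _ _).trans (le_max_right _ _))
      rw [abs_mul]
      exact mul_le_mul (abs_real_sign_le _) ((abs_sub _ _).trans
        (add_le_add (hCf _ (hw' p)) (hCf _ hk))) (abs_nonneg _) zero_le_one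
    · refine le_trans ?_ ((le_max_right _ _).trans (le_max_right _ _))
      rw [abs_mul]
      exact mul_le_mul (abs_real_sign_le _) (hCg _ (hw' p)) (abs_nonneg _) zero_le_one
  have i2 := bk (-M) bM' _ sL cL
  have i3 := bk M bM _ sR cR
  set I4 : ℝ × ℝ → ℝ := fun p => (3 * M ^ 2 - U p ^ 2) * pdt Φ p
    + (-2 * P (U p) + P M + P (-M) + M * (f M - f (-M)) + U p * (f M + f (-M))) * pdx Φ p
    + (-(2 * U p) * pdt U p + (-2 * f (U p) + (f M + f (-M))) * pdx U p) * Φ p with hI4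
  have c1 := continuous_pdt h
  have c2 := continuous_pdx h
  have c3 := continuous_pdt hU
  have c4 := continuous_pdx hU
  have c5 := hU.continuous
  have c6 := h.continuous
  have i4 : Integrable I4 (volume.restrict futureSet) := by
    refine Integrable.restrict (Integrable.add (Integrable.add ?_ ?_) ?_)
    · exact Continuous.integrable_of_hasCompactSupport (by fun_prop)
        (hasCompactSupport_pdt hc).mul_left
    · exact Continuous.integrable_of_hasCompactSupport (by fun_prop)
        (hasCompactSupport_pdx hc).mul_left
    · exact Continuous.integrable_of_hasCompactSupport (by fun_prop) hc.mul_left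
  have j : ∀ c : ℝ → ℝ, Continuous c → ∀ Ψ : ℝ × ℝ → ℝ, ContDiff ℝ 1 Ψ → HasCompactSupport Ψ →
      Integrable (fun x => c x * Ψ (0, x)) := fun c hcc Ψ hΨ hΨc =>
    Continuous.integrable_of_hasCompactSupport (hcc.mul
      (hΨ.continuous.comp (continuous_const.prodMk continuous_id)))
      (hasCompactSupport_slice_right hΨc 0).mul_left
  have j1 := j (fun x => U (0, x) ^ 2 + M ^ 2) (by fun_prop) Φ h hc
  have j2 := j (fun x => |U (0, x) - -M|) (by fun_prop) _ sL cL
  have j3 := j (fun x => |U (0, x) - M|) (by fun_prop) _ sR cR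
  -- Both solutions start from the same datum, so the boundary terms at time zero cancel in that
  -- combination.
  have hJ : (∫ x, (U (0, x) ^ 2 + M ^ 2) * Φ (0, x))
      + (∫ x, |U (0, x) - -M| * ((M - U (0, x)) * Φ (0, x)))
      + (∫ x, |U (0, x) - M| * ((M + U (0, x)) * Φ (0, x)))
      = ∫ x, (3 * M ^ 2 - U (0, x) ^ 2) * Φ (0, x) := by
    rw [← integral_add' j1 j2]
    rw [← integral_add' (j1.add j2) j3]
    refine integral_congr_ae (Eventually.of_forall fun x => ?_)
    have a := abs_lt.1 (hUM (0, x))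
    simp only [Pi.add_apply]
    rw [abs_of_pos (by linarith : 0 < U (0, x) - -M), abs_of_neg (by linarith : U (0, x) - M < 0)]
    ring
  unfold kruzhkovFunctional at K2 K3
  unfold testFunctional at K1 K2 K3 K4
  simp only at K1 K2 K3 K4
  have hpt : ∀ p ∈ futureSet, (w p - U p) ^ 2 * pdt Φ p
      + relativeFlux f (w p) (U p) * pdx Φ p
      + (2 * (w p - U p) * (g (w p) - g (U p))
        - 2 * (f (w p) - f (U p) - deriv f (U p) * (w p - U p)) * pdx U p) * Φ p
      = (((I1 + fun p => |w p - -M| * pdt (fun p => (M - U p) * Φ p) p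
          + Real.sign (w p - -M) * (f (w p) - f (-M)) * pdx (fun p => (M - U p) * Φ p) p
          + Real.sign (w p - -M) * g (w p) * ((M - U p) * Φ p))
        + fun p => |w p - M| * pdt (fun p => (M + U p) * Φ p) p
          + Real.sign (w p - M) * (f (w p) - f M) * pdx (fun p => (M + U p) * Φ p) p
          + Real.sign (w p - M) * g (w p) * ((M + U p) * Φ p))
        - I4) p := by
    intro p hp
    have dU := hU.differentiable one_ne_zero p
    have dΦ := h.differentiable one_ne_zero p
    have tL : pdt (fun p => M - U p) p = - pdt U p := by
      rw [pdt_comp dU ((hasDerivAt_id' (U p)).const_sub M)]; ring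
    have tR : pdt (fun p => M + U p) p = pdt U p := by
      rw [pdt_comp dU ((hasDerivAt_id' (U p)).const_add M)]; ring
    have xL : pdx (fun p => M - U p) p = - pdx U p := by
      rw [pdx_comp dU ((hasDerivAt_id' (U p)).const_sub M)]; ring
    have xR : pdx (fun p => M + U p) p = pdx U p := by
      rw [pdx_comp dU ((hasDerivAt_id' (U p)).const_add M)]; ring
    have a := abs_lt.1 (hwM p)
    simp only [sgL, sgR, Pi.add_apply, Pi.sub_apply, hI1, hI4, relativeFlux]
    rw [pdt_mul (dU.const_sub M) dΦ, pdt_mul (dU.const_add M) dΦ, pdx_mul (dU.const_sub M) dΦ,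
      pdx_mul (dU.const_add M) dΦ, tL, tR, xL, xR,
      abs_of_pos (by linarith : 0 < w p - -M), abs_of_neg (by linarith : w p - M < 0)]
    -- Derivatives of `U` enter when the products `(M ∓ U)Φ` and the entropy of `U` are
    -- differentiated; the equation for `U` trades them for the source difference and the flux
    -- remainder.
    have := hpde p hp.1
    simp only [hP]
    linear_combination (2 * (w p - U p) * Φ p) * this
  have hfin : (∫ p in futureSet, ((w p - U p) ^ 2 * pdt Φ p
      + relativeFlux f (w p) (U p) * pdx Φ p
      + (2 * (w p - U p) * (g (w p) - g (U p))
        - 2 * (f (w p) - f (U p) - deriv f (U p) * (w p - U p)) * pdx U p) * Φ p))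
      = (∫ p in futureSet, I1 p)
        + (∫ p in futureSet, (|w p - -M| * pdt (fun p => (M - U p) * Φ p) p
          + Real.sign (w p - -M) * (f (w p) - f (-M)) * pdx (fun p => (M - U p) * Φ p) p
          + Real.sign (w p - -M) * g (w p) * ((M - U p) * Φ p)))
        + (∫ p in futureSet, (|w p - M| * pdt (fun p => (M + U p) * Φ p) p
          + Real.sign (w p - M) * (f (w p) - f M) * pdx (fun p => (M + U p) * Φ p) p
          + Real.sign (w p - M) * g (w p) * ((M + U p) * Φ p)))
        - ∫ p in futureSet, I4 p := by
    rw [← integral_add' i1 i2]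
    rw [← integral_add' (i1.add i2) i3]
    rw [← integral_sub' ((i1.add i2).add i3) i4]
    exact setIntegral_congr_fun measurableSet_futureSet hpt
  refine ⟨(((i1.add i2).add i3).sub i4).congr
    ((ae_restrict_mem measurableSet_futureSet).mono fun p hp => (hpt p hp).symm), ?_⟩
  rw [hfin]
  linarith [K1, K2, K3, K4, hJ]

/-- The square of the positive part. -/
noncomputable def posSq (s : ℝ) : ℝ := (max s 0) ^ 2

lemma posSq_nonneg (s : ℝ) : 0 ≤ posSq s := sq_nonneg _

lemma posSq_of_nonpos {s : ℝ} (h : s ≤ 0) : posSq s = 0 := by simp [posSq, max_eq_right h]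

lemma posSq_pos {s : ℝ} (h : 0 < s) : 0 < posSq s := by
  unfold posSq; rw [max_eq_left h.le]; positivity

lemma hasDerivAt_posSq (s : ℝ) : HasDerivAt posSq (2 * max s 0) s := by
  rcases lt_trichotomy s 0 with h | h | h
  · rw [max_eq_right h.le, mul_zero]
    refine (hasDerivAt_const s (0 : ℝ)).congr_of_eventuallyEq ?_
    filter_upwards [Iio_mem_nhds h] with r hr
    exact posSq_of_nonpos (le_of_lt hr)
  · subst h
    simp only [max_self, mul_zero]
    rw [hasDerivAt_iff_isLittleO]
    simp only [posSq_of_nonpos le_rfl, sub_zero, smul_zero]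
    refine Asymptotics.IsBigO.trans_isLittleO (g := fun x : ℝ => x ^ 2) ?_ ?_
    · refine Asymptotics.isBigO_of_le _ fun x => ?_
      unfold posSq
      rw [norm_pow, norm_pow, Real.norm_eq_abs, Real.norm_eq_abs]
      refine pow_le_pow_left₀ (abs_nonneg _) ?_ 2
      rw [abs_of_nonneg (le_max_right _ _)]
      exact max_le (le_abs_self x) (abs_nonneg x)
    · simpa using Asymptotics.isLittleO_pow_id (𝕜 := ℝ) one_lt_two
  · rw [max_eq_left h.le]
    refine HasDerivAt.congr_of_eventuallyEq (f := fun r : ℝ => r ^ 2) ?_ ?_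
    · simpa using hasDerivAt_pow 2 s
    · filter_upwards [Ioi_mem_nhds h] with r hr
      unfold posSq; rw [max_eq_left (le_of_lt hr)]

lemma contDiff_posSq : ContDiff ℝ 1 posSq := contDiff_one_iff_deriv.2
  ⟨fun s => (hasDerivAt_posSq s).differentiableAt, by
    rw [show deriv posSq = fun s => 2 * max s 0 from funext fun s => (hasDerivAt_posSq s).deriv]
    fun_prop⟩

/-- Time factor of the test function supported in a truncated cone. -/
noncomputable def coneTime (K T t : ℝ) : ℝ :=
  Real.smoothTransition (t + 1) * (Real.exp (-K * t) * posSq (T - t))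

/-- Cone factor of the test function supported in a truncated cone. -/
noncomputable def coneSpace (L A : ℝ) (p : ℝ × ℝ) : ℝ := posSq (A - L * p.1 - √(1 + p.2 ^ 2))

lemma contDiff_coneTime (K T : ℝ) : ContDiff ℝ 1 (coneTime K T) := by
  refine ContDiff.mul ?_ (ContDiff.mul ?_ ?_)
  · exact Real.smoothTransition.contDiff.comp (contDiff_id.add contDiff_const)
  · exact Real.contDiff_exp.comp (contDiff_const.mul contDiff_id)
  · exact contDiff_posSq.comp (contDiff_const.sub contDiff_id)

lemma coneTime_nonneg (K T t : ℝ) : 0 ≤ coneTime K T t :=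
  mul_nonneg (Real.smoothTransition.nonneg _) (mul_nonneg (Real.exp_pos _).le (posSq_nonneg _))

/-- At positive times the initial cutoff is locally 1, and `posSq (T - t)` is nonincreasing, so only
the exponential contributes. This Gronwall factor will absorb the zeroth-order terms. -/
lemma deriv_coneTime_le (K T : ℝ) {t : ℝ} (ht : 0 < t) :
    deriv (coneTime K T) t ≤ -K * coneTime K T t := by
  have he : coneTime K T =ᶠ[𝓝 t] fun t => Real.exp (-K * t) * posSq (T - t) := by
    filter_upwards [Ioi_mem_nhds ht] with s hs
    unfold coneTime
    rw [Real.smoothTransition.one_of_one_le (by linarith [mem_Ioi.1 hs]), one_mul]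
  have h1 : HasDerivAt (fun t => Real.exp (-K * t)) (Real.exp (-K * t) * (-K)) t := by
    simpa using ((hasDerivAt_id t).const_mul (-K)).exp
  have h2 : HasDerivAt (fun t => posSq (T - t)) (-(2 * max (T - t) 0)) t := by
    exact ((hasDerivAt_posSq (T - t)).comp t ((hasDerivAt_id' t).const_sub T)).congr_deriv
      (by ring)
  rw [he.deriv_eq, he.eq_of_nhds, (h1.fun_mul h2).deriv]
  have := mul_nonneg (Real.exp_pos (-K * t)).le (le_max_right (T - t) 0)
  nlinarith

lemma hasDerivAt_sqrt_one_add_sq (x : ℝ) :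
    HasDerivAt (fun x : ℝ => √(1 + x ^ 2)) (x / √(1 + x ^ 2)) x := by
  have h1 : HasDerivAt (fun x : ℝ => 1 + x ^ 2) (2 * x) x := by
    simpa using (hasDerivAt_pow 2 x).const_add 1
  refine (h1.sqrt (by positivity)).congr_deriv ?_
  rw [mul_div_mul_left _ _ two_ne_zero]

lemma contDiff_coneSpace (L A : ℝ) : ContDiff ℝ 1 (coneSpace L A) := by
  refine contDiff_posSq.comp ((contDiff_const.sub (contDiff_const.mul contDiff_fst)).sub ?_)
  refine ContDiff.sqrt (contDiff_const.add (contDiff_snd.pow 2)) fun p => by positivity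

lemma pdt_coneSpace (L A : ℝ) (p : ℝ × ℝ) :
    pdt (coneSpace L A) p = -(2 * L * max (A - L * p.1 - √(1 + p.2 ^ 2)) 0) := by
  refine (hasDerivAt_pdt ((contDiff_coneSpace L A).differentiable one_ne_zero p)).unique ?_
  have h : HasDerivAt (fun s => A - L * s - √(1 + p.2 ^ 2)) (-L) p.1 := by
    simpa using (((hasDerivAt_id' p.1).const_mul L).const_sub A).sub_const (√(1 + p.2 ^ 2))
  refine ((hasDerivAt_posSq _).comp p.1 h).congr_deriv ?_
  ring

/-- `√(1 + x²)` is a smooth substitute for `|x|` with slope at most 1. Compared with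
`pdt_coneSpace`, the time derivative therefore dominates `L` times the space derivative. -/
lemma abs_pdx_coneSpace_le (L A : ℝ) (p : ℝ × ℝ) :
    |pdx (coneSpace L A) p| ≤ 2 * max (A - L * p.1 - √(1 + p.2 ^ 2)) 0 := by
  have h : HasDerivAt (fun y => A - L * p.1 - √(1 + y ^ 2)) (-(p.2 / √(1 + p.2 ^ 2))) p.2 :=
    (hasDerivAt_sqrt_one_add_sq p.2).const_sub _
  have e := (hasDerivAt_pdx ((contDiff_coneSpace L A).differentiable one_ne_zero p)).unique
    ((hasDerivAt_posSq _).comp p.2 h)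
  rw [e, abs_mul, abs_of_nonneg (mul_nonneg zero_le_two (le_max_right _ _)), abs_neg]
  refine mul_le_of_le_one_right (mul_nonneg zero_le_two (le_max_right _ _)) ?_
  have hpos : 0 < √(1 + p.2 ^ 2) := Real.sqrt_pos.2 (by positivity)
  rw [abs_div, abs_of_pos hpos, div_le_one hpos]
  exact Real.abs_le_sqrt (by linarith)

lemma cone_support {K T L A : ℝ} (hL : 0 ≤ L) {p : ℝ × ℝ}
    (hp : coneTime K T p.1 * coneSpace L A p ≠ 0) :
    p ∈ Icc (-1) T ×ˢ Icc (-(A + L)) (A + L) := by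
  have h1 : coneTime K T p.1 ≠ 0 := left_ne_zero_of_mul hp
  have h2 : coneSpace L A p ≠ 0 := right_ne_zero_of_mul hp
  have a1 : -1 ≤ p.1 := by
    by_contra hcon
    exact h1 (by simp [coneTime, Real.smoothTransition.zero_of_nonpos
      (by linarith : p.1 + 1 ≤ 0)])
  have a2 : p.1 ≤ T := by
    by_contra hcon
    exact h1 (by simp [coneTime, posSq_of_nonpos (by linarith : T - p.1 ≤ 0)])
  have a3 : √(1 + p.2 ^ 2) ≤ A - L * p.1 := by
    by_contra hcon
    exact h2 (posSq_of_nonpos (by linarith))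
  have a4 : |p.2| ≤ √(1 + p.2 ^ 2) := Real.abs_le_sqrt (by linarith)
  have a5 : |p.2| ≤ A + L := by nlinarith
  exact ⟨⟨a1, a2⟩, abs_le.1 a5⟩

/-- A bounded function satisfying the Kruzhkov inequalities up to time `T` coincides with the
classical solution having the same initial datum. -/
lemma ae_eq_of_kruzhkov {f g : ℝ → ℝ} (hf : ContDiff ℝ 2 f) (hg : ContDiff ℝ 1 g)
    {U : ℝ × ℝ → ℝ} (hU : ContDiff ℝ 1 U) {M : ℝ} (hUM : ∀ p, |U p| < M)
    (hpde : ∀ p : ℝ × ℝ, 0 < p.1 → pdt U p + deriv f (U p) * pdx U p = g (U p))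
    {w : ℝ × ℝ → ℝ} (hw : Measurable w) (hwM : ∀ p, |w p| < M) {T : ℝ}
    (H : ∀ k (Ψ : ℝ × ℝ → ℝ), ContDiff ℝ 1 Ψ → HasCompactSupport Ψ → (∀ p, 0 ≤ Ψ p) →
      (∀ p : ℝ × ℝ, T ≤ p.1 → Ψ p = 0) →
        0 ≤ kruzhkovFunctional f g (fun x => U (0, x)) w k Ψ) :
    ∀ᵐ p ∂(volume : Measure (ℝ × ℝ)).restrict futureSet, p.1 < T → w p = U p := by
  have hf1 : ContDiff ℝ 1 f := hf.of_le one_le_two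
  have hU' : ∀ p, |U p| ≤ M := fun p => (hUM p).le
  have hw' : ∀ p, |w p| ≤ M := fun p => (hwM p).le
  have hM0 : 0 ≤ M := (abs_nonneg _).trans (hU' 0)
  obtain ⟨L, hL0, hL⟩ := exists_lipschitz_Icc hf1 M
  obtain ⟨Lg, hLg0, hLg⟩ := exists_lipschitz_Icc hg M
  obtain ⟨C2, hC20, hC2⟩ := exists_taylor_Icc hf M
  have key : ∀ A : ℝ, ∀ᵐ p ∂(volume : Measure (ℝ × ℝ)).restrict futureSet,
      p.1 < T → √(1 + p.2 ^ 2) < A - 2 * L * p.1 → w p = U p := by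
    intro A
    have hbox : IsCompact (Icc (-1) T ×ˢ Icc (-(A + 2 * L)) (A + 2 * L) : Set (ℝ × ℝ)) :=
      isCompact_Icc.prod isCompact_Icc
    obtain ⟨D', hD'⟩ := hbox.bddAbove_image (continuous_pdx hU).abs.continuousOn
    set D := max D' 0
    have hD : ∀ p ∈ (Icc (-1) T ×ˢ Icc (-(A + 2 * L)) (A + 2 * L) : Set (ℝ × ℝ)), |pdx U p| ≤ D :=
      fun p hp => (hD' ⟨p, hp, rfl⟩).trans (le_max_left _ _)
    have hD0 : 0 ≤ D := le_max_right _ _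
    -- The first two terms compensate the source and the flux remainder; the extra 1 leaves `-(w -
    -- U)² Φ` as a strictly coercive remainder.
    set K := 2 * Lg + 2 * C2 * D + 1 with hK
    -- The cone has slope `2L`, not `L`, because the relative flux is bounded by `2L (w - U)²`.
    set Φ : ℝ × ℝ → ℝ := fun p => coneTime K T p.1 * coneSpace (2 * L) A p with hΦdef
    have cT : ContDiff ℝ 1 (fun p : ℝ × ℝ => coneTime K T p.1) :=
      (contDiff_coneTime K T).comp contDiff_fst
    have hΦ : ContDiff ℝ 1 Φ := cT.mul (contDiff_coneSpace (2 * L) A)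
    have hc : HasCompactSupport Φ :=
      HasCompactSupport.of_support_subset_isCompact hbox fun p hp => cone_support (mul_nonneg zero_le_two hL0) hp
    have h0 : ∀ p, 0 ≤ Φ p := fun p => mul_nonneg (coneTime_nonneg _ _ _) (posSq_nonneg _)
    have hrel := relative_entropy_nonneg hf1 hg.continuous hU hUM hpde hw hwM hΦ hc h0
      (fun k Ψ h1 h2 h3 h4 => H k Ψ h1 h2 h3 fun p hp => h4 p (by
        have : coneTime K T p.1 = 0 := by
          simp [coneTime, posSq_of_nonpos (by linarith : T - p.1 ≤ 0)]
        simp [hΦdef, this]))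
    set I : ℝ × ℝ → ℝ := fun p => (w p - U p) ^ 2 * pdt Φ p
      + relativeFlux f (w p) (U p) * pdx Φ p
      + (2 * (w p - U p) * (g (w p) - g (U p))
        - 2 * (f (w p) - f (U p) - deriv f (U p) * (w p - U p)) * pdx U p) * Φ p with hI
    have hle : ∀ p ∈ futureSet, I p ≤ -((w p - U p) ^ 2 * Φ p) := by
      intro p hp
      set E := (w p - U p) ^ 2 with hE
      have hE0 : 0 ≤ E := sq_nonneg _
      set m := max (A - 2 * L * p.1 - √(1 + p.2 ^ 2)) 0
      have hm : 0 ≤ m := le_max_right _ _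
      set θ := coneTime K T p.1
      set Z := coneSpace (2 * L) A p
      have hθ : 0 ≤ θ := coneTime_nonneg _ _ _
      have hZ : 0 ≤ Z := posSq_nonneg _
      have dT : DifferentiableAt ℝ (fun p : ℝ × ℝ => coneTime K T p.1) p :=
        cT.differentiable one_ne_zero p
      have dZ : DifferentiableAt ℝ (coneSpace (2 * L) A) p :=
        (contDiff_coneSpace (2 * L) A).differentiable one_ne_zero p
      have hderT := ((contDiff_coneTime K T).differentiable one_ne_zero p.1).hasDerivAt
      have e1 : pdt (fun p : ℝ × ℝ => coneTime K T p.1) p = deriv (coneTime K T) p.1 := by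
        rw [pdt_comp (Φ := Prod.fst) differentiableAt_fst hderT]
        simp [pdt, fderiv_fst]
      have e2 : pdx (fun p : ℝ × ℝ => coneTime K T p.1) p = 0 := by
        rw [pdx_comp (Φ := Prod.fst) differentiableAt_fst hderT]
        simp [pdx, fderiv_fst]
      have e3 : pdt Φ p = deriv (coneTime K T) p.1 * Z + θ * -(2 * (2 * L) * m) := by
        rw [hΦdef, pdt_mul dT dZ, e1, pdt_coneSpace]
      have e4 : pdx Φ p = θ * pdx (coneSpace (2 * L) A) p := by
        rw [hΦdef, pdx_mul dT dZ, e2]; ring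
      have b1 : pdt Φ p ≤ -K * θ * Z - 4 * L * (θ * m) := by
        rw [e3]
        have := mul_le_mul_of_nonneg_right (deriv_coneTime_le K T hp.1) hZ
        linarith
      have b2 : |pdx Φ p| ≤ 2 * (θ * m) := by
        rw [e4, abs_mul, abs_of_nonneg hθ]
        have := mul_le_mul_of_nonneg_left (abs_pdx_coneSpace_le (2 * L) A p) hθ
        linarith
      have b3 : relativeFlux f (w p) (U p) * pdx Φ p ≤ 4 * L * E * (θ * m) := by
        have := mul_le_mul (abs_relativeFlux_le hf1.continuous hL0 hL (hw' p) (hU' p)) b2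
          (abs_nonneg _) (by positivity)
        rw [← abs_mul] at this
        have := (le_abs_self _).trans this
        linarith
      have b4 : (2 * (w p - U p) * (g (w p) - g (U p))
        - 2 * (f (w p) - f (U p) - deriv f (U p) * (w p - U p)) * pdx U p) * Φ p
          ≤ (2 * Lg + 2 * C2 * D) * E * Φ p := by
        rcases eq_or_ne (Φ p) 0 with hz | hz
        · rw [hz, mul_zero, mul_zero]
        · have hpb := hD p (cone_support (mul_nonneg zero_le_two hL0) hz)
          refine mul_le_mul_of_nonneg_right ?_ (h0 p)
          have c1 : (w p - U p) * (g (w p) - g (U p)) ≤ Lg * E := by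
            refine (le_abs_self _).trans ?_
            rw [abs_mul]
            calc _ ≤ |w p - U p| * (Lg * |w p - U p|) :=
                  mul_le_mul_of_nonneg_left (hLg _ _ (hw' p) (hU' p)) (abs_nonneg _)
              _ = Lg * E := by rw [hE, ← sq_abs]; ring
          have c2 : -((f (w p) - f (U p) - deriv f (U p) * (w p - U p)) * pdx U p)
              ≤ C2 * E * D := by
            refine (neg_le_abs _).trans ?_
            rw [abs_mul]
            exact mul_le_mul (hC2 _ _ (hw' p) (hU' p)) hpb (abs_nonneg _) (by positivity)
          linarith
      have b5 := mul_le_mul_of_nonneg_left b1 hE0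
      have hΦp : Φ p = θ * Z := rfl
      simp only [hI]
      rw [hΦp] at b4 ⊢
      rw [hK] at b5
      linarith
    obtain ⟨iI, hrel⟩ := hrel
    have mU : Measurable U := hU.continuous.measurable
    have iE : Integrable (fun p => (w p - U p) ^ 2 * Φ p) (volume.restrict futureSet) := by
      refine (integrable_bdd_mul_test (C := (M + M) ^ 2)
        ((hw.sub mU).pow_const 2).aestronglyMeasurable (fun p => ?_) hΦ.continuous hc).restrict
      rw [abs_pow]
      exact pow_le_pow_left₀ (abs_nonneg _)
        ((abs_sub _ _).trans (add_le_add (hw' p) (hU' p))) 2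
    have hE0 : ∀ p, 0 ≤ (w p - U p) ^ 2 * Φ p := fun p => mul_nonneg (sq_nonneg _) (h0 p)
    have hmono := setIntegral_mono_on iI iE.neg measurableSet_futureSet hle
    have hzero : ∫ p in futureSet, (w p - U p) ^ 2 * Φ p = 0 := by
      refine le_antisymm ?_ (integral_nonneg hE0)
      have e : ∫ p in futureSet, (-fun p => (w p - U p) ^ 2 * Φ p) p
          = -∫ p in futureSet, (w p - U p) ^ 2 * Φ p := integral_neg _
      linarith [hrel.trans (hmono.trans e.le)]
    have hae := (integral_eq_zero_iff_of_nonneg hE0 iE).1 hzero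
    filter_upwards [hae, ae_restrict_mem measurableSet_futureSet] with p hp hpS hpT hpA
    have hpos : 0 < Φ p := by
      refine mul_pos (mul_pos ?_ (mul_pos (Real.exp_pos _) (posSq_pos (by linarith))))
        (posSq_pos (by linarith))
      exact Real.smoothTransition.pos_of_pos (by linarith [mem_Ioi.1 hpS.1])
    have hsq : (w p - U p) ^ 2 = 0 := (mul_eq_zero.1 hp).resolve_right hpos.ne'
    exact sub_eq_zero.1 (pow_eq_zero_iff two_ne_zero |>.1 hsq)
  -- Cones of integer height exhaust the strip.
  have hall := ae_all_iff.2 fun n : ℕ => key n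
  filter_upwards [hall] with p hp hpT
  obtain ⟨n, hn⟩ := exists_nat_gt (√(1 + p.2 ^ 2) + 2 * L * p.1)
  exact hp n hpT (by linarith)

/-- Uniqueness of entropy solutions in the presence of a bounded classical solution. -/
theorem ae_eq_of_isEntropySolution {f g : ℝ → ℝ} (hf : ContDiff ℝ 2 f) (hg : ContDiff ℝ 1 g)
    {u : ℝ → ℝ → ℝ} (hu : ContDiff ℝ 1 (fun p : ℝ × ℝ => u p.1 p.2)) {Mu : ℝ}
    (hM : ∀ t x, |u t x| ≤ Mu)
    (hpde : ∀ p : ℝ × ℝ, 0 < p.1 → pdt (fun p : ℝ × ℝ => u p.1 p.2) p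
      + deriv f (u p.1 p.2) * pdx (fun p : ℝ × ℝ => u p.1 p.2) p = g (u p.1 p.2))
    {w : ℝ → ℝ → ℝ} (hw : IsEntropySolution f g (u 0) w) :
    ∀ᵐ p ∂((volume : Measure (ℝ × ℝ)).restrict (Ioi 0 ×ˢ univ)), w p.1 p.2 = u p.1 p.2 := by
  obtain ⟨hmeas, hbd, hent⟩ := hw
  have key : ∀ n : ℕ, ∀ᵐ p ∂(volume : Measure (ℝ × ℝ)).restrict futureSet,
      p.1 < (n : ℝ) → w p.1 p.2 = u p.1 p.2 := by
    intro n
    obtain ⟨Mw, hMw⟩ := hbd ((n : ℝ) + 1) (by positivity)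
    set B := max Mw 0 with hB
    have hB0 : 0 ≤ B := le_max_right _ _
    -- A Borel representative truncated at the essential bound: measurable and bounded everywhere,
    -- and almost everywhere equal to `w` before time `n + 1`.
    set w' : ℝ × ℝ → ℝ := fun p => max (-B) (min B (hmeas.mk _ p)) with hw'
    have hw'm : Measurable w' :=
      measurable_const.max (measurable_const.min hmeas.stronglyMeasurable_mk.measurable)
    have hw'B : ∀ p, |w' p| ≤ B := fun p =>
      abs_le.2 ⟨le_max_left _ _, max_le (by linarith) (min_le_left _ _)⟩
    have hMw' : ∀ᵐ p ∂(volume : Measure (ℝ × ℝ)).restrict futureSet,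
        p.1 < (n : ℝ) + 1 → |w p.1 p.2| ≤ Mw := by
      rw [ae_restrict_iff' (measurableSet_Ioo.prod MeasurableSet.univ)] at hMw
      rw [ae_restrict_iff' measurableSet_futureSet]
      filter_upwards [hMw] with p hp hpS hpT
      exact hp ⟨⟨hpS.1, hpT⟩, hpS.2⟩
    have heq : ∀ᵐ p ∂(volume : Measure (ℝ × ℝ)).restrict futureSet,
        p.1 < (n : ℝ) + 1 → w' p = w p.1 p.2 := by
      filter_upwards [hMw', hmeas.ae_eq_mk] with p hp he hpT
      have h1 := abs_le.1 ((hp hpT).trans (le_max_left Mw 0))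
      simp only [hw', ← he]
      rw [min_eq_right h1.2, max_eq_right h1.1]
    have hMu0 : 0 ≤ Mu := (abs_nonneg _).trans (hM 0 0)
    have hfc := hf.continuous
    have hgc := hg.continuous
    have hw'M : ∀ p, |w' p| < B + Mu + 1 := fun p => by linarith [hw'B p]
    have huM : ∀ p : ℝ × ℝ, |u p.1 p.2| < B + Mu + 1 := fun p => by linarith [hM p.1 p.2]
    have hres := ae_eq_of_kruzhkov hf hg hu huM hpde hw'm hw'M (T := n) (fun k Ψ h1 h2 h3 h4 => by
      obtain ⟨Cf, hCf0, hCf⟩ := exists_bound_Icc hfc B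
      obtain ⟨Cg, hCg0, hCg⟩ := exists_bound_Icc hgc B
      have ms : Measurable fun p => Real.sign (w' p - k) :=
        measurable_real_sign.comp (hw'm.sub_const k)
      refine testFunctional_nonneg_of_smooth (T := n)
        (C := max (B + |k|) (max (1 * (Cf + |f k|)) (1 * Cg))) ?_ ?_ ?_ ?_ (fun p => ?_)
        (fun p => ?_) (fun p => ?_) ?_ h1 h2 h3 h4
      · exact (hw'm.sub_const k).abs.aestronglyMeasurable
      · exact (ms.mul ((hfc.measurable.comp hw'm).sub_const _)).aestronglyMeasurable
      · exact (ms.mul (hgc.measurable.comp hw'm)).aestronglyMeasurable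
      · have : Continuous fun x => u 0 x :=
          hu.continuous.comp (continuous_const.prodMk continuous_id)
        fun_prop
      · refine le_trans ?_ (le_max_left _ _)
        rw [abs_abs]
        exact (abs_sub _ _).trans (add_le_add (hw'B p) le_rfl)
      · refine le_trans ?_ ((le_max_left _ _).trans (le_max_right _ _))
        rw [abs_mul]
        exact mul_le_mul (abs_real_sign_le _) ((abs_sub _ _).trans
          (add_le_add (hCf _ (hw'B p)) le_rfl)) (abs_nonneg _) zero_le_one
      · refine le_trans ?_ ((le_max_right _ _).trans (le_max_right _ _))
        rw [abs_mul]
        exact mul_le_mul (abs_real_sign_le _) (hCg _ (hw'B p)) (abs_nonneg _) zero_le_one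
      · intro Φ s1 s2 s3 s4
        have := hent k (fun t x => Φ (t, x)) s1 s2 (fun t x => s3 _)
        refine this.trans (le_of_eq ?_)
        unfold testFunctional
        congr 1
        refine integral_congr_ae ?_
        filter_upwards [heq] with p hp
        have dΦ : DifferentiableAt ℝ Φ p := s1.differentiable (by simp) p
        rw [(hasDerivAt_pdt dΦ).deriv, (hasDerivAt_pdx dΦ).deriv]
        by_cases hpT : p.1 < (n : ℝ) + 1
        · rw [hp hpT]
        -- From time `n + 1` on nothing relates `w'` to `w`, but there the nonnegative `Φ` vanishes,
        -- so each such point is a minimum and the gradient vanishes as well.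
        · have z0 : Φ p = 0 := s4 p (not_lt.1 hpT)
          have hmin : IsLocalMin Φ p := Eventually.of_forall fun q => by rw [z0]; exact s3 q
          have z1 : fderiv ℝ Φ p = 0 := hmin.fderiv_eq_zero
          simp [pdt, pdx, z0, z1])
    filter_upwards [hres, heq] with p hp he hpT
    rw [← he (by linarith), hp hpT]
  have hall := ae_all_iff.2 key
  filter_upwards [hall] with p hp
  obtain ⟨n, hn⟩ := exists_nat_gt p.1
  exact hp n hn

/-! ### Linearising coordinate at a simple zero. -/

/-- Linearisation of a scalar vector field `F` near a simple zero: a `C¹` coordinate `h` in which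
the flow of `F` is linear. -/
lemma exists_linearizing_coordinate {F : ℝ → ℝ} {μ C r : ℝ} (hμ : 0 < μ) (hr : 0 < r)
    (hF : ContinuousOn F (Iio 1)) (hF0 : F 0 = 0) (hsign : ∀ w < 1, w ≠ 0 → 0 < w * F w)
    (hC : ∀ w, |w| ≤ r → |F w - μ * w| ≤ C * w ^ 2) :
    ∃ h h' : ℝ → ℝ, (∀ w < 1, HasDerivAt h (h' w) w) ∧ ContinuousOn h' (Iio 1) ∧
      (∀ w < 1, 0 < h' w) ∧ h 0 = 0 ∧ ∀ w < 1, h' w * F w = μ * h w := by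
  have hFne : ∀ w < 1, w ≠ 0 → F w ≠ 0 := fun w h1 h2 h3 => by
    have := hsign w h1 h2; rw [h3, mul_zero] at this; exact lt_irrefl _ this
  have hC0 : 0 ≤ C := by
    have h1 := (abs_nonneg _).trans (hC r (abs_of_pos hr).le)
    by_contra hcon
    have : C * r ^ 2 < 0 := mul_neg_of_neg_of_pos (not_le.1 hcon) (by positivity)
    linarith
  -- On `|w| ≤ ρ` the quadratic error is at most half the linear part, whence `|F w| ≥ μ|w|/2`.
  set ρ := min (min r (1 / 2)) (μ / (2 * (C + 1))) with hρ
  have hρ0 : 0 < ρ := lt_min (lt_min hr (by norm_num)) (by positivity)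
  have hρr : ρ ≤ r := (min_le_left _ _).trans (min_le_left _ _)
  have hρ1 : ρ < 1 := ((min_le_left _ _).trans (min_le_right _ _)).trans_lt (by norm_num)
  have hρC : C * ρ ≤ μ / 2 := by
    have h1 : ρ ≤ μ / (2 * (C + 1)) := min_le_right _ _
    calc C * ρ ≤ (C + 1) * (μ / (2 * (C + 1))) :=
          mul_le_mul (by linarith) h1 hρ0.le (by linarith)
      _ = μ / 2 := by field_simp
  -- The requirement is `h'/h = μ/F`. Removing the logarithmic singularity leads to `h w = w
  -- exp(∫₀^w ψ)`, where `ψ` is bounded near 0 because `F w = μw + O(w²)`. Division by zero makes `ψ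
  -- 0 = 0`, which is harmless.
  set ψ : ℝ → ℝ := fun w => μ / F w - 1 / w with hψ
  have hopen : IsOpen (Iio (1 : ℝ) ∩ {0}ᶜ) := isOpen_Iio.inter isOpen_compl_singleton
  have hψc : ContinuousOn ψ (Iio 1 ∩ {0}ᶜ) := by
    refine ContinuousOn.sub ?_ ?_
    · exact continuousOn_const.div (hF.mono inter_subset_left) fun w hw => hFne w hw.1 hw.2
    · exact continuousOn_const.div continuousOn_id fun w hw => hw.2
  have hψb : ∀ w, |w| ≤ ρ → |ψ w| ≤ 2 * C / μ := by
    intro w hw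
    rcases eq_or_ne w 0 with rfl | hw0
    · simp only [hψ, hF0, div_zero, sub_zero, abs_zero]; positivity
    have hw1 : w < 1 := (le_abs_self w).trans_lt (hw.trans_lt hρ1)
    have habs : 0 < |w| := abs_pos.2 hw0
    have h1 := hC w (hw.trans hρr)
    have h2 : μ / 2 * |w| ≤ |F w| := by
      have h3 := abs_sub_abs_le_abs_sub (μ * w) (F w)
      rw [abs_sub_comm, abs_mul, abs_of_pos hμ] at h3
      have h4 : C * w ^ 2 ≤ μ / 2 * |w| := by
        rw [← sq_abs, sq, ← mul_assoc]
        exact mul_le_mul_of_nonneg_right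
          ((mul_le_mul_of_nonneg_left hw hC0).trans hρC) habs.le
      linarith
    have e : ψ w = (μ * w - F w) / (F w * w) := by
      simp only [hψ]
      rw [div_sub_div _ _ (hFne w hw1 hw0) hw0, mul_one]
    rw [e, abs_div, abs_mul, abs_sub_comm, div_le_div_iff₀
      (mul_pos (abs_pos.2 (hFne w hw1 hw0)) habs) hμ]
    calc |F w - μ * w| * μ ≤ C * w ^ 2 * μ := mul_le_mul_of_nonneg_right h1 hμ.le
      _ = 2 * C * (μ / 2 * |w| * |w|) := by rw [← sq_abs]; ring
      _ ≤ 2 * C * (|F w| * |w|) := by gcongr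
  have hint : ∀ w < 1, IntervalIntegrable ψ volume 0 w := by
    intro w hw
    set J := uIcc 0 w with hJ
    have hJ1 : J ⊆ Iio 1 := fun s hs => by
      have := (mem_uIcc.1 hs)
      rcases this with ⟨_, h⟩ | ⟨_, h⟩
      · exact h.trans_lt hw
      · exact h.trans_lt one_pos
    have hcomp : IsCompact (J ∩ {s | ρ ≤ |s|}) :=
      isCompact_uIcc.inter_right (isClosed_le continuous_const continuous_abs)
    obtain ⟨D, hD⟩ := hcomp.bddAbove_image (f := fun s => |ψ s|) ((hψc.mono fun s hs =>
      ⟨hJ1 hs.1, fun h0 => by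
        have h2 : ρ ≤ |s| := hs.2
        rw [mem_singleton_iff.1 h0, abs_zero] at h2; linarith⟩).abs)
    have hbound : ∀ s ∈ J, |ψ s| ≤ max D (2 * C / μ) := by
      intro s hs
      rcases le_total ρ |s| with h | h
      · exact (hD ⟨s, ⟨hs, h⟩, rfl⟩).trans (le_max_left _ _)
      · exact (hψb s h).trans (le_max_right _ _)
    have hm : AEStronglyMeasurable ψ (volume.restrict (Iio 1 ∩ {0}ᶜ)) :=
      hψc.aestronglyMeasurable hopen.measurableSet
    have hae : (volume : Measure ℝ).restrict (Iio 1 ∩ {0}ᶜ) = volume.restrict (Iio 1) :=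
      Measure.restrict_congr_set (inter_ae_eq_left_of_ae_eq_univ (by
        rw [ae_eq_univ, compl_compl]; exact measure_singleton _))
    rw [hae] at hm
    rw [intervalIntegrable_iff]
    have hfin : IsFiniteMeasure ((volume : Measure ℝ).restrict (uIoc 0 w)) :=
      ⟨by rw [Measure.restrict_apply_univ, uIoc]; exact measure_Ioc_lt_top⟩
    exact Integrable.of_bound
      (hm.mono_measure (Measure.restrict_mono (uIoc_subset_uIcc.trans hJ1) le_rfl))
      (max D (2 * C / μ))
      ((ae_restrict_mem measurableSet_uIoc).mono fun s hs => hbound s (uIoc_subset_uIcc hs))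
  set I : ℝ → ℝ := fun w => ∫ s in (0 : ℝ)..w, ψ s with hI
  have hId : ∀ w < 1, w ≠ 0 → HasDerivAt I (ψ w) w := by
    intro w hw hw0
    have hmem : w ∈ Iio (1 : ℝ) ∩ {0}ᶜ := ⟨hw, hw0⟩
    exact intervalIntegral.integral_hasDerivAt_right (hint w hw)
      (hψc.stronglyMeasurableAtFilter hopen w hmem) (hψc.continuousAt (hopen.mem_nhds hmem))
  have hI0 : I 0 = 0 := intervalIntegral.integral_same
  have hIc0 : ContinuousAt I 0 := by
    have hb : ∀ w, |w| ≤ ρ → |I w| ≤ 2 * C / μ * |w| := by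
      intro w hw
      have := intervalIntegral.norm_integral_le_of_norm_le_const (a := 0) (b := w) (f := ψ)
        (C := 2 * C / μ) (fun s hs => hψb s (by
          have h1 : |s - 0| ≤ |w - 0| := abs_sub_left_of_mem_uIcc (uIoc_subset_uIcc hs)
          simp only [sub_zero] at h1
          exact h1.trans hw))
      simpa using this
    unfold ContinuousAt
    rw [hI0]
    refine squeeze_zero_norm' (a := fun w => 2 * C / μ * |w|) ?_ ?_
    · filter_upwards [Metric.ball_mem_nhds (0 : ℝ) hρ0] with w hw
      rw [mem_ball_zero_iff] at hw
      exact hb w hw.le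
    · have : Continuous fun w : ℝ => 2 * C / μ * |w| := by fun_prop
      simpa using this.tendsto 0
  have hIc : ∀ w < 1, ContinuousAt I w := fun w hw => by
    rcases eq_or_ne w 0 with rfl | h0
    · exact hIc0
    · exact (hId w hw h0).continuousAt
  -- The continuous extension of `F w / w`; with it `h' = (μ/k) exp I` is visibly continuous and
  -- positive across 0.
  set k : ℝ → ℝ := Function.update (fun w => F w / w) 0 μ with hk
  have hk0 : k 0 = μ := Function.update_self _ _ _
  have hkne : ∀ w, w ≠ 0 → k w = F w / w := fun w hw => Function.update_of_ne hw _ _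
  have hkpos : ∀ w < 1, 0 < k w := by
    intro w hw
    rcases eq_or_ne w 0 with rfl | h0
    · rwa [hk0]
    · rw [hkne w h0]
      have := hsign w hw h0
      rw [show F w / w = (w * F w) / (w * w) by rw [mul_div_mul_left _ _ h0]]
      exact div_pos this (mul_self_pos.2 h0)
  have hkc : ∀ w < 1, ContinuousAt k w := by
    intro w hw
    rcases eq_or_ne w 0 with rfl | h0
    · rw [hk, continuousAt_update_same]
      refine tendsto_iff_norm_sub_tendsto_zero.2 ?_
      refine squeeze_zero' (g := fun w => C * |w|) (Eventually.of_forall fun _ => norm_nonneg _)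
        ?_ ?_
      · have h1 : ∀ᶠ w in 𝓝[≠] (0 : ℝ), |w| < r := by
          refine nhdsWithin_le_nhds ?_
          filter_upwards [Metric.ball_mem_nhds (0 : ℝ) hr] with w hw
          rwa [mem_ball_zero_iff] at hw
        filter_upwards [h1, self_mem_nhdsWithin] with w hw hw0
        have hw0' : w ≠ 0 := hw0
        have h2 := hC w hw.le
        rw [show F w / w - μ = (F w - μ * w) / w by field_simp, norm_div, Real.norm_eq_abs,
          Real.norm_eq_abs, div_le_iff₀ (abs_pos.2 hw0'), mul_assoc, ← sq, sq_abs]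
        exact h2
      · have : Continuous fun w : ℝ => C * |w| := by fun_prop
        have h2 := this.tendsto 0
        simp only [abs_zero, mul_zero] at h2
        exact h2.mono_left nhdsWithin_le_nhds
    · rw [hk, continuousAt_update_of_ne h0]
      exact (hF.continuousAt (Iio_mem_nhds hw)).div continuousAt_id h0
  refine ⟨fun w => w * Real.exp (I w), fun w => μ / k w * Real.exp (I w), ?_, ?_, ?_, ?_, ?_⟩
  · intro w hw
    rcases eq_or_ne w 0 with rfl | h0
    · simp only
      rw [hk0, div_self hμ.ne', one_mul, hasDerivAt_iff_tendsto_slope]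
      have h1 : Tendsto (fun w => Real.exp (I w)) (𝓝[≠] 0) (𝓝 (Real.exp (I 0))) :=
        (Real.continuous_exp.continuousAt.comp hIc0).tendsto.mono_left nhdsWithin_le_nhds
      refine h1.congr' ?_
      filter_upwards [self_mem_nhdsWithin] with w hw0
      have hw0' : w ≠ 0 := hw0
      rw [slope_def_field, zero_mul, sub_zero, sub_zero, mul_div_cancel_left₀ _ hw0']
    · refine ((hasDerivAt_id' w).fun_mul (hId w hw h0).exp).congr_deriv ?_
      have := hFne w hw h0
      simp only
      rw [hkne w h0]
      simp only [hψ]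
      field_simp
      ring
  · intro w hw
    exact ((continuousAt_const.div (hkc w hw) (hkpos w hw).ne').mul
      (Real.continuous_exp.continuousAt.comp (hIc w hw))).continuousWithinAt
  · exact fun w hw => mul_pos (div_pos hμ (hkpos w hw)) (Real.exp_pos _)
  · simp
  · intro w hw
    rcases eq_or_ne w 0 with rfl | h0
    · simp [hF0]
    · have := hFne w hw h0
      simp only
      rw [hkne w h0]
      field_simp

/-! ### Qualitative structure of the front. -/

/-- The mean value theorem on `(n, n+1)` gives points going to infinity where the derivative equals
`M(n+1) - M(n)`, which tends to 0. Applied to the profile, it shows that the endstates are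
equilibria. -/
lemma eq_zero_of_tendsto_deriv {M : ℝ → ℝ} (hM : Differentiable ℝ M) {l d : ℝ}
    (h1 : Tendsto M atTop (𝓝 l)) (h2 : Tendsto (deriv M) atTop (𝓝 d)) : d = 0 := by
  have h3 : ∀ n : ℕ, ∃ c ∈ Ioo (n : ℝ) (n + 1), deriv M c = (M (n + 1) - M n) / (n + 1 - n) :=
    fun n => exists_deriv_eq_slope M (by linarith) hM.continuous.continuousOn hM.differentiableOn
  choose c hc hc' using h3
  have hcl : Tendsto c atTop atTop :=
    tendsto_atTop_mono (fun n => (hc n).1.le) tendsto_natCast_atTop_atTop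
  have e1 : Tendsto (fun n => deriv M (c n)) atTop (𝓝 d) := h2.comp hcl
  have e2 : Tendsto (fun n : ℕ => M ((n : ℝ) + 1) - M n) atTop (𝓝 (l - l)) :=
    (h1.comp (tendsto_atTop_add_const_right _ _ tendsto_natCast_atTop_atTop)).sub
      (h1.comp tendsto_natCast_atTop_atTop)
  rw [sub_self] at e2
  refine tendsto_nhds_unique e1 (e2.congr fun n => ?_)
  rw [hc' n, add_sub_cancel_left, div_one]

lemma exists_bound_of_tendsto {φ : ℝ → ℝ} (hφ : Continuous φ) {l₁ l₂ : ℝ}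
    (h1 : Tendsto φ atBot (𝓝 l₁)) (h2 : Tendsto φ atTop (𝓝 l₂)) : ∃ C, ∀ x, |φ x| ≤ C := by
  have e1 : ∀ᶠ x in atBot, |φ x| < |l₁| + 1 := (h1.abs).eventually (gt_mem_nhds (lt_add_one _))
  have e2 : ∀ᶠ x in atTop, |φ x| < |l₂| + 1 := (h2.abs).eventually (gt_mem_nhds (lt_add_one _))
  obtain ⟨A, hA⟩ := eventually_atBot.1 e1
  obtain ⟨B, hB⟩ := eventually_atTop.1 e2
  obtain ⟨D, hD⟩ := (isCompact_Icc (a := A) (b := B)).bddAbove_image hφ.abs.continuousOn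
  refine ⟨max D (max (|l₁| + 1) (|l₂| + 1)), fun x => ?_⟩
  rcases le_total x A with h | h
  · exact (hA x h).le.trans ((le_max_left _ _).trans (le_max_right _ _))
  rcases le_total B x with h' | h'
  · exact (hB x h').le.trans ((le_max_right _ _).trans (le_max_right _ _))
  · exact (hD ⟨x, ⟨h, h'⟩, rfl⟩).trans (le_max_left _ _)

/-- A profile equation `a(M) M' = b(M)` that does not degenerate has no equilibrium on a front:
forward uniqueness. -/
lemma profile_const_forward {a b M : ℝ → ℝ} (hb : ContDiff ℝ 1 b) (hM : Differentiable ℝ M)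
    (heq : ∀ x, a (M x) * deriv M x = b (M x)) {R S : ℝ} (hMR : ∀ x, |M x| ≤ R)
    (haS : ∀ x, |(a (M x))⁻¹| ≤ S) (hne : ∀ x, a (M x) ≠ 0) {x₀ : ℝ} (h0 : b (M x₀) = 0) :
    ∀ x ≥ x₀, M x = M x₀ := by
  obtain ⟨L, hL0, hL⟩ := exists_lipschitz_Icc hb R
  intro x hx
  -- Gronwall: as `b` vanishes at `M x₀`, the slope `b/a` at `M y` is bounded by a constant times
  -- `|M y - M x₀|`.
  have := eq_zero_of_abs_deriv_le_mul_abs_self_of_eq_zero_right (f := fun x => M x - M x₀)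
    (f' := fun x => deriv M x) (K := S * L) (a := x₀) (b := x)
    (hM.continuous.sub continuous_const).continuousOn
    (fun y _ => ((hM y).hasDerivAt.sub_const _).hasDerivWithinAt) (sub_self _) (fun y _ => ?_)
    x ⟨hx, le_rfl⟩
  · exact sub_eq_zero.1 this
  · have e : deriv M y = (a (M y))⁻¹ * (b (M y) - b (M x₀)) := by
      rw [h0, sub_zero, ← heq y, inv_mul_cancel_left₀ (hne y)]
    rw [Real.norm_eq_abs, Real.norm_eq_abs, e, abs_mul, mul_assoc]
    exact mul_le_mul (haS y) (hL _ _ (hMR y) (hMR x₀)) (abs_nonneg _)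
      ((abs_nonneg _).trans (haS y))

/-- Qualitative properties of a normalised noncharacteristic front. -/
structure IsFront (a b M : ℝ → ℝ) : Prop where
  smooth : ContDiff ℝ 1 M
  eqn : ∀ x, a (M x) * deriv M x = b (M x)
  zero_left : b 0 = 0
  zero_right : b 1 = 0
  pos : ∀ x, 0 < M x
  lt_one : ∀ x, M x < 1
  reaction_neg : ∀ m, 0 < m → m < 1 → b m < 0
  speed_neg : ∀ m, 0 ≤ m → m ≤ 1 → a m < 0
  tendsto_atBot : Tendsto M atBot (𝓝 0)
  tendsto_atTop : Tendsto M atTop (𝓝 1)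

/-- An equilibrium met at a finite point would make the profile constant in both directions, so it
would equal both endstates. Hence `b(M)` never vanishes and, by intermediate values, the profile
fills exactly `(0,1)`. There `b` keeps one sign, read off from `b'(0) < 0`; as `M` increases
somewhere, `a` is negative at one state and, never vanishing, on all of `[0,1]`. -/
lemma isFront_of_profile {a b M : ℝ → ℝ} (ha : Continuous a) (hb : ContDiff ℝ 1 b)
    (hM : ContDiff ℝ 1 M) (heq : ∀ x, a (M x) * deriv M x = b (M x))
    (hbot : Tendsto M atBot (𝓝 0)) (htop : Tendsto M atTop (𝓝 1)) (hne : ∀ x, a (M x) ≠ 0)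
    (h0 : a 0 ≠ 0) (h1 : a 1 ≠ 0) (hb0 : deriv b 0 < 0) : IsFront a b M := by
  have hMd : Differentiable ℝ M := hM.differentiable one_ne_zero
  have hMc := hM.continuous
  have hbc := hb.continuous
  have heq' : ∀ x, deriv M x = b (M x) / a (M x) := fun x => by
    rw [← heq x, mul_div_cancel_left₀ _ (hne x)]
  obtain ⟨R, hR⟩ := exists_bound_of_tendsto hMc hbot htop
  have ht0 : Tendsto (fun x => a (M x)) atBot (𝓝 (a 0)) := (ha.tendsto 0).comp hbot
  have ht1 : Tendsto (fun x => a (M x)) atTop (𝓝 (a 1)) := (ha.tendsto 1).comp htop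
  obtain ⟨S, hS⟩ := exists_bound_of_tendsto (φ := fun x => (a (M x))⁻¹)
    ((ha.comp hMc).inv₀ hne) (ht0.inv₀ h0) (ht1.inv₀ h1)
  -- reflected profile
  set N : ℝ → ℝ := fun x => M (-x) with hN
  have hNd : Differentiable ℝ N := hMd.comp differentiable_neg
  have hNder : ∀ x, deriv N x = - deriv M (-x) := fun x => by
    rw [hN, deriv_comp_neg]
  have hNeq : ∀ x, a (N x) * deriv N x = (fun m => - b m) (N x) := fun x => by
    rw [hNder, mul_neg, heq]
  have hNtop : Tendsto N atTop (𝓝 0) := hbot.comp tendsto_neg_atTop_atBot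
  have zb1 : b 1 = 0 := by
    have h2 : Tendsto (deriv M) atTop (𝓝 (b 1 / a 1)) := by
      refine Tendsto.congr (fun x => (heq' x).symm) ?_
      exact (((hbc.tendsto 1).comp htop)).div ht1 h1
    have := eq_zero_of_tendsto_deriv hMd htop h2
    exact (div_eq_zero_iff.1 this).resolve_right h1
  have zb0 : b 0 = 0 := by
    have h2 : Tendsto (deriv N) atTop (𝓝 (-(b 0 / a 0))) := by
      refine Tendsto.congr (f₁ := fun x => -(b (N x) / a (N x))) (fun x => ?_) ?_
      · rw [hNder, heq']
      · exact (((hbc.tendsto 0).comp hNtop).div ((ha.tendsto 0).comp hNtop) h0).neg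
    have := eq_zero_of_tendsto_deriv hNd hNtop h2
    exact (div_eq_zero_iff.1 (neg_eq_zero.1 this)).resolve_right h0
  have fwd : ∀ x, b (M x) = 0 → M x = 1 := fun x hx => by
    have := profile_const_forward hb hMd heq hR hS hne hx
    exact tendsto_nhds_unique (tendsto_const_nhds.congr' (by
      filter_upwards [eventually_ge_atTop x] with y hy using (this y hy).symm)) htop
  have bwd : ∀ x, b (M x) = 0 → M x = 0 := fun x hx => by
    have hx' : (fun m => - b m) (N (-x)) = 0 := by simp [hN, hx]
    have := profile_const_forward hb.neg hNd hNeq (fun y => hR (-y)) (fun y => hS (-y))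
      (fun y => hne (-y)) hx'
    have e := tendsto_nhds_unique (tendsto_const_nhds.congr' (by
      filter_upwards [eventually_ge_atTop (-x)] with y hy using (this y hy).symm)) hNtop
    simpa [hN] using e
  have hbne : ∀ x, b (M x) ≠ 0 := fun x hx => by
    have e1 := fwd x hx
    have e2 := bwd x hx
    rw [e1] at e2
    exact one_ne_zero e2
  have hMpos : ∀ x, 0 < M x := by
    intro x
    by_contra hcon
    obtain ⟨y, hy⟩ := (htop.eventually (lt_mem_nhds (zero_lt_one))).exists
    obtain ⟨z, hz⟩ := mem_range_of_exists_le_of_exists_ge hMc ⟨x, not_lt.1 hcon⟩ ⟨y, hy.le⟩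
    exact hbne z (by rw [hz, zb0])
  have hMlt : ∀ x, M x < 1 := by
    intro x
    by_contra hcon
    obtain ⟨y, hy⟩ := (hbot.eventually (gt_mem_nhds (zero_lt_one))).exists
    obtain ⟨z, hz⟩ := mem_range_of_exists_le_of_exists_ge hMc ⟨y, hy.le⟩ ⟨x, not_lt.1 hcon⟩
    exact hbne z (by rw [hz, zb1])
  have hsurj : ∀ m, 0 < m → m < 1 → ∃ x, M x = m := by
    intro m hm0 hm1
    obtain ⟨y, hy⟩ := (hbot.eventually (gt_mem_nhds hm0)).exists
    obtain ⟨z, hz⟩ := (htop.eventually (lt_mem_nhds hm1)).exists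
    exact mem_range_of_exists_le_of_exists_ge hMc ⟨y, hy.le⟩ ⟨z, hz.le⟩
  have hbne' : ∀ m, 0 < m → m < 1 → b m ≠ 0 := fun m hm0 hm1 => by
    obtain ⟨x, rfl⟩ := hsurj m hm0 hm1
    exact hbne x
  have hane' : ∀ m, 0 ≤ m → m ≤ 1 → a m ≠ 0 := fun m hm0 hm1 => by
    rcases hm0.eq_or_lt with rfl | hm0
    · exact h0
    rcases hm1.eq_or_lt with rfl | hm1
    · exact h1
    obtain ⟨x, rfl⟩ := hsurj m hm0 hm1
    exact hne x
  -- sign of the reaction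
  obtain ⟨m₁, hm₁0, hm₁1, hbm₁⟩ : ∃ m, 0 < m ∧ m < 1 ∧ b m < 0 := by
    have hder := (hb.differentiable one_ne_zero 0).hasDerivAt
    have hs := (hasDerivAt_iff_tendsto_slope.1 hder).eventually (gt_mem_nhds hb0)
    have hs' : ∀ᶠ m in 𝓝[>] (0 : ℝ), slope b 0 m < 0 :=
      hs.filter_mono (nhdsWithin_mono _ fun m hm => ne_of_gt hm)
    have hI : ∀ᶠ m in 𝓝[>] (0 : ℝ), m < 1 := nhdsWithin_le_nhds (gt_mem_nhds one_pos)
    obtain ⟨m, hm, hm1, hm0⟩ := (hs'.and (hI.and self_mem_nhdsWithin)).exists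
    refine ⟨m, hm0, hm1, ?_⟩
    rw [slope_def_field, zb0, sub_zero, sub_zero] at hm
    have hm0' : (0 : ℝ) < m := hm0
    by_contra hcon
    exact absurd hm (not_lt.2 (div_nonneg (not_lt.1 hcon) hm0'.le))
  have hbneg : ∀ m, 0 < m → m < 1 → b m < 0 := by
    intro m hm0 hm1
    by_contra hcon
    have hz : (0 : ℝ) ∈ b '' uIcc m₁ m :=
      intermediate_value_uIcc hbc.continuousOn (by
        rw [mem_uIcc]; exact Or.inl ⟨hbm₁.le, not_lt.1 hcon⟩)
    obtain ⟨c, hc, hc0⟩ := hz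
    have hcI : c ∈ Ioo (0 : ℝ) 1 := ordConnected_Ioo.uIcc_subset ⟨hm₁0, hm₁1⟩ ⟨hm0, hm1⟩ hc
    exact hbne' c hcI.1 hcI.2 hc0
  -- sign of the speed
  obtain ⟨x₁, hx₁⟩ : ∃ x, 0 < deriv M x := by
    by_contra hcon
    push Not at hcon
    have hanti : Antitone M := antitone_of_deriv_nonpos hMd hcon
    have h2 := hanti.le_of_tendsto htop 0
    linarith [hMlt 0]
  have hax₁ : a (M x₁) < 0 := by
    have h2 := heq x₁
    have h3 := hbneg _ (hMpos x₁) (hMlt x₁)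
    by_contra hcon
    have := mul_nonneg (not_lt.1 hcon) hx₁.le
    linarith
  have haneg : ∀ m, 0 ≤ m → m ≤ 1 → a m < 0 := by
    intro m hm0 hm1
    by_contra hcon
    have hz : (0 : ℝ) ∈ a '' uIcc (M x₁) m :=
      intermediate_value_uIcc ha.continuousOn (by
        rw [mem_uIcc]; exact Or.inl ⟨hax₁.le, not_lt.1 hcon⟩)
    obtain ⟨c, hc, hc0⟩ := hz
    have hcI : c ∈ Icc (0 : ℝ) 1 :=
      ordConnected_Icc.uIcc_subset ⟨(hMpos x₁).le, (hMlt x₁).le⟩ ⟨hm0, hm1⟩ hc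
    exact hane' c hcI.1 hcI.2 hc0
  exact ⟨hM, heq, zb0, zb1, hMpos, hMlt, hbneg, haneg, hbot, htop⟩

/-! ### The front chart and the decay rate of the profile. -/

/-- A global coordinate `h` on states (with inverse `G`) in which the profile equation is linear,
together with the precise decay rate of the profile at `+∞`. -/
structure IsFrontChart (a b M : ℝ → ℝ) (μ κ η : ℝ) (G G' h h' : ℝ → ℝ) : Prop where
  front : IsFront a b M
  mu_pos : 0 < μ
  kappa_pos : 0 < κ
  eta_pos : 0 < η
  speed_neg : ∀ m, -η ≤ m → m ≤ 1 → a m < 0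
  hasDerivAt_h : ∀ m < 1, HasDerivAt h (h' m) m
  continuousOn_h' : ContinuousOn h' (Iio 1)
  h'_pos : ∀ m < 1, 0 < h' m
  h_zero : h 0 = 0
  linear : ∀ m, -η ≤ m → m < 1 → h' m * b m = μ * h m * a m
  hasDerivAt_G : ∀ z, HasDerivAt G (G' z) z
  continuous_G' : Continuous G'
  G'_pos : ∀ z, 0 < G' z
  G_lt_one : ∀ z, G z < 1
  h_G : ∀ z, h (G z) = z
  G_h : ∀ m < 1, G (h m) = m
  h_profile : ∀ x, h (M x) = Real.exp (μ * x)
  decay : ∀ s : ℝ, ∃ c C : ℝ, 0 < c ∧ 0 < C ∧ ∀ x, s ≤ x →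
    c * Real.exp (-κ * x) ≤ deriv M x ∧ deriv M x ≤ C * Real.exp (-κ * x)

lemma eq_exp_of_hasDerivAt {k : ℝ → ℝ} {c : ℝ} (h : ∀ x, HasDerivAt k (c * k x) x) (x : ℝ) :
    k x = k 0 * Real.exp (c * x) := by
  have h1 : ∀ x, HasDerivAt (fun x => k x * Real.exp (-c * x)) 0 x := fun x => by
    have h2 : HasDerivAt (fun x => Real.exp (-c * x)) (Real.exp (-c * x) * (-c)) x := by
      simpa using ((hasDerivAt_id x).const_mul (-c)).exp
    refine ((h x).fun_mul h2).congr_deriv ?_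
    ring
  have h3 := is_const_of_deriv_eq_zero (fun x => (h1 x).differentiableAt)
    (fun x => (h1 x).deriv) x 0
  simp only [mul_zero, Real.exp_zero, mul_one] at h3
  rw [← h3, mul_assoc, ← Real.exp_add]
  simp

lemma IsFront.deriv_eq {a b M : ℝ → ℝ} (hf : IsFront a b M) (x : ℝ) :
    deriv M x = b (M x) / a (M x) := by
  rw [← hf.eqn x, mul_div_cancel_left₀ _ (hf.speed_neg _ (hf.pos x).le (hf.lt_one x).le).ne]

lemma IsFront.deriv_pos {a b M : ℝ → ℝ} (hf : IsFront a b M) (x : ℝ) : 0 < deriv M x := by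
  rw [hf.deriv_eq]
  exact div_pos_of_neg_of_neg (hf.reaction_neg _ (hf.pos x) (hf.lt_one x))
    (hf.speed_neg _ (hf.pos x).le (hf.lt_one x).le)

lemma IsFront.hasDerivAt {a b M : ℝ → ℝ} (hf : IsFront a b M) (x : ℝ) :
    HasDerivAt M (deriv M x) x := (hf.smooth.differentiable one_ne_zero x).hasDerivAt

lemma IsFront.strictMono {a b M : ℝ → ℝ} (hf : IsFront a b M) : StrictMono M :=
  strictMono_of_deriv_pos hf.deriv_pos

lemma exists_quadratic_bound {Q : ℝ → ℝ} (hQ : ContDiff ℝ 2 Q) (h0 : Q 0 = 0)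
    (h1 : deriv Q 0 = 0) : ∃ C, 0 ≤ C ∧ ∀ w, |w| ≤ 1 → |Q w| ≤ C * w ^ 2 := by
  obtain ⟨C, hC0, hC⟩ := exists_taylor_Icc hQ 1
  refine ⟨C, hC0, fun w hw => ?_⟩
  simpa [h0, h1] using hC w 0 hw (by simp)

/-- Near the right state `w = 1 - M` solves `w' = -F(w)` with `F'(0) = -b'(1)/a(1) = κ`. In the
linearising coordinate of `F` it is an exact multiple of `e^{-κx}`, and the derivative of that
coordinate is bounded above and below on the compact range of `1 - M` over `[s, ∞)`. -/
lemma IsFront.exists_decay {a b M : ℝ → ℝ} (hf : IsFront a b M) (ha : ContDiff ℝ 2 a)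
    (hb : ContDiff ℝ 2 b) {κ : ℝ} (hκ : 0 < κ) (hκe : deriv b 1 = -(κ * a 1)) (s : ℝ) :
    ∃ c C : ℝ, 0 < c ∧ 0 < C ∧ ∀ x, s ≤ x →
      c * Real.exp (-κ * x) ≤ deriv M x ∧ deriv M x ≤ C * Real.exp (-κ * x) := by
  -- For `w < 0`, beyond the range of the front, the field is continued by its linear part `κw`,
  -- since nothing is known there about the signs of `a` and `b`.
  set F : ℝ → ℝ := fun w => b (1 - max w 0) / a (1 - max w 0) + κ * min w 0 with hF
  have hacont := ha.continuous
  have hbcont := hb.continuous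
  have hrange : ∀ w : ℝ, w < 1 → 0 < 1 - max w 0 ∧ 1 - max w 0 ≤ 1 := fun w hw =>
    ⟨by linarith [max_lt hw one_pos], by linarith [le_max_right w 0]⟩
  have hane : ∀ w < 1, a (1 - max w 0) ≠ 0 := fun w hw =>
    (hf.speed_neg _ (hrange w hw).1.le (hrange w hw).2).ne
  have hFc : ContinuousOn F (Iio 1) := by
    refine ContinuousOn.add (ContinuousOn.div ?_ ?_ hane) ?_
    · exact Continuous.continuousOn (by fun_prop)
    · exact Continuous.continuousOn (by fun_prop)
    · exact Continuous.continuousOn (by fun_prop)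
  have hFpos : ∀ w, 0 ≤ w → F w = b (1 - w) / a (1 - w) := fun w hw => by
    simp only [hF, max_eq_left hw, min_eq_right hw, mul_zero, add_zero]
  have hFneg : ∀ w, w ≤ 0 → F w = κ * w := fun w hw => by
    simp only [hF, max_eq_right hw, min_eq_left hw, sub_zero, hf.zero_right, zero_div, zero_add]
  have hF0 : F 0 = 0 := by rw [hFneg 0 le_rfl, mul_zero]
  have hsign : ∀ w < 1, w ≠ 0 → 0 < w * F w := by
    intro w hw hw0
    rcases lt_or_gt_of_ne hw0 with h | h
    · rw [hFneg w h.le, mul_left_comm]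
      exact mul_pos hκ (mul_pos_of_neg_of_neg h h)
    · rw [hFpos w h.le]
      exact mul_pos h (div_pos_of_neg_of_neg (hf.reaction_neg _ (by linarith) (by linarith))
        (hf.speed_neg _ (by linarith) (by linarith)))
  obtain ⟨C, hC0, hC⟩ : ∃ C, 0 ≤ C ∧ ∀ w, |w| ≤ 1 →
      |b (1 - w) - κ * w * a (1 - w)| ≤ C * w ^ 2 := by
    refine exists_quadratic_bound (Q := fun w => b (1 - w) - κ * w * a (1 - w)) ?_ ?_ ?_
    · exact (hb.comp (contDiff_const.sub contDiff_id)).sub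
        ((contDiff_const.mul contDiff_id).mul (ha.comp (contDiff_const.sub contDiff_id)))
    · simp [hf.zero_right]
    · have d1 : HasDerivAt (fun w : ℝ => 1 - w) (-1) 0 := (hasDerivAt_id' 0).const_sub 1
      have d2 : HasDerivAt b (deriv b 1) ((fun w : ℝ => 1 - w) 0) := by
        simpa using (hb.differentiable two_ne_zero 1).hasDerivAt
      have d3 : HasDerivAt a (deriv a 1) ((fun w : ℝ => 1 - w) 0) := by
        simpa using (ha.differentiable two_ne_zero 1).hasDerivAt
      have d4 := (d2.comp 0 d1).sub ((((hasDerivAt_id' (0 : ℝ)).const_mul κ)).mul (d3.comp 0 d1))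
      refine d4.deriv.trans ?_
      simp [hκe]
  obtain ⟨A, hA⟩ := (isCompact_Icc (a := (0 : ℝ)) (b := 1)).bddAbove_image
    (f := fun w => |(a w)⁻¹|)
    (hacont.continuousOn.inv₀ fun w hw => (hf.speed_neg w hw.1 hw.2).ne).abs
  have hA' : ∀ w, 0 ≤ w → w ≤ 1 → |(a w)⁻¹| ≤ A := fun w h1 h2 => hA ⟨w, ⟨h1, h2⟩, rfl⟩
  have hA0 : 0 ≤ A := (abs_nonneg _).trans (hA' 0 le_rfl zero_le_one)
  obtain ⟨h, h', hd, hc', hpos', h0, hlin⟩ := exists_linearizing_coordinate (C := A * C)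
    (r := 1 / 2) hκ (by norm_num) hFc hF0 hsign (fun w hw => by
      rcases le_total w 0 with hw0 | hw0
      · rw [hFneg w hw0, sub_self, abs_zero]; positivity
      · have hw1 : w ≤ 1 / 2 := (le_abs_self w).trans hw
        have hne := (hf.speed_neg (1 - w) (by linarith) (by linarith)).ne
        have e : F w - κ * w = (a (1 - w))⁻¹ * (b (1 - w) - κ * w * a (1 - w)) := by
          rw [hFpos w hw0]; field_simp
        rw [e, abs_mul, mul_assoc A]
        exact mul_le_mul (hA' _ (by linarith) (by linarith)) (hC w (by linarith)) (abs_nonneg _)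
          hA0)
  have hlt : ∀ x, 1 - M x < 1 := fun x => by linarith [hf.pos x]
  have hFM : ∀ x, F (1 - M x) = deriv M x := fun x => by
    rw [hFpos _ (by linarith [hf.lt_one x]), sub_sub_cancel, hf.deriv_eq]
  have hk : ∀ x, HasDerivAt (fun x => h (1 - M x)) (-κ * h (1 - M x)) x := fun x => by
    refine ((hd _ (hlt x)).comp x ((hf.hasDerivAt x).const_sub 1)).congr_deriv ?_
    rw [mul_neg, ← hFM x, hlin _ (hlt x), neg_mul]
  have hkx : ∀ x, h (1 - M x) = h (1 - M 0) * Real.exp (-κ * x) :=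
    eq_exp_of_hasDerivAt (k := fun x => h (1 - M x)) hk
  have hM' : ∀ x, deriv M x = κ * h (1 - M 0) * Real.exp (-κ * x) / h' (1 - M x) := fun x => by
    rw [mul_assoc, ← hkx x, ← hlin _ (hlt x), hFM, mul_div_cancel_left₀ _ (hpos' _ (hlt x)).ne']
  have hc1 : 0 < h (1 - M 0) := by
    have h1 := hM' 0
    have h2 := hf.deriv_pos 0
    rw [h1, mul_zero, Real.exp_zero, mul_one] at h2
    have h3 := (div_pos_iff_of_pos_right (hpos' _ (hlt 0))).1 h2
    exact (mul_pos_iff_of_pos_left hκ).1 h3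
  have hsub : Icc 0 (1 - M s) ⊆ Iio 1 := fun w hw => hw.2.trans_lt (hlt s)
  obtain ⟨D, hD⟩ := (isCompact_Icc (a := (0 : ℝ)) (b := 1 - M s)).bddAbove_image
    (f := h') (hc'.mono hsub)
  obtain ⟨E, hE⟩ := (isCompact_Icc (a := (0 : ℝ)) (b := 1 - M s)).bddAbove_image
    (f := fun w => (h' w)⁻¹) ((hc'.mono hsub).inv₀ fun w hw => (hpos' w (hsub hw)).ne')
  have hmem : ∀ x, s ≤ x → 1 - M x ∈ Icc 0 (1 - M s) := fun x hx =>
    ⟨by linarith [hf.lt_one x], by linarith [hf.strictMono.monotone hx]⟩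
  have hDx : ∀ x, s ≤ x → h' (1 - M x) ≤ D := fun x hx => hD ⟨_, hmem x hx, rfl⟩
  have hEx : ∀ x, s ≤ x → (h' (1 - M x))⁻¹ ≤ E := fun x hx => hE ⟨_, hmem x hx, rfl⟩
  have hD0 : 0 < D := (hpos' _ (hlt s)).trans_le (hDx s le_rfl)
  have hE0 : 0 < E := (inv_pos.2 (hpos' _ (hlt s))).trans_le (hEx s le_rfl)
  refine ⟨κ * h (1 - M 0) / D, κ * h (1 - M 0) * E, by positivity, by positivity, fun x hx => ?_⟩
  have hp := hpos' _ (hlt x)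
  have hnum : 0 ≤ κ * h (1 - M 0) * Real.exp (-κ * x) := by positivity
  rw [hM' x]
  constructor
  · rw [div_mul_eq_mul_div]
    exact div_le_div_of_nonneg_left hnum hp (hDx x hx)
  · rw [div_eq_mul_inv]
    calc _ ≤ κ * h (1 - M 0) * Real.exp (-κ * x) * E :=
          mul_le_mul_of_nonneg_left (hEx x hx) hnum
      _ = _ := by ring

/-- The chart linearises `b/a` at the left state and reaches slightly below 0, because perturbed
states may leave `(0,1)` on that side. The state 1 is sent to `+∞`. -/
lemma IsFront.exists_chart {a b M : ℝ → ℝ} (hf : IsFront a b M) (ha : ContDiff ℝ 2 a)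
    (hb : ContDiff ℝ 2 b) (hb0 : deriv b 0 < 0) (hb1 : 0 < deriv b 1) :
    ∃ (η : ℝ) (G G' h h' : ℝ → ℝ),
      IsFrontChart a b M (deriv b 0 / a 0) (deriv b 1 / |a 1|) η G G' h h' := by
  have hacont := ha.continuous
  have hbcont := hb.continuous
  have ha0 : a 0 < 0 := hf.speed_neg 0 le_rfl zero_le_one
  have ha1 : a 1 < 0 := hf.speed_neg 1 zero_le_one le_rfl
  set μ := deriv b 0 / a 0 with hμdef
  have hμ : 0 < μ := div_pos_of_neg_of_neg hb0 ha0
  have hκ : 0 < deriv b 1 / |a 1| := div_pos hb1 (abs_pos.2 ha1.ne)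
  -- a small interval to the left of the left state
  obtain ⟨η, hη0, hη1, haη, hbη⟩ : ∃ η : ℝ, 0 < η ∧ η ≤ 1 / 2 ∧ (∀ m, -η ≤ m → m ≤ 1 → a m < 0) ∧
      ∀ m, -η ≤ m → m < 0 → 0 < b m := by
    have e1 : ∀ᶠ m in 𝓝 (0 : ℝ), a m < 0 := (hacont.tendsto 0).eventually (gt_mem_nhds ha0)
    have hder := (hb.differentiable two_ne_zero 0).hasDerivAt
    have e2 := (hasDerivAt_iff_tendsto_slope.1 hder).eventually (gt_mem_nhds hb0)
    rw [eventually_nhdsWithin_iff] at e2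
    obtain ⟨ε, hε, H⟩ := Metric.eventually_nhds_iff.1 (e1.and e2)
    refine ⟨min (ε / 2) (1 / 2), by positivity, min_le_right _ _, fun m h1 h2 => ?_,
      fun m h1 h2 => ?_⟩
    · rcases le_total 0 m with h | h
      · exact hf.speed_neg m h h2
      · refine (H ?_).1
        rw [dist_zero_right, Real.norm_eq_abs, abs_of_nonpos h]
        linarith [min_le_left (ε / 2) (1 / 2)]
    · have h3 := (H (y := m) (by
        rw [dist_zero_right, Real.norm_eq_abs, abs_of_neg h2]
        linarith [min_le_left (ε / 2) (1 / 2)])).2 h2.ne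
      rw [slope_def_field, hf.zero_left, sub_zero, sub_zero] at h3
      by_contra hcon
      exact absurd h3 (not_lt.2 (div_nonneg_of_nonpos (not_lt.1 hcon) h2.le))
  -- The field is frozen below `-η`: it stays negative there, and the chart becomes defined on the
  -- whole half-line `w < 1`. The linearised equation is claimed for `b/a` only above `-η`.
  set F : ℝ → ℝ := fun w => b (max w (-η)) / a (max w (-η)) with hF
  have hrange : ∀ w : ℝ, w < 1 → -η ≤ max w (-η) ∧ max w (-η) < 1 := fun w hw =>
    ⟨le_max_right _ _, max_lt hw (by linarith)⟩
  have hFc : ContinuousOn F (Iio 1) := by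
    refine ContinuousOn.div ?_ ?_ fun w hw => (haη _ (hrange w hw).1 (hrange w hw).2.le).ne
    · exact Continuous.continuousOn (by fun_prop)
    · exact Continuous.continuousOn (by fun_prop)
  have hFr : ∀ w, -η ≤ w → F w = b w / a w := fun w hw => by simp only [hF, max_eq_left hw]
  have hF0 : F 0 = 0 := by rw [hFr 0 (by linarith), hf.zero_left, zero_div]
  have hFneg : ∀ w < 0, F w < 0 := by
    intro w hw
    have h1 : max w (-η) < 0 := max_lt hw (by linarith)
    exact div_neg_of_pos_of_neg (hbη _ (le_max_right _ _) h1)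
      (haη _ (le_max_right _ _) (by linarith))
  have hsign : ∀ w < 1, w ≠ 0 → 0 < w * F w := by
    intro w hw hw0
    rcases lt_or_gt_of_ne hw0 with h | h
    · exact mul_pos_of_neg_of_neg h (hFneg w h)
    · rw [hFr w (by linarith)]
      exact mul_pos h (div_pos_of_neg_of_neg (hf.reaction_neg _ h hw) (hf.speed_neg _ h.le hw.le))
  obtain ⟨C, hC0, hC⟩ : ∃ C, 0 ≤ C ∧ ∀ w, |w| ≤ 1 → |b w - μ * w * a w| ≤ C * w ^ 2 := by
    refine exists_quadratic_bound (Q := fun w => b w - μ * w * a w) ?_ ?_ ?_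
    · exact hb.sub ((contDiff_const.mul contDiff_id).mul ha)
    · simp [hf.zero_left]
    · have d2 := (hb.differentiable two_ne_zero 0).hasDerivAt
      have d3 := (ha.differentiable two_ne_zero 0).hasDerivAt
      have d4 := d2.sub ((((hasDerivAt_id' (0 : ℝ)).const_mul μ)).mul d3)
      refine d4.deriv.trans ?_
      rw [mul_one, mul_zero, zero_mul, add_zero, hμdef, div_mul_cancel₀ _ ha0.ne, sub_self]
  obtain ⟨A, hA⟩ := (isCompact_Icc (a := -η) (b := 1)).bddAbove_image (f := fun w => |(a w)⁻¹|)
    (hacont.continuousOn.inv₀ fun w hw => (haη w hw.1 hw.2).ne).abs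
  have hA' : ∀ w, -η ≤ w → w ≤ 1 → |(a w)⁻¹| ≤ A := fun w h1 h2 => hA ⟨w, ⟨h1, h2⟩, rfl⟩
  have hA0 : 0 ≤ A := (abs_nonneg _).trans (hA' 0 (by linarith) zero_le_one)
  obtain ⟨h₀, h₀', hd₀, hc₀, hpos₀, hz₀, hlin₀⟩ := exists_linearizing_coordinate (C := A * C)
    (r := η) hμ hη0 hFc hF0 hsign (fun w hw => by
      have hw1 := abs_le.1 hw
      have hne := (haη w hw1.1 (by linarith)).ne
      have e : F w - μ * w = (a w)⁻¹ * (b w - μ * w * a w) := by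
        rw [hFr w hw1.1]; field_simp
      rw [e, abs_mul, mul_assoc A]
      exact mul_le_mul (hA' _ hw1.1 (by linarith)) (hC w (by linarith)) (abs_nonneg _) hA0)
  have hmono₀ : StrictMonoOn h₀ (Iio 1) :=
    strictMonoOn_of_deriv_pos (convex_Iio 1)
      (fun w hw => (hd₀ w hw).continuousAt.continuousWithinAt) fun w hw => by
        rw [interior_Iio] at hw
        rw [(hd₀ w hw).deriv]; exact hpos₀ w hw
  -- normalisation
  set c := h₀ (M 0) with hc
  have hcpos : 0 < c := by
    rw [← hz₀]; exact hmono₀ (by simp) (hf.lt_one 0) (hf.pos 0)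
  set h : ℝ → ℝ := fun w => h₀ w / c with hh
  set h' : ℝ → ℝ := fun w => h₀' w / c with hh'
  have hd : ∀ m < 1, HasDerivAt h (h' m) m := fun m hm => (hd₀ m hm).div_const c
  have hcont : ContinuousOn h (Iio 1) := fun m hm => (hd m hm).continuousAt.continuousWithinAt
  have hc' : ContinuousOn h' (Iio 1) := hc₀.div_const c
  have hpos : ∀ m < 1, 0 < h' m := fun m hm => div_pos (hpos₀ m hm) hcpos
  have hz : h 0 = 0 := by simp [hh, hz₀]
  have hlinF : ∀ m < 1, h' m * F m = μ * h m := fun m hm => by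
    simp only [hh, hh']
    rw [div_mul_eq_mul_div, hlin₀ m hm, mul_div_assoc]
  have hlin : ∀ m, -η ≤ m → m < 1 → h' m * b m = μ * h m * a m := fun m h1 h2 => by
    rw [← hlinF m h2, hFr m h1, mul_assoc, div_mul_cancel₀ _ (haη m h1 h2.le).ne]
  have hmono : StrictMonoOn h (Iio 1) := fun x hx y hy hxy =>
    div_lt_div_of_pos_right (hmono₀ hx hy hxy) hcpos
  have hprof : ∀ x, h (M x) = Real.exp (μ * x) := by
    have hk : ∀ x, HasDerivAt (fun x => h (M x)) (μ * h (M x)) x := fun x => by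
      refine ((hd _ (hf.lt_one x)).comp x (hf.hasDerivAt x)).congr_deriv ?_
      rw [← hlinF _ (hf.lt_one x), hFr _ (by linarith [hf.pos x]), hf.deriv_eq]
    intro x
    rw [eq_exp_of_hasDerivAt (k := fun x => h (M x)) hk x]
    simp only [hh]
    rw [← hc, div_self hcpos.ne', one_mul]
  -- surjectivity
  have hηlt : -η < (1 : ℝ) := by linarith
  have hhη : h (-η) < 0 := by
    rw [← hz]; exact hmono hηlt (by simp) (by linarith)
  have hFη : F (-η) < 0 := hFneg _ (by linarith)
  -- Below `-η`, `F` is constant and `h ≤ h(-η) < 0`, so `h' = μh/F ≥ k > 0` and `h` tends to `-∞`.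
  -- Positive values are attained along the profile.
  set k := μ * h (-η) / F (-η) with hk
  have hkpos : 0 < k := div_pos_of_neg_of_neg (mul_neg_of_pos_of_neg hμ hhη) hFη
  have hleft : ∀ w ≤ -η, h w ≤ h (-η) - k * (-η - w) := by
    intro w hw
    have := (convex_Icc w (-η)).mul_sub_le_image_sub_of_le_deriv (f := h) (C := k)
      (fun x hx => (hd x (hx.2.trans_lt hηlt)).continuousAt.continuousWithinAt)
      (fun x hx => by
        rw [interior_Icc] at hx
        exact (hd x (hx.2.trans hηlt)).differentiableAt.differentiableWithinAt)
      (fun x hx => by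
        rw [interior_Icc] at hx
        have hx1 := hx.2.trans hηlt
        rw [(hd x hx1).deriv]
        have e : F x = F (-η) := by simp only [hF, max_eq_right hx.2.le, max_self]
        have h2 := hlinF x hx1
        rw [e] at h2
        rw [hk, div_le_iff_of_neg hFη, h2]
        exact mul_le_mul_of_nonneg_left (hmono hx1 hηlt hx.2).le hμ.le)
      w ⟨le_rfl, hw⟩ (-η) ⟨hw, le_rfl⟩ hw
    linarith
  have hsurj : ∀ z, ∃ m < 1, h m = z := by
    intro z
    rcases lt_or_ge 0 z with hz0 | hz0
    · refine ⟨M (Real.log z / μ), hf.lt_one _, ?_⟩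
      rw [hprof, mul_div_cancel₀ _ hμ.ne', Real.exp_log hz0]
    · set w := -η - (|z| + |h (-η)|) / k with hw
      have hwη : w ≤ -η := by
        have : 0 ≤ (|z| + |h (-η)|) / k := by positivity
        linarith
      have h1 := hleft w hwη
      have h2 : k * (-η - w) = |z| + |h (-η)| := by
        rw [hw]; field_simp; ring
      have h3 : h w ≤ z := by linarith [neg_abs_le z, le_abs_self (h (-η))]
      have hsub : Icc w 0 ⊆ Iio 1 := fun x hx => hx.2.trans_lt one_pos
      obtain ⟨m, hm, hmz⟩ := intermediate_value_Icc (by linarith : w ≤ 0) (hcont.mono hsub)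
        ⟨h3, by rw [hz]; exact hz0⟩
      exact ⟨m, hsub hm, hmz⟩
  choose G hG1 hG2 using hsurj
  have hGh : ∀ m < 1, G (h m) = m := fun m hm => hmono.injOn (hG1 _) hm (hG2 _)
  have hGmono : StrictMono G := fun x y hxy => by
    by_contra hcon
    have := hmono.monotoneOn (hG1 y) (hG1 x) (not_lt.1 hcon)
    rw [hG2, hG2] at this
    exact absurd hxy (not_lt.2 this)
  have hGrange : G '' univ = Iio 1 := by
    ext m
    simp only [image_univ, mem_range, mem_Iio]
    exact ⟨fun ⟨z, hz⟩ => hz ▸ hG1 z, fun hm => ⟨h m, hGh m hm⟩⟩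
  have hGcont : ∀ z, ContinuousAt G z := fun z =>
    continuousAt_of_monotoneOn_of_image_mem_nhds (hGmono.monotone.monotoneOn _) univ_mem (by
      rw [hGrange]; exact Iio_mem_nhds (hG1 z))
  refine ⟨η, G, fun z => (h' (G z))⁻¹, h, h', hf, hμ, hκ, hη0, haη, hd, hc', hpos, hz, hlin,
    ?_, ?_, ?_, hG1, hG2, hGh, hprof, ?_⟩
  · intro z
    exact HasDerivAt.of_local_left_inverse (hGcont z) (hd _ (hG1 z)) (hpos _ (hG1 z)).ne'
      (Eventually.of_forall hG2)
  · refine Continuous.inv₀ ?_ fun z => (hpos _ (hG1 z)).ne'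
    exact continuous_iff_continuousAt.2 fun z =>
      ContinuousAt.comp (hc'.continuousAt (Iio_mem_nhds (hG1 z))) (hGcont z)
  · exact fun z => inv_pos.2 (hpos _ (hG1 z))
  · refine hf.exists_decay ha hb hκ ?_
    rw [abs_of_neg ha1, div_mul_eq_mul_div, div_neg, neg_neg, mul_div_cancel_right₀ _ ha1.ne]

namespace IsFrontChart

variable {a b M : ℝ → ℝ} {μ κ η : ℝ} {G G' h h' : ℝ → ℝ}

lemma eta_lt (H : IsFrontChart a b M μ κ η G G' h h') : -η < 1 := by linarith [H.eta_pos]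

lemma strictMonoOn_h (H : IsFrontChart a b M μ κ η G G' h h') : StrictMonoOn h (Iio 1) :=
  strictMonoOn_of_deriv_pos (convex_Iio 1)
    (fun w hw => (H.hasDerivAt_h w hw).continuousAt.continuousWithinAt) fun w hw => by
      rw [interior_Iio] at hw
      rw [(H.hasDerivAt_h w hw).deriv]; exact H.h'_pos w hw

lemma le_G_iff (H : IsFrontChart a b M μ κ η G G' h h') {m z : ℝ} (hm : m < 1) :
    m ≤ G z ↔ h m ≤ z := by
  rw [← H.strictMonoOn_h.le_iff_le hm (H.G_lt_one z), H.h_G]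

lemma continuous_G (H : IsFrontChart a b M μ κ η G G' h h') : Continuous G :=
  continuous_iff_continuousAt.2 fun z => (H.hasDerivAt_G z).continuousAt

lemma contDiff_G (H : IsFrontChart a b M μ κ η G G' h h') : ContDiff ℝ 1 G :=
  contDiff_one_iff_deriv.2 ⟨fun z => (H.hasDerivAt_G z).differentiableAt, by
    rw [show deriv G = G' from funext fun z => (H.hasDerivAt_G z).deriv]
    exact H.continuous_G'⟩

lemma h'_mul_G' (H : IsFrontChart a b M μ κ η G G' h h') (z : ℝ) : h' (G z) * G' z = 1 := by
  have h1 := (H.hasDerivAt_h _ (H.G_lt_one z)).comp z (H.hasDerivAt_G z)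
  have h2 : h ∘ G = id := funext H.h_G
  rw [h2] at h1
  exact h1.unique (hasDerivAt_id z)

lemma G_exp (H : IsFrontChart a b M μ κ η G G' h h') (x : ℝ) : G (Real.exp (μ * x)) = M x := by
  rw [← H.h_profile, H.G_h _ (H.front.lt_one x)]

/-- The equation satisfied by the inverse chart. -/
lemma reaction_eq (H : IsFrontChart a b M μ κ η G G' h h') {z : ℝ} (hz : h (-η) ≤ z) :
    b (G z) = a (G z) * (μ * z * G' z) := by
  have h1 := H.linear (G z) ((H.le_G_iff H.eta_lt).2 hz) (H.G_lt_one z)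
  rw [H.h_G] at h1
  have h2 := H.h'_mul_G' z
  calc b (G z) = (h' (G z) * G' z) * b (G z) := by rw [h2, one_mul]
    _ = G' z * (h' (G z) * b (G z)) := by ring
    _ = _ := by rw [h1]; ring

lemma deriv_profile (H : IsFrontChart a b M μ κ η G G' h h') (x : ℝ) :
    deriv M x = G' (Real.exp (μ * x)) * (μ * Real.exp (μ * x)) := by
  have h1 : HasDerivAt (fun x => Real.exp (μ * x)) (Real.exp (μ * x) * μ) x := by
    simpa using ((hasDerivAt_id x).const_mul μ).exp
  have h2 := (H.hasDerivAt_G (Real.exp (μ * x))).comp x h1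
  have h3 : (G ∘ fun x => Real.exp (μ * x)) = M := funext H.G_exp
  rw [h3] at h2
  rw [h2.deriv]; ring

end IsFrontChart

/-! ### Weighted estimates between states and the first integral. -/

/-- The weight `exp (-κ x₊ - μ x₋)` comparable to the derivative of the profile. -/
noncomputable def tailWeight (κ μ x : ℝ) : ℝ := Real.exp (-κ * max x 0 - μ * max (-x) 0)

lemma tailWeight_pos (κ μ x : ℝ) : 0 < tailWeight κ μ x := Real.exp_pos _

lemma tailWeight_shift {κ μ : ℝ} (hκ : 0 ≤ κ) (hμ : 0 ≤ μ) {x s : ℝ} (h : |s - x| ≤ 1) :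
    tailWeight κ μ s ≤ Real.exp (κ + μ) * tailWeight κ μ x := by
  unfold tailWeight
  rw [← Real.exp_add, Real.exp_le_exp]
  have h1 := abs_le.1 h
  have a1 : max x 0 ≤ max s 0 + 1 := max_le (by linarith [le_max_left s 0])
    (by linarith [le_max_right s 0])
  have a2 : max (-x) 0 ≤ max (-s) 0 + 1 := max_le (by linarith [le_max_left (-s) 0])
    (by linarith [le_max_right (-s) 0])
  nlinarith [mul_le_mul_of_nonneg_left a1 hκ, mul_le_mul_of_nonneg_left a2 hμ]

namespace IsFrontChart

variable {a b M : ℝ → ℝ} {μ κ η : ℝ} {G G' h h' : ℝ → ℝ}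

/-- On the right this is the decay estimate; on the left it follows from `M' = G'(e^{μx}) μ e^{μx}`
with `G'` bounded on `[0,1]`. -/
lemma exists_deriv_profile_le (H : IsFrontChart a b M μ κ η G G' h h') :
    ∃ C, 0 < C ∧ ∀ x, deriv M x ≤ C * tailWeight κ μ x := by
  obtain ⟨c, C, hc, hC, hdec⟩ := H.decay 0
  obtain ⟨D, hD0, hD⟩ := exists_bound_Icc H.continuous_G' 1
  refine ⟨max C (D * μ), lt_max_of_lt_left hC, fun x => ?_⟩
  unfold tailWeight
  rcases le_total 0 x with hx | hx
  · rw [max_eq_left hx, max_eq_right (by linarith : -x ≤ 0), mul_zero, sub_zero]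
    exact (hdec x hx).2.trans (mul_le_mul_of_nonneg_right (le_max_left _ _) (Real.exp_pos _).le)
  · rw [max_eq_right hx, max_eq_left (by linarith : 0 ≤ -x), H.deriv_profile]
    have h1 : Real.exp (μ * x) ≤ 1 := by
      rw [Real.exp_le_one_iff]; exact mul_nonpos_of_nonneg_of_nonpos H.mu_pos.le hx
    have h2 := (le_abs_self _).trans (hD _ (by rw [abs_of_pos (Real.exp_pos _)]; exact h1))
    calc G' (Real.exp (μ * x)) * (μ * Real.exp (μ * x))
        ≤ D * (μ * Real.exp (μ * x)) :=
          mul_le_mul_of_nonneg_right h2 (mul_pos H.mu_pos (Real.exp_pos _)).le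
      _ = D * μ * Real.exp (-κ * 0 - μ * -x) := by
          rw [mul_zero, zero_sub, mul_neg, neg_neg, mul_assoc]
      _ ≤ _ := mul_le_mul_of_nonneg_right (le_max_right _ _) (Real.exp_pos _).le

/-- Values of the first integral for which `G (q e^{μ x})` stays under control at position `x`. -/
def Admissible (_ : IsFrontChart a b M μ κ η G G' h h') (x q : ℝ) : Prop :=
  (Real.exp (-μ) ≤ q ∧ q ≤ Real.exp μ) ∨
    (x ≤ 0 ∧ h (-η) ≤ q * Real.exp (μ * x) ∧ q * Real.exp (μ * x) ≤ Real.exp μ)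

/-- The quantity is the derivative of `q ↦ G(q e^{μx})`. For `q = e^{μσ}` with `|σ| ≤ 1`,
multiplication by `q` is a translation, `G(q e^{μx}) = M(x + σ)`, and the bound is inherited from
`M'`. In the other case the argument stays in a compact set and the factor `e^{μx}` is already the
weight. -/
lemma exists_G'_le (H : IsFrontChart a b M μ κ η G G' h h') :
    ∃ C, 0 < C ∧ ∀ x q, H.Admissible x q →
      G' (q * Real.exp (μ * x)) * Real.exp (μ * x) ≤ C * tailWeight κ μ x := by
  obtain ⟨C, hC, hCx⟩ := H.exists_deriv_profile_le
  obtain ⟨D, hD⟩ := (isCompact_Icc (a := h (-η)) (b := Real.exp μ)).bddAbove_image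
    H.continuous_G'.continuousOn
  have hμ := H.mu_pos
  refine ⟨max (Real.exp μ / μ * (C * Real.exp (κ + μ))) D, lt_max_of_lt_left (by positivity),
    fun x q hq => ?_⟩
  have hw := (tailWeight_pos κ μ x).le
  rcases hq with ⟨h1, h2⟩ | ⟨h0, h1, h2⟩
  · have hq0 : 0 < q := (Real.exp_pos _).trans_le h1
    set σ := Real.log q / μ with hσ
    have hqe : q = Real.exp (μ * σ) := by
      rw [hσ, mul_div_cancel₀ _ hμ.ne', Real.exp_log hq0]
    rw [hqe, Real.exp_le_exp] at h1 h2
    have hσ1 : -1 ≤ σ := by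
      by_contra hcon
      nlinarith [mul_lt_mul_of_pos_left (not_le.1 hcon) hμ]
    have hσ2 : σ ≤ 1 := by
      by_contra hcon
      nlinarith [mul_lt_mul_of_pos_left (not_le.1 hcon) hμ]
    have e : q * Real.exp (μ * x) = Real.exp (μ * (x + σ)) := by
      rw [hqe, ← Real.exp_add]; ring_nf
    rw [e]
    have h3 := H.deriv_profile (x + σ)
    have h4 : Real.exp (μ * x) = Real.exp (μ * (x + σ)) * Real.exp (-(μ * σ)) := by
      rw [← Real.exp_add]; ring_nf
    have h5 := (hCx (x + σ)).trans (mul_le_mul_of_nonneg_left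
      (tailWeight_shift H.kappa_pos.le hμ.le (x := x) (s := x + σ)
        (by rw [add_sub_cancel_left]; exact abs_le.2 ⟨hσ1, hσ2⟩)) hC.le)
    have h6 : Real.exp (-(μ * σ)) ≤ Real.exp μ := Real.exp_le_exp.2 (by nlinarith)
    have hMpos := (H.front.deriv_pos (x + σ)).le
    calc G' (Real.exp (μ * (x + σ))) * Real.exp (μ * x)
        = deriv M (x + σ) / μ * Real.exp (-(μ * σ)) := by
          rw [h3, h4]; field_simp
      _ ≤ (C * (Real.exp (κ + μ) * tailWeight κ μ x)) / μ * Real.exp μ := by gcongr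
      _ = Real.exp μ / μ * (C * Real.exp (κ + μ)) * tailWeight κ μ x := by ring
      _ ≤ _ := mul_le_mul_of_nonneg_right (le_max_left _ _) hw
  · have h3 := hD ⟨_, ⟨h1, h2⟩, rfl⟩
    have h4 : tailWeight κ μ x = Real.exp (μ * x) := by
      unfold tailWeight
      rw [max_eq_right h0, max_eq_left (by linarith : 0 ≤ -x)]
      ring_nf
    rw [h4]
    exact mul_le_mul_of_nonneg_right (h3.trans (le_max_right _ _)) (Real.exp_pos _).le

/-- The wave corresponds to `q = 1`, and at fixed `x` the segment from 1 to an admissible value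
consists of admissible values; the mean value inequality concludes. -/
lemma exists_abs_G_sub_le (H : IsFrontChart a b M μ κ η G G' h h') :
    ∃ C, 0 < C ∧ ∀ x q, H.Admissible x q →
      |G (q * Real.exp (μ * x)) - M x| ≤ C * tailWeight κ μ x * |q - 1| := by
  obtain ⟨C, hC, hCx⟩ := H.exists_G'_le
  refine ⟨C, hC, fun x q hq => ?_⟩
  have hadm : ∀ r ∈ uIcc 1 q, H.Admissible x r := by
    intro r hr
    have hμ := H.mu_pos
    rcases hq with ⟨h1, h2⟩ | ⟨h0, h1, h2⟩
    · exact Or.inl (ordConnected_Icc.uIcc_subset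
        (⟨Real.exp_le_one_iff.2 (by linarith), Real.one_le_exp hμ.le⟩ :
          (1 : ℝ) ∈ Icc (Real.exp (-μ)) (Real.exp μ)) ⟨h1, h2⟩ hr)
    · refine Or.inr ⟨h0, ?_⟩
      have he := Real.exp_pos (μ * x)
      have h3 : Real.exp (μ * x) ≤ 1 :=
        Real.exp_le_one_iff.2 (mul_nonpos_of_nonneg_of_nonpos hμ.le h0)
      have hη : h (-η) ≤ 0 := by
        rw [← H.h_zero]
        exact H.strictMonoOn_h.monotoneOn H.eta_lt (by simp) (by linarith [H.eta_pos])
      have h4 := Real.one_le_exp hμ.le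
      rcases mem_uIcc.1 hr with ⟨r1, r2⟩ | ⟨r1, r2⟩
      · exact ⟨by nlinarith, (mul_le_mul_of_nonneg_right r2 he.le).trans h2⟩
      · exact ⟨h1.trans (mul_le_mul_of_nonneg_right r1 he.le), by nlinarith⟩
  have hder : ∀ r, HasDerivAt (fun r => G (r * Real.exp (μ * x)))
      (G' (r * Real.exp (μ * x)) * Real.exp (μ * x)) r := fun r => by
    have h1 : HasDerivAt (fun r => r * Real.exp (μ * x)) (Real.exp (μ * x)) r := by
      simpa using (hasDerivAt_id r).mul_const (Real.exp (μ * x))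
    exact (H.hasDerivAt_G _).comp r h1
  have key := (convex_uIcc 1 q).norm_image_sub_le_of_norm_hasDerivWithin_le
    (C := C * tailWeight κ μ x) (fun r _ => (hder r).hasDerivWithinAt) (fun r hr => by
      rw [Real.norm_eq_abs, abs_of_pos (mul_pos (H.G'_pos _) (Real.exp_pos _))]
      exact hCx x r (hadm r hr)) left_mem_uIcc right_mem_uIcc
  simpa [H.G_exp] using key

/-- `b/a` is the slope field of the profile equation; this compares the slope at a perturbed state
with `M'`. -/
lemma exists_lipschitz_slope (H : IsFrontChart a b M μ κ η G G' h h') (ha : ContDiff ℝ 1 a)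
    (hb : ContDiff ℝ 1 b) :
    ∃ L, 0 ≤ L ∧ ∀ m n, -η ≤ m → m ≤ 1 → -η ≤ n → n ≤ 1 →
      |b m / a m - b n / a n| ≤ L * |m - n| := by
  have hane : ∀ m ∈ Icc (-η) 1, a m ≠ 0 := fun m hm => (H.speed_neg m hm.1 hm.2).ne
  have hac := ha.continuous
  have hbc := hb.continuous
  have ha' := ha.continuous_deriv le_rfl
  have hb' := hb.continuous_deriv le_rfl
  have hder : ∀ m ∈ Icc (-η) 1, HasDerivAt (fun m => b m / a m)
      ((deriv b m * a m - b m * deriv a m) / a m ^ 2) m := fun m hm =>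
    (hb.differentiable one_ne_zero m).hasDerivAt.fun_div
      (ha.differentiable one_ne_zero m).hasDerivAt (hane m hm)
  obtain ⟨L, hL⟩ := (isCompact_Icc (a := -η) (b := 1)).bddAbove_image
    (f := fun m => |(deriv b m * a m - b m * deriv a m) / a m ^ 2|)
    (ContinuousOn.abs (ContinuousOn.div (Continuous.continuousOn (by fun_prop))
      (Continuous.continuousOn (by fun_prop)) fun m hm => pow_ne_zero 2 (hane m hm)))
  refine ⟨L, (abs_nonneg _).trans (hL ⟨1, ⟨H.eta_lt.le, le_rfl⟩, rfl⟩),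
    fun m n hm hm' hn hn' => ?_⟩
  exact (convex_Icc (-η) 1).norm_image_sub_le_of_norm_hasDerivWithin_le
    (fun r hr => (hder r hr).hasDerivWithinAt) (fun r hr => hL ⟨r, hr, rfl⟩)
    (show n ∈ Icc (-η) 1 from ⟨hn, hn'⟩) (show m ∈ Icc (-η) 1 from ⟨hm, hm'⟩)

/-- Control of the first integral and of its derivative by the size of the perturbation. -/
lemma exists_first_integral_bounds (H : IsFrontChart a b M μ κ η G G' h h')
    (ha : ContDiff ℝ 1 a) (hb : ContDiff ℝ 1 b) :
    ∃ δ C, 0 < δ ∧ 0 < C ∧ ∀ x m p n, n ≤ δ → |m - M x| ≤ n * Real.exp (-κ * max x 0) →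
      |p - deriv M x| ≤ n * Real.exp (-κ * max x 0) →
      m < 1 ∧ (0 ≤ x → Real.exp (-μ) ≤ Real.exp (-μ * x) * h m
        ∧ Real.exp (-μ * x) * h m ≤ Real.exp μ) ∧
      (x ≤ 0 → h (-η) ≤ h m ∧ h m ≤ Real.exp μ) ∧
      |Real.exp (-μ * x) * h m - 1| ≤ C * n * Real.exp (μ * max (-x) 0) ∧
      |Real.exp (-μ * x) * (h' m * p - μ * h m)| ≤ C * n * Real.exp (μ * max (-x) 0) := by
  have hμ := H.mu_pos
  have hκ := H.kappa_pos
  have hη := H.eta_pos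
  have hmono := H.front.strictMono
  have hhmono := H.strictMonoOn_h
  -- Starting at `-1` is enough because the profile is compared with its translates `M (x ± 1)` for
  -- `x ≥ 0`.
  obtain ⟨c, C₁, hc, hC₁, hdec⟩ := H.decay (-1)
  obtain ⟨L, hL0, hL⟩ := H.exists_lipschitz_slope ha hb
  have hsubM : Icc (-η) (M 1) ⊆ Iio 1 := fun m hm => hm.2.trans_lt (H.front.lt_one 1)
  obtain ⟨D, hD⟩ := (isCompact_Icc (a := -η) (b := M 1)).bddAbove_image
    (H.continuousOn_h'.mono hsubM)
  have hD' : ∀ m, -η ≤ m → m ≤ M 1 → h' m ≤ D := fun m h1 h2 => hD ⟨m, ⟨h1, h2⟩, rfl⟩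
  -- increments of the profile
  have hinc : ∀ x y, -1 ≤ x → x ≤ y → c * Real.exp (-κ * y) * (y - x) ≤ M y - M x := by
    intro x y hx hxy
    refine (convex_Icc x y).mul_sub_le_image_sub_of_le_deriv
      (fun s _ => (H.front.hasDerivAt s).continuousAt.continuousWithinAt)
      (fun s _ => (H.front.hasDerivAt s).differentiableAt.differentiableWithinAt)
      (fun s hs => ?_) x ⟨le_rfl, hxy⟩ y ⟨hxy, le_rfl⟩ hxy
    rw [interior_Icc] at hs
    refine le_trans ?_ (hdec s (by linarith [hs.1])).1
    exact mul_le_mul_of_nonneg_left (Real.exp_le_exp.2 (by nlinarith [hs.2])) hc.le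
  -- For `x ≤ 0` the first two terms keep the state in `[-η, M 1]`; for `x ≥ 0` the last one traps
  -- it between `M (x - 1)` and `M (x + 1)`, whose distances to `M x` are at least of order
  -- `e^{-κx}`.
  set δ := min (min η (M 1 - M 0)) (c * Real.exp (-κ)) with hδ
  have hδ0 : 0 < δ := lt_min (lt_min hη (sub_pos.2 (hmono one_pos))) (by positivity)
  have hδη : δ ≤ η := (min_le_left _ _).trans (min_le_left _ _)
  have hδM : δ ≤ M 1 - M 0 := (min_le_left _ _).trans (min_le_right _ _)
  have hδc : δ ≤ c * Real.exp (-κ) := min_le_right _ _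
  -- derivative of the chart along the profile
  have hh'M : ∀ s, -1 ≤ s → h' (M s) ≤ μ / c * Real.exp ((μ + κ) * s) := by
    intro s hs
    have h1 := H.deriv_profile s
    have h2 := H.h'_mul_G' (Real.exp (μ * s))
    rw [H.G_exp] at h2
    have h3 : h' (M s) * deriv M s = μ * Real.exp (μ * s) := by
      rw [h1, ← mul_assoc, h2, one_mul]
    have h4 := mul_le_mul_of_nonneg_left (hdec s hs).1 (H.h'_pos _ (H.front.lt_one s)).le
    rw [h3] at h4
    have h5 : h' (M s) * c * Real.exp (-κ * s) ≤ μ * Real.exp (μ * s) := by linarith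
    have h6 := mul_le_mul_of_nonneg_right h5 (Real.exp_pos (κ * s)).le
    have h7 : Real.exp (-κ * s) * Real.exp (κ * s) = 1 := by
      rw [← Real.exp_add]; simp
    rw [mul_assoc, h7, mul_one, mul_assoc, ← Real.exp_add, ← add_mul] at h6
    rw [div_mul_eq_mul_div, le_div_iff₀ hc]
    exact h6
  set E := max (μ / c * Real.exp (μ + κ)) D with hE
  have hE0 : 0 < E := lt_max_of_lt_left (by positivity)
  refine ⟨δ, E * (1 + L), hδ0, by positivity, fun x m p n hn hm hp => ?_⟩
  have hm' := abs_le.1 hm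
  have hn0 : 0 ≤ n := by
    by_contra hcon
    have := (abs_nonneg _).trans hm
    have := mul_neg_of_neg_of_pos (not_le.1 hcon) (Real.exp_pos (-κ * max x 0))
    linarith
  -- location of the state
  have hright : 0 ≤ x → M (x - 1) ≤ m ∧ m ≤ M (x + 1) := by
    intro hx
    rw [max_eq_left hx] at hm'
    have h1 := hinc (x - 1) x (by linarith) (by linarith)
    have h2 := hinc x (x + 1) (by linarith) (by linarith)
    have e : Real.exp (-κ * (x + 1)) = Real.exp (-κ) * Real.exp (-κ * x) := by
      rw [← Real.exp_add]; ring_nf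
    rw [e] at h2
    have hep := Real.exp_pos (-κ * x)
    have h3 : n * Real.exp (-κ * x) ≤ c * Real.exp (-κ) * Real.exp (-κ * x) :=
      mul_le_mul_of_nonneg_right (hn.trans hδc) hep.le
    have h4 : c * Real.exp (-κ) * Real.exp (-κ * x) ≤ c * Real.exp (-κ * x) := by
      have : Real.exp (-κ) ≤ 1 := Real.exp_le_one_iff.2 (by linarith)
      nlinarith [mul_pos hc hep]
    constructor
    · nlinarith
    · nlinarith
  have hleft : x ≤ 0 → -η ≤ m ∧ m ≤ M 1 := by
    intro hx
    rw [max_eq_right hx, mul_zero, Real.exp_zero, mul_one] at hm'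
    have h1 := hmono.monotone hx
    have h2 := H.front.pos x
    constructor <;> linarith
  have hm1 : m < 1 := by
    rcases le_total 0 x with hx | hx
    · exact (hright hx).2.trans_lt (H.front.lt_one _)
    · exact (hleft hx).2.trans_lt (H.front.lt_one _)
  have hmη : -η ≤ m := by
    rcases le_total 0 x with hx | hx
    · linarith [(hright hx).1, H.front.pos (x - 1)]
    · exact (hleft hx).1
  have hbd : ∀ r ∈ uIcc (M x) m, r < 1 ∧ h' r ≤ E * Real.exp ((μ + κ) * max x 0) := by
    intro r hr
    rcases le_total 0 x with hx | hx
    · have hrI : r ∈ Icc (M (x - 1)) (M (x + 1)) :=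
        ordConnected_Icc.uIcc_subset ⟨hmono.monotone (by linarith), hmono.monotone (by linarith)⟩
          ⟨(hright hx).1, (hright hx).2⟩ hr
      obtain ⟨s, hs, rfl⟩ := intermediate_value_Icc (by linarith : x - 1 ≤ x + 1)
        H.front.smooth.continuous.continuousOn hrI
      refine ⟨H.front.lt_one s, (hh'M s (by linarith [hs.1])).trans ?_⟩
      rw [max_eq_left hx]
      calc μ / c * Real.exp ((μ + κ) * s) ≤ μ / c * Real.exp ((μ + κ) * (x + 1)) := by
            have := hs.2; gcongr
        _ = μ / c * Real.exp (μ + κ) * Real.exp ((μ + κ) * x) := by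
            rw [mul_assoc, ← Real.exp_add]; ring_nf
        _ ≤ _ := mul_le_mul_of_nonneg_right (le_max_left _ _) (Real.exp_pos _).le
    · have hrI : r ∈ Icc (-η) (M 1) :=
        ordConnected_Icc.uIcc_subset ⟨by linarith [H.front.pos x], hmono.monotone (by linarith)⟩
          ⟨(hleft hx).1, (hleft hx).2⟩ hr
      refine ⟨hsubM hrI, (hD' r hrI.1 hrI.2).trans ?_⟩
      rw [max_eq_right hx, mul_zero, Real.exp_zero, mul_one]
      exact le_max_right _ _
  -- Here the critical rate matters: the growth `e^{(μ+κ)x}` of `h'`, the weight `e^{-κx}` and the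
  -- factor `e^{-μx}` cancel exactly for `x ≥ 0`.
  have hexp : Real.exp (-μ * x) * (Real.exp ((μ + κ) * max x 0) * Real.exp (-κ * max x 0))
      = Real.exp (μ * max (-x) 0) := by
    rw [← Real.exp_add, ← Real.exp_add]
    congr 1
    rcases le_total 0 x with hx | hx
    · rw [max_eq_left hx, max_eq_right (by linarith : -x ≤ 0)]; ring
    · rw [max_eq_right hx, max_eq_left (by linarith : 0 ≤ -x)]; ring
  have hex := Real.exp_pos (-μ * x)
  have hnorm : Real.exp (-μ * x) * h (M x) = 1 := by
    rw [H.h_profile, ← Real.exp_add]; simp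
  refine ⟨hm1, fun hx => ?_, fun hx => ?_, ?_, ?_⟩
  · have h1 := hhmono.monotoneOn (H.front.lt_one _) hm1 (hright hx).1
    have h2 := hhmono.monotoneOn hm1 (H.front.lt_one _) (hright hx).2
    rw [H.h_profile] at h1 h2
    have h3 := mul_le_mul_of_nonneg_left h1 hex.le
    have h4 := mul_le_mul_of_nonneg_left h2 hex.le
    rw [← Real.exp_add] at h3 h4
    refine ⟨le_trans (le_of_eq ?_) h3, h4.trans (le_of_eq ?_)⟩ <;> ring_nf
  · have h1 := hhmono.monotoneOn H.eta_lt hm1 (hleft hx).1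
    have h2 := hhmono.monotoneOn hm1 (H.front.lt_one _) (hleft hx).2
    rw [H.h_profile, mul_one] at h2
    exact ⟨h1, h2⟩
  · have key := (convex_uIcc (M x) m).norm_image_sub_le_of_norm_hasDerivWithin_le
      (C := E * Real.exp ((μ + κ) * max x 0))
      (fun r hr => (H.hasDerivAt_h r (hbd r hr).1).hasDerivWithinAt) (fun r hr => by
        rw [Real.norm_eq_abs, abs_of_pos (H.h'_pos _ (hbd r hr).1)]
        exact (hbd r hr).2) left_mem_uIcc right_mem_uIcc
    rw [Real.norm_eq_abs, Real.norm_eq_abs] at key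
    have e0 : |Real.exp (-μ * x) * h m - 1| = Real.exp (-μ * x) * |h m - h (M x)| := by
      rw [show (1 : ℝ) = _ from hnorm.symm, ← mul_sub, abs_mul, abs_of_pos hex]
    rw [e0]
    calc Real.exp (-μ * x) * |h m - h (M x)|
        ≤ Real.exp (-μ * x) * (E * Real.exp ((μ + κ) * max x 0)
            * (n * Real.exp (-κ * max x 0))) := by
          refine mul_le_mul_of_nonneg_left (key.trans ?_) hex.le
          exact mul_le_mul_of_nonneg_left hm (by positivity)
      _ = E * n * (Real.exp (-μ * x) * (Real.exp ((μ + κ) * max x 0)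
            * Real.exp (-κ * max x 0))) := by ring
      _ = E * n * Real.exp (μ * max (-x) 0) := by rw [hexp]
      _ ≤ E * (1 + L) * n * Real.exp (μ * max (-x) 0) := by
          refine mul_le_mul_of_nonneg_right ?_ (Real.exp_pos _).le
          nlinarith [mul_nonneg hE0.le hn0, mul_nonneg (mul_nonneg hE0.le hn0) hL0]
  · have hlin := H.linear m hmη hm1
    have han := (H.speed_neg m hmη hm1.le).ne
    -- The derivative of the first integral measures the failure of `(m, p)` to satisfy the profile
    -- equation, which is small since `(M, M')` satisfies it.
    have e : h' m * p - μ * h m = h' m * (p - b m / a m) := by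
      rw [mul_sub, mul_div_assoc', hlin, mul_div_cancel_right₀ _ han]
    have h1 : |p - b m / a m| ≤ (1 + L) * (n * Real.exp (-κ * max x 0)) := by
      have h2 := hL (M x) m (by linarith [H.front.pos x]) (H.front.lt_one x).le hmη hm1.le
      rw [← H.front.deriv_eq, abs_sub_comm (M x)] at h2
      have h3 := abs_sub_le p (deriv M x) (b m / a m)
      have h4 := mul_le_mul_of_nonneg_left hm hL0
      linarith
    rw [e, abs_mul, abs_of_pos hex, abs_mul, abs_of_pos (H.h'_pos m hm1)]
    have h2 := (hbd m right_mem_uIcc).2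
    calc Real.exp (-μ * x) * (h' m * |p - b m / a m|)
        ≤ Real.exp (-μ * x) * (E * Real.exp ((μ + κ) * max x 0)
            * ((1 + L) * (n * Real.exp (-κ * max x 0)))) := by
          refine mul_le_mul_of_nonneg_left ?_ hex.le
          exact mul_le_mul h2 h1 (abs_nonneg _) (by positivity)
      _ = E * (1 + L) * n * (Real.exp (-μ * x) * (Real.exp ((μ + κ) * max x 0)
            * Real.exp (-κ * max x 0))) := by ring
      _ = _ := by rw [hexp]

end IsFrontChart

/-! ### Feet of characteristics by a global implicit function. -/

/-- A map with a local left inverse and an invertible derivative: the left inverse is smooth. -/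
lemma contDiffAt_of_leftInverse {E : Type*} [NormedAddCommGroup E] [NormedSpace ℝ E]
    [CompleteSpace E] {Φ g : E → E} {e : E ≃L[ℝ] E} {p : E} (hΦ : ContDiffAt ℝ 1 Φ p)
    (he : HasFDerivAt Φ (e : E →L[ℝ] E) p) (hg : ∀ᶠ y in 𝓝 p, g (Φ y) = y) :
    ContDiffAt ℝ 1 g (Φ p) ∧ HasFDerivAt g (e.symm : E →L[ℝ] E) (Φ p) := by
  have hs : HasStrictFDerivAt Φ (e : E →L[ℝ] E) p := hΦ.hasStrictFDerivAt' he one_ne_zero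
  refine ⟨?_, (hs.to_local_left_inverse hg).hasFDerivAt⟩
  refine (hΦ.to_localInverse he one_ne_zero).congr_of_eventuallyEq ?_
  have h1 : ∀ᶠ y in 𝓝 (Φ p), Φ (hs.localInverse Φ e p y) = y := hs.eventually_right_inverse
  have h2 : Tendsto (hs.localInverse Φ e p) (𝓝 (Φ p)) (𝓝 p) := by
    have := hs.localInverse_continuousAt.tendsto
    rwa [hs.localInverse_apply_image] at this
  filter_upwards [h1, h2.eventually hg] with y hy1 hy2
  rw [hy1] at hy2
  exact hy2

/-- Global implicit function: solve `H (ξ, x) = t` for `ξ` when `H` vanishes on the diagonal and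
increases at rate at least `c` in its first variable on `{x₀ ≥ x - 1}`. -/
lemma exists_implicit_function {H : ℝ × ℝ → ℝ} (hH : ContDiff ℝ 1 H) {c : ℝ} (hc : 0 < c)
    (h0 : ∀ x, H (x, x) = 0) (hN : ∀ x₀ x, x - 1 ≤ x₀ → c ≤ pdt H (x₀, x)) :
    ∃ ξ : ℝ × ℝ → ℝ, ∀ p, -c < p.1 → p.2 - 1 < ξ p ∧ H (ξ p, p.2) = p.1 ∧ ContDiffAt ℝ 1 ξ p ∧
      pdt ξ p = (pdt H (ξ p, p.2))⁻¹ ∧ pdx ξ p = -pdx H (ξ p, p.2) / pdt H (ξ p, p.2) ∧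
      (0 ≤ p.1 → p.2 ≤ ξ p) ∧ (p.1 = 0 → ξ p = p.2) := by
  have hd : ∀ p, DifferentiableAt ℝ H p := hH.differentiable one_ne_zero
  have hder : ∀ x s, HasDerivAt (fun s => H (s, x)) (pdt H (s, x)) s := fun x s =>
    hasDerivAt_pdt (hd (s, x))
  have hslope : ∀ x s s', x - 1 ≤ s → s ≤ s' → c * (s' - s) ≤ H (s', x) - H (s, x) := by
    intro x s s' h1 h2
    refine (convex_Icc s s').mul_sub_le_image_sub_of_le_deriv (f := fun s => H (s, x))
      (fun r _ => (hder x r).continuousAt.continuousWithinAt)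
      (fun r _ => (hder x r).differentiableAt.differentiableWithinAt)
      (fun r hr => ?_) s ⟨le_rfl, h2⟩ s' ⟨h2, le_rfl⟩ h2
    rw [interior_Icc] at hr
    rw [(hder x r).deriv]
    exact hN r x (h1.trans hr.1.le)
  have hinj : ∀ x s s', x - 1 ≤ s → x - 1 ≤ s' → H (s, x) = H (s', x) → s = s' := by
    intro x s s' h1 h2 h3
    rcases le_total s s' with h | h
    · have := hslope x s s' h1 h; nlinarith
    · have := hslope x s' s h2 h; nlinarith
  have hex : ∀ p : ℝ × ℝ, ∃ s, -c < p.1 → p.2 - 1 < s ∧ H (s, p.2) = p.1 := by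
    intro p
    by_cases hp : -c < p.1
    -- Over the unit interval left of the diagonal `H` drops by at least `c`, so all values above
    -- `-c` are reached. Slightly negative times are thus allowed, and `ξ` is `C¹` in a full
    -- neighbourhood of time zero.
    · have h1 := hslope p.2 (p.2 - 1) p.2 le_rfl (by linarith)
      have h2 := hslope p.2 p.2 (p.2 + |p.1| / c) (by linarith) (by
        linarith [div_nonneg (abs_nonneg p.1) hc.le])
      rw [h0] at h1 h2
      have h3 : c * (p.2 + |p.1| / c - p.2) = |p.1| := by field_simp; ring
      obtain ⟨s, hs, hs'⟩ := intermediate_value_Icc (f := fun s => H (s, p.2))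
        (a := p.2 - 1) (b := p.2 + |p.1| / c)
        (by linarith [div_nonneg (abs_nonneg p.1) hc.le])
        (fun r _ => (hder p.2 r).continuousAt.continuousWithinAt)
        (show p.1 ∈ _ from ⟨by linarith, by linarith [le_abs_self p.1]⟩)
      refine ⟨s, fun _ => ⟨lt_of_le_of_ne hs.1 ?_, hs'⟩⟩
      rintro rfl
      simp only at hs'
      linarith
    · exact ⟨0, fun h => absurd h hp⟩
  choose ξ hξ using hex
  refine ⟨ξ, fun p hp => ?_⟩
  obtain ⟨hgt, heq⟩ := hξ p hp
  set a : ℝ × ℝ := (ξ p, p.2) with ha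
  have hNa : c ≤ pdt H a := hN _ _ hgt.le
  have hNpos : 0 < pdt H a := hc.trans_le hNa
  -- Near `a`, the map `(t, x) ↦ (ξ, x)` is a left inverse of `Φ`, because `H` is injective in its
  -- first variable; the inverse function theorem then gives regularity and both partial derivatives
  -- of `ξ`.
  set Φ : ℝ × ℝ → ℝ × ℝ := fun y => (H y, y.2) with hΦdef
  have hΦ : ContDiff ℝ 1 Φ := hH.prodMk contDiff_snd
  have hΦa : Φ a = p := Prod.ext heq rfl
  have hL : HasFDerivAt Φ ((fderiv ℝ H a).prod (ContinuousLinearMap.snd ℝ ℝ ℝ)) a :=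
    (hd a).hasFDerivAt.prodMk hasFDerivAt_snd
  have hdec : ∀ v : ℝ × ℝ, fderiv ℝ H a v = v.1 * pdt H a + v.2 * pdx H a := by
    intro v
    have : v = v.1 • ((1, 0) : ℝ × ℝ) + v.2 • ((0, 1) : ℝ × ℝ) := by ext <;> simp
    conv_lhs => rw [this]
    rw [map_add, map_smul, map_smul]
    rfl
  let L' : ℝ × ℝ →L[ℝ] ℝ × ℝ :=
    ((pdt H a)⁻¹ • (ContinuousLinearMap.fst ℝ ℝ ℝ - pdx H a • ContinuousLinearMap.snd ℝ ℝ ℝ)).prod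
      (ContinuousLinearMap.snd ℝ ℝ ℝ)
  let e : (ℝ × ℝ) ≃L[ℝ] ℝ × ℝ := ContinuousLinearEquiv.equivOfInverse
    ((fderiv ℝ H a).prod (ContinuousLinearMap.snd ℝ ℝ ℝ)) L'
    (fun v => by
      refine Prod.ext ?_ rfl
      simp only [L', ContinuousLinearMap.prod_apply, smul_apply,
        sub_apply, ContinuousLinearMap.coe_fst', ContinuousLinearMap.coe_snd',
        smul_eq_mul, hdec]
      field_simp; ring)
    (fun v => by
      refine Prod.ext ?_ rfl
      simp only [L', ContinuousLinearMap.prod_apply, smul_apply,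
        sub_apply, ContinuousLinearMap.coe_fst', ContinuousLinearMap.coe_snd',
        smul_eq_mul, hdec]
      field_simp; ring)
  have hinv : ∀ᶠ y in 𝓝 a, (fun y => (ξ y, y.2)) (Φ y) = y := by
    have c1 : ∀ᶠ y in 𝓝 a, -c < H y :=
      hH.continuous.continuousAt.eventually (lt_mem_nhds (by rw [heq]; exact hp))
    have c2 : ∀ᶠ y : ℝ × ℝ in 𝓝 a, y.2 - 1 < y.1 :=
      (isOpen_lt (by fun_prop) (by fun_prop)).mem_nhds hgt
    filter_upwards [c1, c2] with y hy1 hy2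
    have := hξ (H y, y.2) hy1
    refine Prod.ext (hinj y.2 _ _ this.1.le hy2.le ?_) rfl
    exact this.2
  obtain ⟨r1, r2⟩ := contDiffAt_of_leftInverse (g := fun y => (ξ y, y.2)) (e := e) hΦ.contDiffAt hL hinv
  rw [hΦa] at r1 r2
  have r3 : HasFDerivAt ξ ((ContinuousLinearMap.fst ℝ ℝ ℝ).comp L') p := r2.fst
  refine ⟨hgt, heq, contDiff_fst.contDiffAt.comp p r1, ?_, ?_, fun h => ?_, fun h => ?_⟩
  · rw [pdt, r3.fderiv]; simp [L']
  · rw [pdx, r3.fderiv]; simp [L']; ring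
  · by_contra hcon
    have := hslope p.2 (ξ p) p.2 hgt.le (not_le.1 hcon).le
    rw [h0, heq] at this
    nlinarith [not_le.1 hcon]
  · exact hinj p.2 _ _ hgt.le (by linarith) (by rw [heq, h0, h])

/-- Primitive of the divided difference of a travel time per unit length. -/
lemma exists_travel_primitive {B : ℝ → ℝ} (hB : Continuous B) (hB0 : DifferentiableAt ℝ B 0)
    {A : ℝ} (hA : ∀ z, |B z| ≤ A) {μ : ℝ} (hμ : 0 < μ) :
    ∃ (R r : ℝ → ℝ) (C : ℝ), (∀ z, HasDerivAt R (r z) z) ∧ Continuous r ∧ 0 < C ∧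
      (∀ z, μ * z * r z = B z - B 0) ∧ (∀ z, |r z| ≤ C) ∧ ∀ z, |z * r z| ≤ C := by
  -- With `B z = B 0 + μ z r z`, the integral of `B(q e^{μs})` in `s` is explicit in terms of a
  -- primitive of `r`. Both `r` and `z r` are bounded: near 0 by continuity, away from 0 because `B`
  -- is bounded.
  set r : ℝ → ℝ := fun z => dslope B 0 z / μ with hr
  have hrc : Continuous r := by
    have : ContinuousOn (dslope B 0) univ :=
      (continuousOn_dslope univ_mem).2 ⟨hB.continuousOn, hB0⟩
    exact (continuousOn_univ.1 this).div_const μ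
  have he : ∀ z, μ * z * r z = B z - B 0 := fun z => by
    have := sub_smul_dslope B 0 z
    rw [smul_eq_mul, sub_zero] at this
    rw [hr, ← this]; field_simp
  have hzr : ∀ z, |z * r z| ≤ 2 * A / μ := fun z => by
    have h1 : |z * r z| * μ = |B z - B 0| := by
      rw [← he, mul_assoc, abs_mul μ, abs_of_pos hμ, mul_comm]
    rw [le_div_iff₀ hμ, h1]
    exact (abs_sub _ _).trans (by linarith [hA z, hA 0])
  obtain ⟨D, hD0, hD⟩ := exists_bound_Icc hrc 1
  refine ⟨fun z => ∫ s in (0 : ℝ)..z, r s, r, max (2 * A / μ) D + 1,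
    fun z => hrc.integral_hasStrictDerivAt 0 z |>.hasDerivAt, hrc,
    by linarith [le_max_right (2 * A / μ) D], he, fun z => ?_,
    fun z => (hzr z).trans (by linarith [le_max_left (2 * A / μ) D])⟩
  rcases le_total |z| 1 with hz | hz
  · exact (hD z hz).trans (by linarith [le_max_right (2 * A / μ) D])
  · have h1 := hzr z
    rw [abs_mul] at h1
    have h2 : |r z| ≤ |z| * |r z| := le_mul_of_one_le_left (abs_nonneg _) hz
    linarith [le_max_left (2 * A / μ) D]

/-- The foot, at time zero, of the characteristic through a point, when `q` is the first integral
at time zero and `B (q e^{μ x})` the travel time per unit length. -/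
lemma exists_characteristic_foot {B R r q q' : ℝ → ℝ} {μ β β' : ℝ}
    (hR : ∀ z, HasDerivAt R (r z) z) (hr : Continuous r)
    (hB : ∀ z, μ * z * r z = B z - B 0) (hβ0 : 0 < β) (hβ : ∀ z, β ≤ B z) (hβ' : ∀ z, B z ≤ β')
    (hq : ∀ x, HasDerivAt q (q' x) x) (hq' : Continuous q')
    (hsmall : ∀ x₀ x, x - 1 ≤ x₀ → |q' x₀ * (r (q x₀ * Real.exp (μ * x₀)) * Real.exp (μ * x₀)
      - r (q x₀ * Real.exp (μ * x)) * Real.exp (μ * x))| ≤ β / 2) :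
    ∃ ξ : ℝ × ℝ → ℝ, ∀ p, -(β / 2) < p.1 → p.2 - 1 < ξ p ∧ ContDiffAt ℝ 1 ξ p ∧
      (∃ N, β / 2 ≤ N ∧ pdt ξ p = N⁻¹ ∧ pdx ξ p = B (q (ξ p) * Real.exp (μ * p.2)) / N) ∧
      (0 ≤ p.1 → p.2 + p.1 / β' ≤ ξ p) ∧ (p.1 = 0 → ξ p = p.2) := by
  have hRc : ContDiff ℝ 1 R := contDiff_one_iff_deriv.2 ⟨fun z => (hR z).differentiableAt, by
    rwa [show deriv R = r from funext fun z => (hR z).deriv]⟩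
  have hqc : ContDiff ℝ 1 q := contDiff_one_iff_deriv.2 ⟨fun z => (hq z).differentiableAt, by
    rwa [show deriv q = q' from funext fun z => (hq z).deriv]⟩
  have hexp : ∀ x, HasDerivAt (fun x => Real.exp (μ * x)) (Real.exp (μ * x) * μ) x := fun x => by
    simpa using ((hasDerivAt_id x).const_mul μ).exp
  -- This is the travel time from the foot `p.1` to the position `p.2`, namely the integral of `B(q
  -- e^{μs})` between them with `q` frozen at its value at the foot.
  set H : ℝ × ℝ → ℝ := fun p => B 0 * (p.1 - p.2) + R (q p.1 * Real.exp (μ * p.1))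
    - R (q p.1 * Real.exp (μ * p.2)) with hHdef
  have hH : ContDiff ℝ 1 H := by
    have e1 : ContDiff ℝ 1 fun p : ℝ × ℝ => q p.1 := hqc.comp contDiff_fst
    refine ((contDiff_const.mul (contDiff_fst.sub contDiff_snd)).add (hRc.comp (e1.mul ?_))).sub
      (hRc.comp (e1.mul ?_))
    · exact (contDiff_const.mul contDiff_fst).exp
    · exact (contDiff_const.mul contDiff_snd).exp
  have hd := hH.differentiable one_ne_zero
  have hpdt : ∀ x₀ x, pdt H (x₀, x) = B (q x₀ * Real.exp (μ * x₀))
      + q' x₀ * (r (q x₀ * Real.exp (μ * x₀)) * Real.exp (μ * x₀)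
      - r (q x₀ * Real.exp (μ * x)) * Real.exp (μ * x)) := by
    intro x₀ x
    refine (hasDerivAt_pdt (hd (x₀, x))).unique ?_
    have d1 := ((hasDerivAt_id' x₀).sub_const x).const_mul (B 0)
    have d2 := (hR _).comp x₀ ((hq x₀).fun_mul (hexp x₀))
    have d3 := (hR _).comp x₀ ((hq x₀).mul_const (Real.exp (μ * x)))
    refine ((d1.add d2).sub d3).congr_deriv ?_
    linear_combination hB (q x₀ * Real.exp (μ * x₀))
  have hpath : ∀ w x, HasDerivAt (fun x => B 0 * x + R (w * Real.exp (μ * x)))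
      (B (w * Real.exp (μ * x))) x := by
    intro w x
    have d1 := (hasDerivAt_id' x).const_mul (B 0)
    have d2 := (hR _).comp x ((hexp x).const_mul w)
    refine (d1.add d2).congr_deriv ?_
    linear_combination hB (w * Real.exp (μ * x))
  have hpdx : ∀ x₀ x, pdx H (x₀, x) = -B (q x₀ * Real.exp (μ * x)) := by
    intro x₀ x
    refine (hasDerivAt_pdx (hd (x₀, x))).unique ?_
    have d1 := (hpath (q x₀) x).const_sub (B 0 * x₀ + R (q x₀ * Real.exp (μ * x₀)))
    refine d1.congr_of_eventuallyEq (Eventually.of_forall fun y => ?_)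
    simp only [hHdef]
    ring
  obtain ⟨ξ, hξ⟩ := exists_implicit_function hH (half_pos hβ0) (fun x => by simp [hHdef])
    (fun x₀ x hx => by
      rw [hpdt]
      linarith [(abs_le.1 (hsmall x₀ x hx)).1, hβ (q x₀ * Real.exp (μ * x₀))])
  refine ⟨ξ, fun p hp => ?_⟩
  obtain ⟨h1, h2, h3, h4, h5, h6, h7⟩ := hξ p hp
  refine ⟨h1, h3, ⟨pdt H (ξ p, p.2), ?_, h4, by rw [h5, hpdx, neg_neg]⟩, fun ht => ?_, h7⟩
  · rw [hpdt]
    linarith [(abs_le.1 (hsmall (ξ p) p.2 h1.le)).1, hβ (q (ξ p) * Real.exp (μ * ξ p))]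
  · have h8 := h6 ht
    -- A travel time per unit length of at most `β'` means speed at least `1/β'`, hence the lower
    -- bound on the distance covered.
    have h9 := (convex_Icc p.2 (ξ p)).image_sub_le_mul_sub_of_deriv_le
      (f := fun x => B 0 * x + R (q (ξ p) * Real.exp (μ * x))) (C := β')
      (fun x _ => (hpath _ x).continuousAt.continuousWithinAt)
      (fun x _ => (hpath _ x).differentiableAt.differentiableWithinAt)
      (fun x _ => by rw [(hpath _ x).deriv]; exact hβ' _) p.2 ⟨le_rfl, h8⟩ (ξ p) ⟨h8, le_rfl⟩ h8
    have h10 : H (ξ p, p.2) ≤ β' * (ξ p - p.2) := by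
      refine le_trans (le_of_eq ?_) h9
      simp only [hHdef]; ring
    rw [h2] at h10
    have hβ'0 : 0 < β' := hβ0.trans_le ((hβ 0).trans (hβ' 0))
    have : p.1 / β' ≤ ξ p - p.2 := by rw [div_le_iff₀ hβ'0]; linarith
    linarith

/-! ### Global solutions near the front. -/

namespace IsFrontChart

variable {a b M : ℝ → ℝ} {μ κ η : ℝ} {G G' h h' : ℝ → ℝ}

lemma strictMono_G (H : IsFrontChart a b M μ κ η G G' h h') : StrictMono G :=
  strictMono_of_deriv_pos fun z => by rw [(H.hasDerivAt_G z).deriv]; exact H.G'_pos z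

lemma G_zero (H : IsFrontChart a b M μ κ η G G' h h') : G 0 = 0 := by
  have := H.G_h 0 one_pos
  rwa [H.h_zero] at this

lemma h_neg_eta_nonpos (H : IsFrontChart a b M μ κ η G G' h h') : h (-η) ≤ 0 := by
  rw [← H.h_zero]
  exact H.strictMonoOn_h.monotoneOn H.eta_lt (by simp) (by linarith [H.eta_pos])

/-- The travel time per unit length, as a function of the chart variable. -/
lemma exists_travel_time (H : IsFrontChart a b M μ κ η G G' h h') (ha : ContDiff ℝ 1 a) :
    ∃ (B : ℝ → ℝ) (β β' : ℝ), Continuous B ∧ DifferentiableAt ℝ B 0 ∧ 0 < β ∧ (∀ z, β ≤ B z) ∧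
      (∀ z, B z ≤ β') ∧ ∀ z, h (-η) ≤ z → a (G z) * B z = -1 := by
  have hac := ha.continuous
  have hGc := H.continuous_G
  have hrange : ∀ z, max (G z) (-η) ∈ Icc (-η) 1 := fun z =>
    ⟨le_max_right _ _, max_le (H.G_lt_one z).le H.eta_lt.le⟩
  have hneg : ∀ m ∈ Icc (-η) 1, a m < 0 := fun m hm => H.speed_neg m hm.1 hm.2
  have hne : ∀ z, a (max (G z) (-η)) ≠ 0 := fun z => (hneg _ (hrange z)).ne
  have hI : (Icc (-η) 1).Nonempty := ⟨1, H.eta_lt.le, le_rfl⟩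
  have hinvc : ContinuousOn (fun m => -(a m)⁻¹) (Icc (-η) 1) :=
    (hac.continuousOn.inv₀ fun m hm => (hneg m hm).ne).neg
  obtain ⟨m₁, hm₁, hmin⟩ := isCompact_Icc.exists_isMinOn hI hinvc
  obtain ⟨m₂, hm₂, hmax⟩ := isCompact_Icc.exists_isMaxOn hI hinvc
  -- Clipping at `-η` keeps `a` away from 0 for every `z`; it is inactive for `z ≥ h(-η)`, the only
  -- range where the relation with the speed is claimed.
  refine ⟨fun z => -(a (max (G z) (-η)))⁻¹, -(a m₁)⁻¹, -(a m₂)⁻¹, ?_, ?_,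
    by linarith [inv_lt_zero.2 (hneg m₁ hm₁)], fun z => hmin (hrange z), fun z => hmax (hrange z),
    fun z hz => ?_⟩
  · exact (Continuous.inv₀ (by fun_prop) hne).neg
  · have h1 : DifferentiableAt ℝ (fun z => -(a (G z))⁻¹) 0 := by
      refine (DifferentiableAt.inv ?_ ?_).neg
      · exact (ha.differentiable one_ne_zero _).comp 0 (H.hasDerivAt_G 0).differentiableAt
      · rw [H.G_zero]
        exact (hneg 0 ⟨by linarith [H.eta_pos], zero_le_one⟩).ne
    refine h1.congr_of_eventuallyEq ?_
    have h2 : ∀ᶠ z in 𝓝 (0 : ℝ), -η < G z := hGc.continuousAt.eventually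
      (lt_mem_nhds (by rw [H.G_zero]; linarith [H.eta_pos]))
    filter_upwards [h2] with z hz
    rw [max_eq_left hz.le]
  · have h1 : -η ≤ G z := (H.le_G_iff H.eta_lt).2 hz
    have h2 := (hneg (G z) ⟨h1, (H.G_lt_one z).le⟩).ne
    simp only [max_eq_left h1]
    field_simp

lemma exp_mul_tailWeight (x y : ℝ) : tailWeight κ μ x * Real.exp (μ * max (-y) 0)
    = Real.exp (-κ * max x 0) * Real.exp (-μ * (max (-x) 0 - max (-y) 0)) := by
  unfold tailWeight
  rw [← Real.exp_add, ← Real.exp_add]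
  ring_nf

/-- Global solutions issued from small perturbations of a front, with pointwise control of the
perturbation by its initial size at the foot of the characteristic. -/
theorem exists_solution (H : IsFrontChart a b M μ κ η G G' h h') (ha : ContDiff ℝ 1 a)
    (hb : ContDiff ℝ 1 b) :
    ∃ δ C c ε : ℝ, 0 < δ ∧ 0 < C ∧ 0 < c ∧ 0 < ε ∧ ∀ m₀ : ℝ → ℝ, ContDiff ℝ 1 m₀ →
      (∀ x, |m₀ x - M x| ≤ δ * Real.exp (-κ * max x 0)) →
      (∀ x, |deriv m₀ x - deriv M x| ≤ δ * Real.exp (-κ * max x 0)) →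
      ∃ v : ℝ × ℝ → ℝ, (∀ p, -ε < p.1 → ContDiffAt ℝ 1 v p) ∧
        (∃ Λ, ∀ p, -ε < p.1 → |v p| ≤ Λ) ∧
        (∀ p, 0 ≤ p.1 → pdt v p + a (v p) * pdx v p = b (v p)) ∧
        (∀ x, v (0, x) = m₀ x) ∧
        ∀ p, 0 ≤ p.1 → ∃ y, p.2 + c * p.1 ≤ y ∧ ∀ n ≤ δ,
          |m₀ y - M y| ≤ n * Real.exp (-κ * max y 0) →
          |deriv m₀ y - deriv M y| ≤ n * Real.exp (-κ * max y 0) →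
          |v p - M p.2| ≤ C * n * (Real.exp (-κ * max p.2 0)
            * Real.exp (-μ * (max (-p.2) 0 - max (-y) 0))) ∧
          |pdx v p - deriv M p.2| ≤ C * n * (Real.exp (-κ * max p.2 0)
            * Real.exp (-μ * (max (-p.2) 0 - max (-y) 0))) := by
  have hμ := H.mu_pos
  obtain ⟨δ₁, K, hδ₁, hK, hint⟩ := H.exists_first_integral_bounds ha hb
  obtain ⟨C₁, hC₁, hG'⟩ := H.exists_G'_le
  obtain ⟨C₂, hC₂, hGsub⟩ := H.exists_abs_G_sub_le
  obtain ⟨L, hL0, hL⟩ := H.exists_lipschitz_slope ha hb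
  obtain ⟨B, β, β', hBc, hB0, hβ0, hβ, hβ', haB⟩ := H.exists_travel_time ha
  have hβ'0 : 0 < β' := hβ0.trans_le ((hβ 0).trans (hβ' 0))
  obtain ⟨R, r, D, hR, hrc, hD, hBr, hrD, hzrD⟩ := exists_travel_primitive hBc hB0
    (fun z => abs_le.2 ⟨by linarith [hβ z], hβ' z⟩) hμ
  -- The second term limits to `β/2` the contribution of `q'` to the derivative of the travel time;
  -- this is the absence of shock formation.
  set δ := min δ₁ (β / (4 * (K * (D * Real.exp μ)))) with hδ
  have hδ0 : 0 < δ := lt_min hδ₁ (by positivity)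
  refine ⟨δ, C₂ * K * (1 + L) + C₁ * K * (2 * β' / β), β'⁻¹, β / 2, hδ0, by positivity,
    by positivity, by positivity, fun m₀ hm₀ hd0 hd1 => ?_⟩
  have hpt := fun x => hint x (m₀ x) (deriv m₀ x) δ (min_le_left _ _) (hd0 x) (hd1 x)
  set q : ℝ → ℝ := fun x => Real.exp (-μ * x) * h (m₀ x) with hqdef
  set q' : ℝ → ℝ := fun x => Real.exp (-μ * x) * (h' (m₀ x) * deriv m₀ x - μ * h (m₀ x))
    with hq'def
  have hm₀c := hm₀.continuous
  have hm₀'c := hm₀.continuous_deriv le_rfl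
  have hm₀lt : ∀ x, m₀ x < 1 := fun x => (hpt x).1
  have hq : ∀ x, HasDerivAt q (q' x) x := fun x => by
    have d1 : HasDerivAt (fun x => Real.exp (-μ * x)) (Real.exp (-μ * x) * (-μ)) x := by
      simpa using ((hasDerivAt_id x).const_mul (-μ)).exp
    have d2 := (H.hasDerivAt_h _ (hm₀lt x)).comp x (hm₀.differentiable one_ne_zero x).hasDerivAt
    refine (d1.fun_mul d2).congr_deriv ?_
    simp only [hq'def, Function.comp_apply]; ring
  have hhm : Continuous fun x => h (m₀ x) := continuous_iff_continuousAt.2 fun x =>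
    (H.hasDerivAt_h _ (hm₀lt x)).continuousAt.comp hm₀c.continuousAt
  have hhm' : Continuous fun x => h' (m₀ x) := H.continuousOn_h'.comp_continuous hm₀c hm₀lt
  have hq'c : Continuous q' := by
    have he : Continuous fun x => Real.exp (-μ * x) := by fun_prop
    exact he.mul ((hhm'.mul hm₀'c).sub (continuous_const.mul hhm))
  have hqe : ∀ x, q x * Real.exp (μ * x) = h (m₀ x) := fun x => by
    simp only [hqdef]
    rw [mul_right_comm, ← Real.exp_add]; simp
  -- This decay compensates the growth `e^{μ x₋}` of `q'` on the left. For `x₀ ≥ 0` it comes from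
  -- the bound on `z r(z)` and `q ≥ e^{-μ}`; for `x₀ ≤ 0`, from the bound on `r` and `x ≤ x₀ + 1`.
  have hsmall1 : ∀ x₀ x, x - 1 ≤ x₀ → |r (q x₀ * Real.exp (μ * x)) * Real.exp (μ * x)|
      ≤ D * Real.exp μ * Real.exp (-(μ * max (-x₀) 0)) := by
    intro x₀ x hx
    rw [abs_mul, abs_of_pos (Real.exp_pos _)]
    rcases le_total 0 x₀ with h0 | h0
    · rw [max_eq_right (by linarith : -x₀ ≤ 0), mul_zero, neg_zero, Real.exp_zero, mul_one]
      obtain ⟨hq1, -⟩ := (hpt x₀).2.1 h0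
      have hz := hzrD (q x₀ * Real.exp (μ * x))
      have hqpos : 0 < q x₀ := (Real.exp_pos _).trans_le hq1
      rw [abs_mul, abs_of_pos (mul_pos hqpos (Real.exp_pos _))] at hz
      have h2 := mul_le_mul_of_nonneg_right hq1 (mul_nonneg
        (abs_nonneg (r (q x₀ * Real.exp (μ * x)))) (Real.exp_pos (μ * x)).le)
      have h3 : Real.exp (-μ) * (|r (q x₀ * Real.exp (μ * x))| * Real.exp (μ * x)) ≤ D := by
        change _ ≤ q x₀ * _ at h2
        linarith
      rw [Real.exp_neg, inv_mul_le_iff₀ (Real.exp_pos _)] at h3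
      linarith
    · rw [max_eq_left (by linarith : 0 ≤ -x₀), mul_assoc D, ← Real.exp_add]
      exact mul_le_mul (hrD _) (Real.exp_le_exp.2 (by nlinarith)) (Real.exp_pos _).le hD.le
  have hsmall : ∀ x₀ x, x - 1 ≤ x₀ → |q' x₀ * (r (q x₀ * Real.exp (μ * x₀)) * Real.exp (μ * x₀)
      - r (q x₀ * Real.exp (μ * x)) * Real.exp (μ * x))| ≤ β / 2 := by
    intro x₀ x hx
    have h1 := hsmall1 x₀ x hx
    have h2 := hsmall1 x₀ x₀ (by linarith)
    have h3 : |q' x₀| ≤ K * δ * Real.exp (μ * max (-x₀) 0) := (hpt x₀).2.2.2.2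
    rw [abs_mul]
    calc _ ≤ (K * δ * Real.exp (μ * max (-x₀) 0))
          * (2 * (D * Real.exp μ * Real.exp (-(μ * max (-x₀) 0)))) :=
          mul_le_mul h3 ((abs_sub _ _).trans (by linarith)) (abs_nonneg _) (by positivity)
      _ = 2 * (K * (D * Real.exp μ)) * δ := by
          rw [Real.exp_neg]; field_simp
      _ ≤ 2 * (K * (D * Real.exp μ)) * (β / (4 * (K * (D * Real.exp μ)))) :=
          mul_le_mul_of_nonneg_left (min_le_right _ _) (by positivity)
      _ = β / 2 := by field_simp; norm_num
  obtain ⟨ξ, hξ⟩ := exists_characteristic_foot hR hrc hBr hβ0 hβ hβ' hq hq'c hsmall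
  have hqc : ContDiff ℝ 1 q := contDiff_one_iff_deriv.2 ⟨fun z => (hq z).differentiableAt, by
    rwa [show deriv q = q' from funext fun z => (hq z).deriv]⟩
  set Z : ℝ × ℝ → ℝ := fun p => q (ξ p) * Real.exp (μ * p.2) with hZdef
  have hZc : ∀ p, -(β / 2) < p.1 → ContDiffAt ℝ 1 Z p := fun p hp =>
    (hqc.contDiffAt.comp p (hξ p hp).2.1).mul (contDiff_const.mul contDiff_snd).exp.contDiffAt
  have hZd : ∀ p, -(β / 2) < p.1 → DifferentiableAt ℝ Z p := fun p hp =>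
    (hZc p hp).differentiableAt one_ne_zero
  have hE : ∀ p : ℝ × ℝ, HasDerivAt (fun x => Real.exp (μ * x)) (Real.exp (μ * p.2) * μ) p.2 :=
    fun p => by simpa using ((hasDerivAt_id p.2).const_mul μ).exp
  have hZt : ∀ p, -(β / 2) < p.1 → pdt Z p = q' (ξ p) * pdt ξ p * Real.exp (μ * p.2) := by
    intro p hp
    refine (hasDerivAt_pdt (hZd p hp)).unique ?_
    have hξd := hasDerivAt_pdt ((hξ p hp).2.1.differentiableAt one_ne_zero)
    exact ((hq (ξ p)).comp p.1 hξd).mul_const (Real.exp (μ * p.2))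
  have hZx : ∀ p, -(β / 2) < p.1 → pdx Z p
      = Real.exp (μ * p.2) * (q' (ξ p) * pdx ξ p) + μ * Z p := by
    intro p hp
    refine (hasDerivAt_pdx (hZd p hp)).unique ?_
    have hξd := hasDerivAt_pdx ((hξ p hp).2.1.differentiableAt one_ne_zero)
    refine (((hq (ξ p)).comp p.2 hξd).fun_mul (hE p)).congr_deriv ?_
    simp only [hZdef, Function.comp_apply]; ring
  have hvt : ∀ p, -(β / 2) < p.1 → pdt (fun p => G (Z p)) p = G' (Z p) * pdt Z p := fun p hp =>
    pdt_comp (hZd p hp) (H.hasDerivAt_G _)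
  have hvx : ∀ p, -(β / 2) < p.1 → pdx (fun p => G (Z p)) p = G' (Z p) * pdx Z p := fun p hp =>
    pdx_comp (hZd p hp) (H.hasDerivAt_G _)
  have hneg := H.h_neg_eta_nonpos
  have hqlow : ∀ x, 0 ≤ q x ∨ h (-η) ≤ q x * Real.exp (μ * x) := fun x => by
    rcases le_total 0 x with h0 | h0
    · exact Or.inl ((Real.exp_pos _).le.trans ((hpt x).2.1 h0).1)
    · rw [hqe]; exact Or.inr ((hpt x).2.2.1 h0).1
  -- Two slacks are used: `s = 0` at nonnegative times, where the foot lies to the right and the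
  -- chart variable stays above `h(-η)`, and `s = 1` at slightly negative times, where only
  -- boundedness is needed.
  have hlow : ∀ x₀ x s, 0 ≤ s → x ≤ x₀ + s →
      h (-η) * Real.exp (μ * s) ≤ q x₀ * Real.exp (μ * x) := by
    intro x₀ x s hs hx
    rcases hqlow x₀ with h1 | h1
    · exact (mul_nonpos_of_nonpos_of_nonneg hneg (Real.exp_pos _).le).trans
        (mul_nonneg h1 (Real.exp_pos _).le)
    · have e : q x₀ * Real.exp (μ * x)
          = q x₀ * Real.exp (μ * x₀) * Real.exp (μ * (x - x₀)) := by
        rw [mul_assoc (q x₀), ← Real.exp_add]; ring_nf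
      rw [e]
      have h2 : Real.exp (μ * (x - x₀)) ≤ Real.exp (μ * s) :=
        Real.exp_le_exp.2 (mul_le_mul_of_nonneg_left (by linarith) hμ.le)
      calc h (-η) * Real.exp (μ * s) ≤ h (-η) * Real.exp (μ * (x - x₀)) :=
            mul_le_mul_of_nonpos_left h2 hneg
        _ ≤ _ := mul_le_mul_of_nonneg_right h1 (Real.exp_pos _).le
  have hpos : ∀ p : ℝ × ℝ, 0 ≤ p.1 → -(β / 2) < p.1 := fun p hp => by linarith
  have hle : ∀ p : ℝ × ℝ, 0 ≤ p.1 → p.2 ≤ ξ p := fun p hp => by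
    have := (hξ p (hpos p hp)).2.2.2.1 hp
    linarith [div_nonneg hp hβ'0.le]
  have hZlow : ∀ p : ℝ × ℝ, 0 ≤ p.1 → h (-η) ≤ Z p := fun p hp => by
    simpa using hlow (ξ p) p.2 0 le_rfl (by linarith [hle p hp])
  refine ⟨fun p => G (Z p), fun p hp => H.contDiff_G.contDiffAt.comp p (hZc p hp), ?_,
    fun p hp => ?_, fun x => ?_, fun p hp => ⟨ξ p, ?_, fun n hn h0 h1 => ?_⟩⟩
  · refine ⟨max 1 |G (h (-η) * Real.exp (μ * 1))|, fun p hp => abs_le.2 ⟨?_, ?_⟩⟩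
    · have h1 := H.strictMono_G.monotone (hlow (ξ p) p.2 1 zero_le_one
        (by linarith [(hξ p hp).1]))
      change _ ≤ G (Z p) at h1
      linarith [neg_abs_le (G (h (-η) * Real.exp (μ * 1))),
        le_max_right 1 |G (h (-η) * Real.exp (μ * 1))|]
    · exact (H.G_lt_one _).le.trans (le_max_left _ _)
  · have hp' := hpos p hp
    obtain ⟨N, hN, hNt, hNx⟩ := (hξ p hp').2.2.1
    have hN0 : N ≠ 0 := by linarith
    rw [hvt p hp', hvx p hp', hZt p hp', hZx p hp', hNt, hNx, H.reaction_eq (hZlow p hp)]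
    have h1 := haB _ (hZlow p hp)
    have h2 : a (G (Z p)) * (B (Z p) / N) = -N⁻¹ := by
      rw [mul_div_assoc', h1]; field_simp
    change _ + _ * (_ * (_ * (_ * (B (Z p) / N)) + _)) = _
    linear_combination (G' (Z p) * Real.exp (μ * p.2) * q' (ξ p)) * h2
  · have h1 := (hξ (0, x) (by simpa using hβ0)).2.2.2.2 rfl
    simp only [hZdef, h1]
    rw [hqe, H.G_h _ (hm₀lt x)]
  · have := (hξ p (hpos p hp)).2.2.2.1 hp
    rwa [div_eq_inv_mul] at this
  · have hp' := hpos p hp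
    obtain ⟨N, hN, -, hNx⟩ := (hξ p hp').2.2.1
    have hn0 : 0 ≤ n := by
      by_contra hcon
      have := (abs_nonneg _).trans h0
      have := mul_neg_of_neg_of_pos (not_le.1 hcon) (Real.exp_pos (-κ * max (ξ p) 0))
      linarith
    obtain ⟨-, -, -, hq1, hq2⟩ := hint (ξ p) (m₀ (ξ p)) (deriv m₀ (ξ p)) n
      (hn.trans (min_le_left _ _)) h0 h1
    change |q (ξ p) - 1| ≤ _ at hq1
    change |q' (ξ p)| ≤ _ at hq2
    -- Since `x ≤ ξ`, a foot on the left forces `x ≤ 0`; a foot on the right gives `q` within a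
    -- factor `e^{±μ}` of 1.
    have hadm : H.Admissible p.2 (q (ξ p)) := by
      rcases le_total 0 (ξ p) with hx | hx
      · exact Or.inl ((hpt (ξ p)).2.1 hx)
      · have hx' := hle p hp
        refine Or.inr ⟨hx'.trans hx, hZlow p hp, ?_⟩
        have h2 := ((hpt (ξ p)).2.2.1 hx).2
        rw [← hqe] at h2
        rcases le_total 0 (q (ξ p)) with hqs | hqs
        · refine le_trans (mul_le_mul_of_nonneg_left (Real.exp_le_exp.2 ?_) hqs) h2
          exact mul_le_mul_of_nonneg_left hx' hμ.le
        · exact (mul_nonpos_of_nonpos_of_nonneg hqs (Real.exp_pos _).le).trans (Real.exp_pos _).le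
    have hT := tailWeight_pos κ μ p.2
    rw [← exp_mul_tailWeight]
    have hv : |G (Z p) - M p.2| ≤ C₂ * K * n
        * (tailWeight κ μ p.2 * Real.exp (μ * max (-ξ p) 0)) := by
      refine (hGsub p.2 (q (ξ p)) hadm).trans ?_
      refine (mul_le_mul_of_nonneg_left hq1 (by positivity)).trans (le_of_eq ?_)
      ring
    have hW : 0 ≤ n * (tailWeight κ μ p.2 * Real.exp (μ * max (-ξ p) 0)) := by positivity
    constructor
    · refine hv.trans ?_
      have : 0 ≤ (C₂ * K * L + C₁ * K * (2 * β' / β)) *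
        (n * (tailWeight κ μ p.2 * Real.exp (μ * max (-ξ p) 0))) :=
        mul_nonneg (by positivity) hW
      nlinarith
    · have hGη : -η ≤ G (Z p) := (H.le_G_iff H.eta_lt).2 (hZlow p hp)
      -- The space derivative splits into a part driven by `q'` and the profile slope `b/a` at the
      -- perturbed state; the latter is compared with `M' = b/a` at `M` by the Lipschitz bound.
      have hlin : G' (Z p) * (μ * Z p) = b (G (Z p)) / a (G (Z p)) := by
        rw [H.reaction_eq (hZlow p hp), mul_div_cancel_left₀ _
          (H.speed_neg _ hGη (H.G_lt_one _).le).ne]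
        ring
      have h2 := hL (G (Z p)) (M p.2) hGη (H.G_lt_one _).le
        (by linarith [H.front.pos p.2, H.eta_pos]) (H.front.lt_one _).le
      rw [← H.front.deriv_eq, ← hlin] at h2
      have h3 := hG' p.2 (q (ξ p)) hadm
      change G' (Z p) * _ ≤ _ at h3
      have h4 : |pdx ξ p| ≤ 2 * β' / β := by
        rw [hNx, abs_div, abs_of_pos (hβ0.trans_le (hβ _)), abs_of_pos (by linarith : 0 < N),
          div_le_div_iff₀ (by linarith) hβ0]
        nlinarith [hβ' (q (ξ p) * Real.exp (μ * p.2))]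
      have h5 : |G' (Z p) * Real.exp (μ * p.2) * (q' (ξ p) * pdx ξ p)|
          ≤ C₁ * tailWeight κ μ p.2 * (K * n * Real.exp (μ * max (-ξ p) 0) * (2 * β' / β)) := by
        rw [abs_mul, abs_mul (q' _), abs_of_pos (mul_pos (H.G'_pos _) (Real.exp_pos _))]
        gcongr
      have h6 : pdx (fun p => G (Z p)) p - deriv M p.2
          = G' (Z p) * Real.exp (μ * p.2) * (q' (ξ p) * pdx ξ p)
            + (G' (Z p) * (μ * Z p) - deriv M p.2) := by
        rw [hvx p hp', hZx p hp']; ring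
      rw [h6]
      refine (abs_add_le _ _).trans ((add_le_add h5 (h2.trans
        (mul_le_mul_of_nonneg_left hv hL0))).trans ?_)
      have : 0 ≤ (C₂ * K) * (n * (tailWeight κ μ p.2 * Real.exp (μ * max (-ξ p) 0))) :=
        mul_nonneg (by positivity) hW
      nlinarith

end IsFrontChart

/-! ### Back to the original variables. -/

lemma fderiv_eq_pdt_add_pdx (Φ : ℝ × ℝ → ℝ) (p : ℝ × ℝ) (s y : ℝ) :
    fderiv ℝ Φ p (s, y) = s * pdt Φ p + y * pdx Φ p := by
  have : ((s, y) : ℝ × ℝ) = s • ((1, 0) : ℝ × ℝ) + y • ((0, 1) : ℝ × ℝ) := by ext <;> simp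
  rw [this, map_add, map_smul, map_smul]
  rfl

/-- A smooth change of time, trivial for nonnegative times and bounded from below. -/
lemma exists_time_cutoff {ε : ℝ} (hε : 0 < ε) : ∃ τ : ℝ → ℝ, ContDiff ℝ 1 τ ∧ (∀ t, -ε < τ t) ∧
    (∀ t, 0 ≤ t → τ t = t) ∧ ∀ t, 0 ≤ t → HasDerivAt τ 1 t := by
  have hτ : ContDiff ℝ 1 fun t : ℝ => t * Real.smoothTransition (1 + 2 / ε * t) :=
    contDiff_id.mul (Real.smoothTransition.contDiff.comp
      (contDiff_const.add (contDiff_const.mul contDiff_id)))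
  have hpos : ∀ t : ℝ, 0 ≤ t → t * Real.smoothTransition (1 + 2 / ε * t) = t := fun t ht => by
    rw [Real.smoothTransition.one_of_one_le
      (by linarith [mul_nonneg (div_pos two_pos hε).le ht]), mul_one]
  refine ⟨fun t => t * Real.smoothTransition (1 + 2 / ε * t), hτ, fun t => ?_, hpos,
    fun t ht => ?_⟩
  · beta_reduce
    rcases le_total 0 t with ht | ht
    · rw [hpos t ht]; linarith
    · have h1 := Real.smoothTransition.nonneg (1 + 2 / ε * t)
      have h2 := Real.smoothTransition.le_one (1 + 2 / ε * t)
      rcases le_total t (-(ε / 2)) with h | h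
      · rw [Real.smoothTransition.zero_of_nonpos, mul_zero]
        · linarith
        · have := mul_le_mul_of_nonneg_left h (div_pos two_pos hε).le
          have e : 2 / ε * -(ε / 2) = -1 := by field_simp
          linarith
      · nlinarith
  -- At `t = 0` the function is the identity only to the right; differentiability being known, the
  -- right derivative determines the derivative.
  · have h1 := (hτ.differentiable one_ne_zero t).hasDerivAt
    have h2 : HasDerivWithinAt (fun t : ℝ => t * Real.smoothTransition (1 + 2 / ε * t)) 1
        (Ici t) t := (hasDerivWithinAt_id t _).congr (fun s hs => hpos s (ht.trans hs)) (hpos t ht)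
    have h3 := (uniqueDiffWithinAt_Ici t).eq_deriv _ h1.hasDerivWithinAt h2
    rwa [h3] at h1

lemma IsSmoothNoncharacteristicWave.profile_eq {f g U : ℝ → ℝ} {σ um up : ℝ}
    (hf : Differentiable ℝ f) (hU : IsSmoothNoncharacteristicWave f g U σ um up) (x : ℝ) :
    (deriv f (U x) - σ) * deriv U x = g (U x) := by
  have hUd : HasDerivAt U (deriv U x) x := (hU.smooth.differentiable (by simp) x).hasDerivAt
  have h1 := hU.solution.2 0 le_rfl x
  have e1 : HasDerivAt (fun s => U (x - σ * s)) (-σ * deriv U x) 0 := by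
    have d1 : HasDerivAt (fun s : ℝ => x - σ * s) (-σ) 0 := by
      simpa using ((hasDerivAt_id (0 : ℝ)).const_mul σ).const_sub x
    have d2 : HasDerivAt U (deriv U x) (x - σ * 0) := by simpa using hUd
    exact (d2.comp (0 : ℝ) d1).congr_deriv (by ring)
  have e2 : HasDerivAt (fun y => f (U y)) (deriv f (U x) * deriv U x) x :=
    (hf (U x)).hasDerivAt.comp x hUd
  rw [e1.hasDerivWithinAt.derivWithin (uniqueDiffWithinAt_Ici 0)] at h1
  simp only [mul_zero, sub_zero] at h1
  rw [e2.deriv] at h1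
  linarith

/-- Global `C¹` solutions issued from small perturbations of a noncharacteristic wave, with
pointwise control of the perturbation in the moving frame. -/
theorem exists_wave_perturbation {f g U : ℝ → ℝ} {σ um up : ℝ} (hf : ContDiff ℝ ∞ f)
    (hg : ContDiff ℝ ∞ g) (hU : IsSmoothNoncharacteristicWave f g U σ um up)
    (hum : deriv g um < 0) (hup : 0 < deriv g up) :
    ∃ δ C c μ : ℝ, 0 < δ ∧ 0 < C ∧ 0 < c ∧ 0 < μ ∧ ∀ u₀ : ℝ → ℝ, ContDiff ℝ 1 u₀ →
      (∀ x, |u₀ x - U x| ≤ δ * Real.exp (-criticalRate f g σ up * max x 0)) →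
      (∀ x, |deriv u₀ x - deriv U x| ≤ δ * Real.exp (-criticalRate f g σ up * max x 0)) →
      ∃ u : ℝ → ℝ → ℝ, ContDiff ℝ 1 (fun p : ℝ × ℝ => u p.1 p.2) ∧
        (∃ Λ, ∀ t x, |u t x| ≤ Λ) ∧
        (∀ p : ℝ × ℝ, 0 ≤ p.1 → pdt (fun p : ℝ × ℝ => u p.1 p.2) p
          + deriv f (u p.1 p.2) * pdx (fun p : ℝ × ℝ => u p.1 p.2) p = g (u p.1 p.2)) ∧
        (∀ x, u 0 x = u₀ x) ∧
        ∀ t x, 0 ≤ t → ∃ y, x + c * t ≤ y ∧ ∀ n ≤ δ,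
          |u₀ y - U y| ≤ n * Real.exp (-criticalRate f g σ up * max y 0) →
          |deriv u₀ y - deriv U y| ≤ n * Real.exp (-criticalRate f g σ up * max y 0) →
          |u t (x + σ * t) - U x| ≤ C * n * (Real.exp (-criticalRate f g σ up * max x 0)
            * Real.exp (-μ * (max (-x) 0 - max (-y) 0))) ∧
          |deriv (fun x => u t (x + σ * t)) x - deriv U x| ≤ C * n
            * (Real.exp (-criticalRate f g σ up * max x 0)
            * Real.exp (-μ * (max (-x) 0 - max (-y) 0))) := by
  set Δ := up - um with hΔ
  -- The endstates differ because `g'` has opposite signs there, so states can be rescaled to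
  -- `[0,1]`, with reversed orientation if `up < um`.
  have hΔ0 : Δ ≠ 0 := by
    intro h0
    rw [show up = um by linarith [h0]] at hup
    linarith
  have hΔ1 : 0 < |Δ| := abs_pos.2 hΔ0
  have hUd : ∀ x, HasDerivAt U (deriv U x) x := fun x =>
    (hU.smooth.differentiable (by simp) x).hasDerivAt
  set a : ℝ → ℝ := fun m => deriv f (um + Δ * m) - σ with hadef
  set b : ℝ → ℝ := fun m => g (um + Δ * m) / Δ with hbdef
  set M : ℝ → ℝ := fun x => (U x - um) / Δ with hMdef
  have haff : ContDiff ℝ 2 fun m : ℝ => um + Δ * m :=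
    contDiff_const.add (contDiff_const.mul contDiff_id)
  have hf' : ContDiff ℝ 2 (deriv f) := contDiff_infty.1 (contDiff_infty_iff_deriv.1 hf).2 2
  have ha : ContDiff ℝ 2 a := (hf'.comp haff).sub contDiff_const
  have hb : ContDiff ℝ 2 b := ((contDiff_infty.1 hg 2).comp haff).div_const Δ
  have hMd : ∀ x, HasDerivAt M (deriv U x / Δ) x := fun x => ((hUd x).sub_const um).div_const Δ
  have hM : ContDiff ℝ 1 M :=
    ((hU.smooth.of_le (by exact_mod_cast le_top)).sub contDiff_const).div_const Δ
  have hUM : ∀ x, um + Δ * M x = U x := fun x => by simp only [hMdef]; field_simp; ring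
  have hb' : ∀ m, deriv b m = deriv g (um + Δ * m) := by
    intro m
    have d1 : HasDerivAt (fun m : ℝ => um + Δ * m) Δ m := by
      simpa using ((hasDerivAt_id m).const_mul Δ).const_add um
    have d2 := ((hg.differentiable (by simp) _).hasDerivAt.comp m d1).div_const Δ
    refine d2.deriv.trans ?_
    field_simp
  have h1 : um + Δ * 1 = up := by rw [hΔ]; ring
  have h0 : um + Δ * 0 = um := by ring
  have hfront : IsFront a b M := by
    refine isFront_of_profile ha.continuous (hb.of_le (by norm_num)) hM (fun x => ?_) ?_ ?_
      (fun x => ?_) ?_ ?_ ?_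
    · rw [(hMd x).deriv]
      simp only [hadef, hbdef]
      rw [hUM, ← hU.profile_eq (hf.differentiable (by simp))]
      ring
    · simpa using (hU.tendsto_atBot.sub_const um).div_const Δ
    · have := (hU.tendsto_atTop.sub_const um).div_const Δ
      rwa [← hΔ, div_self hΔ0] at this
    · simp only [hadef]
      rw [hUM]; exact sub_ne_zero.2 (hU.noncharacteristic x)
    · simp only [hadef]
      rw [h0]; exact sub_ne_zero.2 hU.noncharacteristic_left
    · simp only [hadef]
      rw [h1]; exact sub_ne_zero.2 hU.noncharacteristic_right
    · rw [hb', h0]; exact hum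
  obtain ⟨η, G, G', h, h', H⟩ := hfront.exists_chart ha hb (by rw [hb', h0]; exact hum)
    (by rw [hb', h1]; exact hup)
  have hκ : deriv b 1 / |a 1| = criticalRate f g σ up := by
    rw [hb', h1]; simp only [hadef]; rw [h1]; rfl
  rw [hκ] at H
  set κ := criticalRate f g σ up
  obtain ⟨δ, C, c, ε, hδ, hC, hc, hε, hsol⟩ := H.exists_solution (ha.of_le (by norm_num))
    (hb.of_le (by norm_num))
  obtain ⟨τ, hτ, hτε, hτid, hτ'⟩ := exists_time_cutoff hε
  refine ⟨δ * |Δ|, C, c, _, by positivity, hC, hc, H.mu_pos, fun u₀ hu₀ hd0 hd1 => ?_⟩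
  have hu₀d : ∀ x, HasDerivAt u₀ (deriv u₀ x) x := fun x =>
    (hu₀.differentiable one_ne_zero x).hasDerivAt
  have hm₀d : ∀ x, deriv (fun x => (u₀ x - um) / Δ) x = deriv u₀ x / Δ := fun x =>
    (((hu₀d x).sub_const um).div_const Δ).deriv
  have hscale : ∀ y n, |u₀ y - U y| ≤ n * Real.exp (-κ * max y 0) →
      |deriv u₀ y - deriv U y| ≤ n * Real.exp (-κ * max y 0) →
      |(u₀ y - um) / Δ - M y| ≤ n / |Δ| * Real.exp (-κ * max y 0) ∧
      |deriv (fun x => (u₀ x - um) / Δ) y - deriv M y| ≤ n / |Δ| * Real.exp (-κ * max y 0) := by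
    intro y n h0 h1
    rw [hm₀d, (hMd y).deriv, ← sub_div, ← sub_div,
      sub_sub_sub_cancel_right, abs_div, abs_div, div_mul_eq_mul_div]
    exact ⟨div_le_div_of_nonneg_right h0 hΔ1.le, div_le_div_of_nonneg_right h1 hΔ1.le⟩
  have hcancel : δ * |Δ| / |Δ| = δ := by field_simp
  obtain ⟨v, hv, ⟨Λ, hΛ⟩, hpde, hv0, hest⟩ := hsol (fun x => (u₀ x - um) / Δ)
    ((hu₀.sub contDiff_const).div_const Δ)
    (fun x => by simpa only [hcancel] using (hscale x _ (hd0 x) (hd1 x)).1)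
    (fun x => by simpa only [hcancel] using (hscale x _ (hd0 x) (hd1 x)).2)
  have hvd : ∀ p : ℝ × ℝ, DifferentiableAt ℝ v (τ p.1, p.2 - σ * p.1) := fun p =>
    (hv _ (hτε p.1)).differentiableAt one_ne_zero
  -- Since `τ` takes values above `-ε`, where `v` is `C¹`, the composition is `C¹` on the whole
  -- plane; for `t ≥ 0` it is the solution in the original frame.
  have hu : ContDiff ℝ 1 fun p : ℝ × ℝ => um + Δ * v (τ p.1, p.2 - σ * p.1) := by
    refine contDiff_const.add (contDiff_const.mul (contDiff_iff_contDiffAt.2 fun p => ?_))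
    have e1 : ContDiff ℝ 1 fun p : ℝ × ℝ => (τ p.1, p.2 - σ * p.1) :=
      (hτ.comp contDiff_fst).prodMk (contDiff_snd.sub (contDiff_const.mul contDiff_fst))
    exact (hv (τ p.1, p.2 - σ * p.1) (hτε p.1)).comp p e1.contDiffAt
  have hud := hu.differentiable one_ne_zero
  refine ⟨fun t x => um + Δ * v (τ t, x - σ * t), hu, ⟨|um| + |Δ| * Λ, fun t x => ?_⟩,
    fun p hp => ?_, fun x => ?_, fun t x ht => ?_⟩
  · refine (abs_add_le _ _).trans ?_
    rw [abs_mul]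
    gcongr
    exact hΛ _ (hτε t)
  · have e1 : pdt (fun p : ℝ × ℝ => um + Δ * v (τ p.1, p.2 - σ * p.1)) p
        = Δ * (pdt v (τ p.1, p.2 - σ * p.1) - σ * pdx v (τ p.1, p.2 - σ * p.1)) := by
      refine (hasDerivAt_pdt (hud p)).unique ?_
      have d1 : HasDerivAt (fun s : ℝ => p.2 - σ * s) (-σ) p.1 := by
        simpa using ((hasDerivAt_id p.1).const_mul σ).const_sub p.2
      have d2 := (hvd p).hasFDerivAt.comp_hasDerivAt p.1 ((hτ' p.1 hp).prodMk d1)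
      refine ((d2.const_mul Δ).const_add um).congr_deriv ?_
      rw [fderiv_eq_pdt_add_pdx]
      ring
    have e2 : pdx (fun p : ℝ × ℝ => um + Δ * v (τ p.1, p.2 - σ * p.1)) p
        = Δ * pdx v (τ p.1, p.2 - σ * p.1) := by
      refine (hasDerivAt_pdx (hud p)).unique ?_
      have d1 : HasDerivAt (fun y : ℝ => y - σ * p.1) 1 p.2 := (hasDerivAt_id p.2).sub_const _
      have d2 := (hvd p).hasFDerivAt.comp_hasDerivAt p.2 ((hasDerivAt_const p.2 (τ p.1)).prodMk d1)
      refine ((d2.const_mul Δ).const_add um).congr_deriv ?_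
      rw [fderiv_eq_pdt_add_pdx]
      ring
    have e3 := hpde (τ p.1, p.2 - σ * p.1) (by rw [hτid _ hp]; exact hp)
    simp only [hadef, hbdef] at e3
    rw [eq_div_iff hΔ0] at e3
    rw [e1, e2]
    linear_combination e3
  · have := hv0 x
    beta_reduce
    rw [hτid 0 le_rfl, mul_zero, sub_zero, this]
    field_simp
    ring
  · obtain ⟨y, hy, hyn⟩ := hest (t, x) ht
    refine ⟨y, hy, fun n hn h0 h1 => ?_⟩
    obtain ⟨s0, s1⟩ := hscale y n h0 h1
    obtain ⟨r0, r1⟩ := hyn (n / |Δ|) ((div_le_iff₀ hΔ1).2 hn) s0 s1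
    have hvd' : DifferentiableAt ℝ v (t, x) := by
      have := hvd (t, x + σ * t)
      rwa [hτid t ht, add_sub_cancel_right] at this
    have e1 : deriv (fun x => um + Δ * v (τ t, x + σ * t - σ * t)) x = Δ * pdx v (t, x) := by
      simp only [hτid t ht, add_sub_cancel_right]
      exact (((hasDerivAt_pdx hvd').const_mul Δ).const_add um).deriv
    have hfin : ∀ r s w, |r - s| ≤ C * (n / |Δ|) * w → |Δ * (r - s)| ≤ C * n * w := by
      intro r s w hrs
      rw [abs_mul]
      refine (mul_le_mul_of_nonneg_left hrs hΔ1.le).trans (le_of_eq ?_)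
      field_simp
    rw [e1]
    constructor
    · have := hfin _ _ _ r0
      beta_reduce
      rw [hτid t ht, add_sub_cancel_right, ← hUM x]
      rwa [show um + Δ * v (t, x) - (um + Δ * M x) = Δ * (v (t, x) - M x) by ring]
    · have := hfin _ _ _ r1
      rw [(hMd x).deriv] at this
      rwa [mul_sub, mul_div_cancel₀ _ hΔ0] at this

/-! ### Weighted norms and transport of sub-exponential weights. -/

lemma weightedNorm_le {w v : ℝ → ℝ} (hw : ∀ x, 0 < w x) {K : ℝ}
    (h0 : ∀ x, |v x| ≤ K * w x) (h1 : ∀ x, |deriv v x| ≤ K * w x) :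
    weightedNorm w v ≤ ENNReal.ofReal K := by
  unfold weightedNorm
  rw [eLpNorm_exponent_top]
  refine eLpNormEssSup_le_of_ae_bound (Eventually.of_forall fun x => ?_)
  rw [norm_smul, norm_inv, Real.norm_eq_abs, abs_of_pos (hw x), Prod.norm_def,
    inv_mul_le_iff₀ (hw x), mul_comm]
  exact max_le (h0 x) (h1 x)

lemma ae_le_of_weightedNorm_le {w v : ℝ → ℝ} (hw : ∀ x, 0 < w x) {K : ℝ} (hK : 0 ≤ K)
    (h : weightedNorm w v ≤ ENNReal.ofReal K) :
    ∀ᵐ x, |v x| ≤ K * w x ∧ |deriv v x| ≤ K * w x := by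
  unfold weightedNorm at h
  rw [eLpNorm_exponent_top] at h
  filter_upwards [ae_le_eLpNormEssSup (f := fun x => (w x)⁻¹ • (v x, deriv v x)) (μ := volume)]
    with x hx
  have h2 := hx.trans h
  rw [← ofReal_norm, ENNReal.ofReal_le_ofReal_iff hK, norm_smul, norm_inv,
    Real.norm_eq_abs, abs_of_pos (hw x), Prod.norm_def, inv_mul_le_iff₀ (hw x), mul_comm] at h2
  exact ⟨(le_max_left _ _).trans h2, (le_max_right _ _).trans h2⟩

/-- A strict failure at `x` persists on an open set meeting every right neighbourhood of `x`, hence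
on a set of positive measure. The one-sided form suits weights that are merely monotone. -/
lemma le_of_ae_le_right {F W : ℝ → ℝ} (hF : Continuous F) (hW : Continuous W) {x : ℝ}
    (h : ∀ᵐ s, x < s → F s ≤ W s) : F x ≤ W x := by
  by_contra hcon
  have hU : IsOpen {s | W s < F s} := isOpen_lt hW hF
  have hne : ({s | W s < F s} ∩ Ioi x).Nonempty := by
    have h1 : {s | W s < F s} ∈ 𝓝[>] x := mem_nhdsWithin_of_mem_nhds (hU.mem_nhds (not_le.1 hcon))
    exact Filter.nonempty_of_mem (inter_mem h1 self_mem_nhdsWithin)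
  have hpos := (hU.inter isOpen_Ioi).measure_pos volume hne
  have hzero : volume ({s | W s < F s} ∩ Ioi x) = 0 :=
    measure_mono_null (t := {s | ¬(x < s → F s ≤ W s)})
      (fun s hs hle => absurd (hle hs.2) (not_le.2 hs.1)) (ae_iff.1 h)
  exact hpos.ne' hzero

lemma expWeightPos_pos (κ x : ℝ) : 0 < expWeightPos κ x := Real.exp_pos _

lemma continuous_expWeightPos (κ : ℝ) : Continuous (expWeightPos κ) := by
  unfold expWeightPos expWeight
  fun_prop

lemma le_of_normExp_le {κ : ℝ} {v : ℝ → ℝ} (hv : ContDiff ℝ 1 v) {K : ℝ} (hK : 0 ≤ K)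
    (h : normExp κ v ≤ ENNReal.ofReal K) (x : ℝ) :
    |v x| ≤ K * expWeightPos κ x ∧ |deriv v x| ≤ K * expWeightPos κ x := by
  have h1 := ae_le_of_weightedNorm_le (expWeightPos_pos κ) hK h
  have hw := (continuous_expWeightPos κ).const_mul K
  exact ⟨le_of_ae_le_right hv.continuous.abs hw (h1.mono fun s hs _ => hs.1),
    le_of_ae_le_right (hv.continuous_deriv le_rfl).abs hw (h1.mono fun s hs _ => hs.2)⟩

/-- `ρ` may jump, so an almost everywhere bound does not pass to a point by continuity; to the right
of `x`, however, `ρ` is at most its value at `x`, which can be frozen. -/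
lemma le_of_normExpRho_le {κ : ℝ} {ρ v : ℝ → ℝ} (hρ : IsSubexponentialWeight ρ)
    (hv : ContDiff ℝ 1 v) {K : ℝ} (hK : 0 ≤ K) (h : normExpRho κ ρ v ≤ ENNReal.ofReal K) (x : ℝ) :
    |v x| ≤ K * ρ (max x 0) * expWeightPos κ x ∧
      |deriv v x| ≤ K * ρ (max x 0) * expWeightPos κ x := by
  have h1 := ae_le_of_weightedNorm_le
    (fun x => mul_pos (hρ.pos _ (le_max_right x 0)) (expWeightPos_pos κ x)) hK h
  have hw := (continuous_expWeightPos κ).const_mul (K * ρ (max x 0))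
  have h2 : ∀ s, x < s → K * (ρ (max s 0) * expWeightPos κ s)
      ≤ K * ρ (max x 0) * expWeightPos κ s := fun s hs => by
    rw [← mul_assoc]
    refine mul_le_mul_of_nonneg_right (mul_le_mul_of_nonneg_left ?_ hK) (expWeightPos_pos κ s).le
    exact hρ.antitone (mem_Ici.2 (le_max_right _ _)) (mem_Ici.2 (le_max_right _ _))
      (max_le_max_right 0 hs.le)
  exact ⟨le_of_ae_le_right hv.continuous.abs hw (h1.mono fun s hs hxs => hs.1.trans (h2 s hxs)),
    le_of_ae_le_right (hv.continuous_deriv le_rfl).abs hw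
      (h1.mono fun s hs hxs => hs.2.trans (h2 s hxs))⟩

/-- Characteristics starting at a bounded position have moved far to the left. -/
lemma sub_le_negPart_sub {x y Y s : ℝ} (hY : 0 ≤ Y) (hy : y ≤ Y) (h : x + s ≤ y) :
    s - Y ≤ max (-x) 0 - max (-y) 0 := by
  have h1 := le_max_left (-x) 0
  rcases le_total 0 y with h0 | h0
  · rw [max_eq_right (by linarith : -y ≤ 0)]; linarith
  · rw [max_eq_left (by linarith : 0 ≤ -y)]; linarith

lemma exp_negPart_sub_le_one {μ x y : ℝ} (hμ : 0 < μ) (h : x ≤ y) :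
    Real.exp (-μ * (max (-x) 0 - max (-y) 0)) ≤ 1 := by
  have := max_le_max_right 0 (neg_le_neg h)
  exact Real.exp_le_one_iff.2 (by nlinarith)

/-- If `y ≥ ct/2`, monotonicity of `ρ` suffices. Otherwise `x` lies at least `ct/2` further left
than the negative part of `y`, and the factor `e^{-μct/2}` is dominated by `ρ(θt)` through the
exponential lower bound on `ρ`. -/
lemma IsSubexponentialWeight.exists_transport_bound {ρ : ℝ → ℝ} (hρ : IsSubexponentialWeight ρ)
    {c μ : ℝ} (hc : 0 < c) (hμ : 0 < μ) :
    ∃ C θ, 0 < C ∧ 0 < θ ∧ ∀ t x y, 0 ≤ t → x + c * t ≤ y →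
      ρ (max y 0) * Real.exp (-μ * (max (-x) 0 - max (-y) 0)) ≤ C * ρ (θ * t) := by
  obtain ⟨a, A, ha, hA, hlow⟩ := hρ.lower_bound
  have h00 := hρ.pos 0 le_rfl
  -- The first bound on `θ` serves the case `y ≥ ct/2`; the second gives `aθ ≤ μc/2` for the
  -- exponential case.
  refine ⟨max 1 (ρ 0 / A), min (c / 2) (μ * c / (2 * a)), lt_max_of_lt_left one_pos,
    lt_min (by positivity) (by positivity), fun t x y ht hxy => ?_⟩
  set θ := min (c / 2) (μ * c / (2 * a))
  have hθ1 : θ ≤ c / 2 := min_le_left _ _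
  have hθ2 : a * θ ≤ μ * c / 2 := by
    have := mul_le_mul_of_nonneg_left (min_le_right (c / 2) (μ * c / (2 * a))) ha.le
    refine this.trans (le_of_eq ?_)
    field_simp
  have hθ0 : 0 ≤ θ := le_min (by positivity) (by positivity)
  have hct : 0 ≤ c * t := by positivity
  have hρθ := hρ.pos (θ * t) (by positivity)
  rcases le_total (c * t / 2) y with h | h
  · have h1 : ρ (max y 0) ≤ ρ (θ * t) := by
      refine hρ.antitone (mem_Ici.2 (by positivity)) (le_max_right y 0) ?_
      refine le_trans ?_ (le_max_left y 0)
      nlinarith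
    calc _ ≤ ρ (θ * t) * 1 := mul_le_mul h1 (exp_negPart_sub_le_one hμ (by linarith))
          (Real.exp_pos _).le hρθ.le
      _ ≤ _ := by rw [mul_comm]; exact mul_le_mul_of_nonneg_right (le_max_left _ _) hρθ.le
  · have h1 : ρ (max y 0) ≤ ρ 0 :=
      hρ.antitone (mem_Ici.2 le_rfl) (le_max_right y 0) (le_max_right y 0)
    have h2 := sub_le_negPart_sub (by positivity) h hxy
    have h3 : Real.exp (-μ * (max (-x) 0 - max (-y) 0)) ≤ Real.exp (-a * (θ * t)) := by
      refine Real.exp_le_exp.2 ?_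
      have := mul_le_mul_of_nonneg_left h2 hμ.le
      have := mul_le_mul_of_nonneg_right hθ2 ht
      nlinarith
    have h4 := hlow (θ * t) (by positivity)
    calc _ ≤ ρ 0 * Real.exp (-a * (θ * t)) := mul_le_mul h1 h3 (Real.exp_pos _).le h00.le
      _ = ρ 0 / A * (A * Real.exp (-a * (θ * t))) := by field_simp
      _ ≤ ρ 0 / A * ρ (θ * t) := mul_le_mul_of_nonneg_left h4 (by positivity)
      _ ≤ _ := mul_le_mul_of_nonneg_right (le_max_right _ _) hρθ.le

lemma isClassicalSolution_of_contDiff {f g : ℝ → ℝ} (hf : Differentiable ℝ f) {u : ℝ → ℝ → ℝ}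
    (hu : ContDiff ℝ 1 (fun p : ℝ × ℝ => u p.1 p.2))
    (hpde : ∀ p : ℝ × ℝ, 0 ≤ p.1 → pdt (fun p : ℝ × ℝ => u p.1 p.2) p
      + deriv f (u p.1 p.2) * pdx (fun p : ℝ × ℝ => u p.1 p.2) p = g (u p.1 p.2)) :
    IsClassicalSolution f g u := by
  refine ⟨hu.contDiffOn, fun t ht x => ?_⟩
  have hd := hu.differentiable one_ne_zero (t, x)
  have h1 := hasDerivAt_pdt hd
  have h2 := (hf (u t x)).hasDerivAt.comp x (hasDerivAt_pdx hd)
  rw [h1.hasDerivWithinAt.derivWithin (uniqueDiffOn_Ici 0 t ht), ← hpde (t, x) ht]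
  congr 1
  exact h2.deriv

end BalanceLaw

/-! ### The stability theorem. -/

open BalanceLaw in
theorem theorem2p2
    (f g : ℝ → ℝ) (hf : ContDiff ℝ ∞ f) (hg : ContDiff ℝ ∞ g)
    (U : ℝ → ℝ) (σ um up : ℝ)
    (hU : BalanceLaw.IsSmoothNoncharacteristicWave f g U σ um up)
    (hum : deriv g um < 0) (hup : 0 < deriv g up)
    (κ : ℝ) (hκ : κ = BalanceLaw.criticalRate f g σ up) :
    ∃ δ₀ : ℝ, 0 < δ₀ ∧
      ∀ ρ : ℝ → ℝ, BalanceLaw.IsSubexponentialWeight ρ →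
        ∃ C θ : ℝ, 0 < C ∧ 0 < θ ∧
          ∀ u₀ : ℝ → ℝ, BalanceLaw.IsBUC1 u₀ →
            BalanceLaw.IsBUC (fun x => (u₀ x - U x) / BalanceLaw.expWeightPos κ x) →
            BalanceLaw.IsBUC
              (fun x => deriv (fun y => u₀ y - U y) x / BalanceLaw.expWeightPos κ x) →
            BalanceLaw.normExp κ (fun x => u₀ x - U x) ≤ ENNReal.ofReal δ₀ →
            ∃ u : ℝ → ℝ → ℝ,
              -- `u` is a global classical solution starting from `u₀`
              BalanceLaw.IsClassicalSolution f g u ∧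
              (∀ x, u 0 x = u₀ x) ∧
              -- and it is the unique entropy solution
              BalanceLaw.IsEntropySolution f g u₀ u ∧
              (∀ w : ℝ → ℝ → ℝ, BalanceLaw.IsEntropySolution f g u₀ w →
                ∀ᵐ p ∂((volume : Measure (ℝ × ℝ)).restrict (Ioi 0 ×ˢ univ)),
                  w p.1 p.2 = u p.1 p.2) ∧
              -- convergence without rate
              (Tendsto
                  (fun x => Real.exp (κ * x) • (u₀ x - U x, deriv (fun y => u₀ y - U y) x))
                  atTop (𝓝 ((0 : ℝ), (0 : ℝ))) →
                Tendsto
                  (fun t => BalanceLaw.normExp κ (fun x => u t (x + σ * t) - U x))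
                  atTop (𝓝 0)) ∧
              -- convergence with rate
              (BalanceLaw.normExpRho κ ρ (fun x => u₀ x - U x) < ⊤ →
                ∀ t : ℝ, 0 ≤ t →
                  BalanceLaw.normExp κ (fun x => u t (x + σ * t) - U x)
                    ≤ ENNReal.ofReal C *
                        BalanceLaw.normExpRho κ ρ (fun x => u₀ x - U x) *
                        ENNReal.ofReal (ρ (θ * t))) := by
  subst hκ
  obtain ⟨δ, C, c, μ, hδ, hC, hc, hμ, hsol⟩ := exists_wave_perturbation hf hg hU hum hup
  set κ := criticalRate f g σ up
  refine ⟨δ, hδ, fun ρ hρ => ?_⟩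
  obtain ⟨C', θ, hC', hθ, htransport⟩ := hρ.exists_transport_bound hc hμ
  refine ⟨C * C', θ, by positivity, hθ, fun u₀ hu₀ _ _ hsmall => ?_⟩
  have hu₀1 := hu₀.1
  have hU1 : ContDiff ℝ 1 U := contDiff_infty.1 hU.smooth 1
  have hdiff : ContDiff ℝ 1 fun x => u₀ x - U x := hu₀1.sub hU1
  have hdiff' : ∀ x, deriv (fun y => u₀ y - U y) x = deriv u₀ x - deriv U x := fun x =>
    deriv_fun_sub (hu₀1.differentiable one_ne_zero x) (hU1.differentiable one_ne_zero x)
  have hbd := le_of_normExp_le hdiff hδ.le hsmall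
  obtain ⟨u, hu, ⟨Λ, hΛ⟩, hpde, hu0, hest⟩ := hsol u₀ hu₀1 (fun x => (hbd x).1)
    (fun x => by rw [← hdiff']; exact (hbd x).2)
  have hu0' : u 0 = u₀ := funext hu0
  have hshift : ∀ t x, deriv (fun x => u t (x + σ * t) - U x) x
      = deriv (fun x => u t (x + σ * t)) x - deriv U x := fun t x => by
    refine deriv_fun_sub ?_ (hU1.differentiable one_ne_zero x)
    have h1 : DifferentiableAt ℝ (fun x : ℝ => (t, x + σ * t)) x := by fun_prop
    exact DifferentiableAt.comp (g := fun p : ℝ × ℝ => u p.1 p.2) x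
      (hu.differentiable one_ne_zero (t, x + σ * t)) h1
  -- weighted size of the initial perturbation
  set E : ℝ → ℝ := fun y => (expWeightPos κ y)⁻¹
    * max |u₀ y - U y| |deriv (fun y => u₀ y - U y) y| with hE
  have hE_le : ∀ y n, |u₀ y - U y| ≤ n * expWeightPos κ y →
      |deriv (fun y => u₀ y - U y) y| ≤ n * expWeightPos κ y → E y ≤ n := fun y n h0 h1 => by
    simp only [hE]
    rw [inv_mul_le_iff₀ (expWeightPos_pos κ y), mul_comm]
    exact max_le h0 h1
  have hE0 : ∀ y, 0 ≤ E y := fun y => mul_nonneg (inv_pos.2 (expWeightPos_pos κ y)).le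
    ((abs_nonneg _).trans (le_max_left _ _))
  have hEδ : ∀ y, E y ≤ δ := fun y => hE_le y δ (hbd y).1 (hbd y).2
  have hEw : ∀ y, E y * expWeightPos κ y
      = max |u₀ y - U y| |deriv (fun y => u₀ y - U y) y| := fun y => by
    simp only [hE]
    rw [mul_right_comm, inv_mul_cancel₀ (expWeightPos_pos κ y).ne', one_mul]
  -- The pointwise estimate is used with `n = E y`, the smallest admissible size at the foot. As the
  -- foot is known only through `y ≥ x + ct`, the bound is required for all such `y`.
  have hmain : ∀ t, 0 ≤ t → ∀ K, (∀ x y, x + c * t ≤ y →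
      C * (E y * Real.exp (-μ * (max (-x) 0 - max (-y) 0))) ≤ K) →
      normExp κ (fun x => u t (x + σ * t) - U x) ≤ ENNReal.ofReal K := by
    intro t ht K hK
    have hx : ∀ x, |u t (x + σ * t) - U x| ≤ K * expWeightPos κ x ∧
        |deriv (fun x => u t (x + σ * t) - U x) x| ≤ K * expWeightPos κ x := by
      intro x
      obtain ⟨y, hy, hyn⟩ := hest t x ht
      obtain ⟨r0, r1⟩ := hyn (E y) (hEδ y) ((le_max_left _ _).trans (hEw y).ge)
        (by rw [← hdiff']; exact (le_max_right _ _).trans (hEw y).ge)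
      have hle : C * E y * (expWeightPos κ x * Real.exp (-μ * (max (-x) 0 - max (-y) 0)))
          ≤ K * expWeightPos κ x := by
        refine le_trans (le_of_eq ?_)
          (mul_le_mul_of_nonneg_right (hK x y hy) (expWeightPos_pos κ x).le)
        ring
      rw [hshift]
      exact ⟨r0.trans hle, r1.trans hle⟩
    exact weightedNorm_le (expWeightPos_pos κ) (fun x => (hx x).1) fun x => (hx x).2
  have hf2 : ContDiff ℝ 2 f := contDiff_infty.1 hf 2
  have hg1 : ContDiff ℝ 1 g := contDiff_infty.1 hg 1
  refine ⟨u, isClassicalSolution_of_contDiff (hf.differentiable (by simp)) hu hpde, hu0, ?_, ?_,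
    fun hlim => ?_, fun hfin t ht => ?_⟩
  · rw [← hu0']
    exact isEntropySolution_of_contDiff (hf2.of_le (by norm_num)) hg.continuous hu hΛ
      fun p hp => hpde p hp.le
  · intro w hw
    rw [← hu0'] at hw
    exact ae_eq_of_isEntropySolution hf2 hg1 hu hΛ (fun p hp => hpde p hp.le) hw
  · refine ENNReal.tendsto_nhds_zero.2 fun e he => ?_
    obtain ⟨e', he', hee⟩ := ENNReal.lt_iff_exists_nnreal_btwn.1 he
    have he'0 : 0 < (e' : ℝ) := by exact_mod_cast he'
    have hElim : ∀ᶠ y in atTop, E y < e' / C := by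
      have h0 : ‖((0 : ℝ), (0 : ℝ))‖ < e' / C := by simpa using div_pos he'0 hC
      have h1 := hlim.norm.eventually (gt_mem_nhds h0)
      filter_upwards [h1, eventually_ge_atTop 0] with y hy hy0
      rw [norm_smul, Prod.norm_def, Real.norm_eq_abs, abs_of_pos (Real.exp_pos _)] at hy
      have : (expWeightPos κ y)⁻¹ = Real.exp (κ * y) := by
        rw [expWeightPos, expWeight, max_eq_left hy0, ← Real.exp_neg]; ring_nf
      simp only [hE]
      rw [this]
      exact hy
    obtain ⟨Y, hY0, hY⟩ : ∃ Y, 0 ≤ Y ∧ ∀ y, Y ≤ y → E y < e' / C := by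
      obtain ⟨Y, hY⟩ := eventually_atTop.1 hElim
      exact ⟨max Y 0, le_max_right _ _, fun y hy => hY y ((le_max_left _ _).trans hy)⟩
    -- For feet to the left of `Y` only `E ≤ δ` is available, and smallness comes from the
    -- exponential factor; to the right of `Y` it comes from `E` itself.
    have hdecay : Tendsto (fun t => C * (δ * Real.exp (-μ * (c * t - Y)))) atTop (𝓝 0) := by
      have h1 : Tendsto (fun t => μ * (c * t - Y)) atTop atTop :=
        ((tendsto_id.const_mul_atTop hc).atTop_add tendsto_const_nhds).const_mul_atTop hμ
      have h2 := ((Real.tendsto_exp_neg_atTop_nhds_zero.comp h1).const_mul δ).const_mul C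
      simpa [Function.comp_def] using h2
    filter_upwards [hdecay.eventually (gt_mem_nhds he'0), eventually_ge_atTop 0] with t ht ht0
    refine le_trans (hmain t ht0 e' fun x y hxy => ?_) (by simpa using hee.le)
    have hxy' : x ≤ y := by linarith [mul_nonneg hc.le ht0]
    rcases le_total Y y with h | h
    · have h1 := mul_le_mul (hY y h).le (exp_negPart_sub_le_one hμ hxy') (Real.exp_pos _).le
        (div_pos he'0 hC).le
      rw [mul_one, le_div_iff₀' hC] at h1
      exact h1
    · have h1 : Real.exp (-μ * (max (-x) 0 - max (-y) 0)) ≤ Real.exp (-μ * (c * t - Y)) := by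
        refine Real.exp_le_exp.2 ?_
        nlinarith [sub_le_negPart_sub hY0 h hxy]
      refine le_trans ?_ ht.le
      exact mul_le_mul_of_nonneg_left (mul_le_mul (hEδ y) h1 (Real.exp_pos _).le hδ.le) hC.le
  · set K := (normExpRho κ ρ (fun x => u₀ x - U x)).toReal with hK
    have hKe : ENNReal.ofReal K = normExpRho κ ρ (fun x => u₀ x - U x) :=
      ENNReal.ofReal_toReal hfin.ne
    have hK0 : 0 ≤ K := ENNReal.toReal_nonneg
    have hρbd := le_of_normExpRho_le hρ hdiff hK0 hKe.ge
    rw [← hKe, ← ENNReal.ofReal_mul (by positivity), ← ENNReal.ofReal_mul (by positivity)]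
    refine hmain t ht _ fun x y hxy => ?_
    have h1 := hE_le y (K * ρ (max y 0)) (hρbd y).1 (hρbd y).2
    calc C * (E y * Real.exp (-μ * (max (-x) 0 - max (-y) 0)))
        ≤ C * (K * ρ (max y 0) * Real.exp (-μ * (max (-x) 0 - max (-y) 0))) := by gcongr
      _ = C * K * (ρ (max y 0) * Real.exp (-μ * (max (-x) 0 - max (-y) 0))) := by ring
      _ ≤ C * K * (C' * ρ (θ * t)) :=
          mul_le_mul_of_nonneg_left (htransport t x y ht hxy) (by positivity)
      _ = _ := by ring
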